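/- **Lemma 5.2 (Estimates on the flow).** Let $T>0$ and let $\Omega\subset\mathbb R^d$ be a bounded open polytopal set, that is, the interior of a finite union of closed convex polyhedra. Let $\mathcal M$ be a polytopal mesh of $\Omega$: finitely many non-empty, pairwise disjoint, open polytopal cells contained in $\Omega$, whose closures cover $\Omega$. Let $\phi:\Omega\to\mathbb R$ be piecewise smooth on $\mathcal M$ (on each cell it is the restriction of a $C^\infty$ function on $\mathbb R^d$) with $0<\phi_*\le\phi\le\phi^*$. Let $\mathbf V\in H_{\rm div}(\Omega)$ be piecewise polynomial on $\mathcal M$, with $|{\rm div}\,\mathbf V|\le\Gamma_{\rm div}$ a.e. in $\Omega$ and $\mathbf V\cdot\mathbf n=0$ on $\partial\Omega$, i.e. $\int_\Omega(\mathbf V\cdot\nabla\psi+\psi\,{\rm div}\,\mathbf V)=0$ for all $\psi\in C_c^\infty(\mathbb R^d)$. Let $F$ be the flow of $\mathbf V/\phi$ on $[-T,T]$: there is a relatively closed set $\mathcal C\subset\Omega$ of zero Lebesgue measure such that, for each $x\in\Omega\setminus\mathcal C$, the map $t\mapsto F_t(x)\in\Omega$ is Lipschitz continuous on $[-T,T]$,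 $F_0(x)=x$ and, for all $t\in[-T,T]$ except at most countably many, $F_t(x)$ lies in an (open) cell and $\frac{d}{dt}F_t(x)=\frac{\mathbf V(F_t(x))}{\phi(F_t(x))}$. Denote by $JF_t$ the Jacobian determinant of $F_t$, and set $$C_1(s)=\frac{\phi^*}{\phi_*}\exp\Big(\frac{\Gamma_{\rm div}}{\phi_*}|s|\Big).$$ 1. For a.e. $x\in\Omega$ the set of times $s\in[-T,T]$ at which $F_s(x)$ does not lie in a cell is at most countable and, for all other $s\in[-T,T]$, the map $F_s$ is differentiable at $x$, the integral below converges absolutely, and $$\int_0^s|JF_t(x)|\,({\rm div}\,\mathbf V)(F_t(x))\,dt=\phi(F_s(x))\,|JF_s(x)|-\phi(x),\qquad |JF_s(x)|\le C_1(s).$$ Moreover, for each $s\in[-T,T]$, the point $F_s(x)$ lies in a cell for a.e. $x\in\Omega$; hence, for each $s\in[-T,T]$, these relations hold for a.e. $x\in\Omega$. 2. Let $w\ge0$ be a solution of $\phi\,\partial_tw+\mathbf V\cdot\nabla w=0$, that is, $w(\cdot,t)$ is measurable for each $t\in[-T,T]$ and, for all $s,t\in[-T,T]$ with $s-t\in[-T,T]$,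 $w(x,t)=w(F_{s-t}(x),s)$ for a.e. $x\in\Omega$. Then, for all $s,t\in[-T,T]$ with $s-t\in[-T,T]$ (the integrals being possibly infinite), $$\int_\Omega\phi(x)w(x,t-s)\,dx\le\Big(1+\frac{\Gamma_{\rm div}C_1(T)}{\phi_*}|s|\Big)\int_\Omega\phi(x)w(x,t)\,dx$$ and $$\int_\Omega w(x,t-s)\,dx\le\frac{C_1(T)}{\phi_*}\int_\Omega\phi(x)w(x,t)\,dx.$$ -/

import Mathlib

open scoped ContDiff

namespace EllamFlow

/-- The Euclidean space `ℝ^d`. -/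
abbrev Sp (d : ℕ) : Type := EuclideanSpace ℝ (Fin d)

/-- Open polytopal set (open polygon, polyhedron, ...; not necessarily convex or connected):
a bounded set which is the interior of a finite union of closed convex polyhedra, each of these
being a finite intersection of closed half-spaces `{x | ⟪h.1, x⟫ ≤ h.2}`. -/
def IsPolytopal {d : ℕ} (K : Set (Sp d)) : Prop :=
  Bornology.IsBounded K ∧
    ∃ S : Finset (Finset (Sp d × ℝ)),
      K = interior (⋃ P ∈ S, {x : Sp d | ∀ h ∈ P, inner ℝ h.1 x ≤ h.2})

/-- A polytopal mesh of `Ω`: finitely many non-empty disjoint open polytopal cells contained in `Ω`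
whose closures cover `Ω`. -/
structure IsMesh {d : ℕ} (Ω : Set (Sp d)) (M : Set (Set (Sp d))) : Prop where
  finite : M.Finite
  polytopal : ∀ K ∈ M, IsPolytopal K
  nonempty : ∀ K ∈ M, K.Nonempty
  disjoint : M.PairwiseDisjoint id
  subset : ∀ K ∈ M, K ⊆ Ω
  cover : Ω ⊆ ⋃ K ∈ M, closure K

/-- `φ` is piecewise smooth on the mesh: on each cell it is the restriction of a `C^∞` function
on `ℝ^d` (smoothness up to the boundary of the cell). The values of `φ` outside of the cells are
not constrained. -/
def IsPiecewiseSmooth {d : ℕ} (M : Set (Set (Sp d))) (φ : Sp d → ℝ) : Prop :=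
  ∀ K ∈ M, ∃ g : Sp d → ℝ, ContDiff ℝ ∞ g ∧ Set.EqOn φ g K

/-- `V` is piecewise polynomial on the mesh. The values of `V` outside of the cells are not
constrained. -/
def IsPiecewisePolynomial {d : ℕ} (M : Set (Set (Sp d))) (V : Sp d → Sp d) : Prop :=
  ∀ K ∈ M, ∀ i : Fin d, ∃ p : MvPolynomial (Fin d) ℝ,
    ∀ x ∈ K, V x i = MvPolynomial.eval (fun j => x j) p

/-- `V ∈ H_div(Ω)` with weak divergence `D`. Here `fderiv ℝ ψ x (V x)` is `∇ψ(x) · V(x)`. -/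
structure IsHDiv {d : ℕ} (Ω : Set (Sp d)) (V : Sp d → Sp d) (D : Sp d → ℝ) : Prop where
  memLp_field : MeasureTheory.MemLp V 2 (MeasureTheory.volume.restrict Ω)
  memLp_div : MeasureTheory.MemLp D 2 (MeasureTheory.volume.restrict Ω)
  weak_div : ∀ ψ : Sp d → ℝ, ContDiff ℝ ∞ ψ → HasCompactSupport ψ → tsupport ψ ⊆ Ω →
    ∫ x in Ω, fderiv ℝ ψ x (V x) = - ∫ x in Ω, ψ x * D x

/-- `V · n = 0` on `∂Ω`, for a field `V ∈ H_div(Ω)` with weak divergence `D`: the normal trace,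
defined by Stokes' formula, vanishes. Test functions do not have to vanish on `∂Ω`. -/
def HasZeroNormalTrace {d : ℕ} (Ω : Set (Sp d)) (V : Sp d → Sp d) (D : Sp d → ℝ) : Prop :=
  ∀ ψ : Sp d → ℝ, ContDiff ℝ ∞ ψ → HasCompactSupport ψ →
    ∫ x in Ω, (fderiv ℝ ψ x (V x) + ψ x * D x) = 0

/-- Standing assumptions on the domain, the mesh, the porosity `φ` and the velocity `V`, whose
weak divergence is `D`. -/
structure IsData {d : ℕ} (Ω : Set (Sp d)) (M : Set (Set (Sp d))) (φ : Sp d → ℝ)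
    (V : Sp d → Sp d) (D : Sp d → ℝ) (φmin φmax Γ : ℝ) : Prop where
  domain : IsPolytopal Ω
  mesh : IsMesh Ω M
  smooth : IsPiecewiseSmooth M φ
  bounds : ∀ x ∈ Ω, φmin ≤ φ x ∧ φ x ≤ φmax
  hdiv : IsHDiv Ω V D
  polynomial : IsPiecewisePolynomial M V
  div_bound : ∀ᵐ x ∂(MeasureTheory.volume.restrict Ω), |D x| ≤ Γ
  no_flux : HasZeroNormalTrace Ω V D

/-- `t ↦ γ t` is a trajectory in `Ω` of the velocity `V / φ` on `[-T, T]`, starting at `x`: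
it is Lipschitz continuous and, except at an at most countable number of times (those where it
intersects the faces of the mesh, on which `V` and `φ` are not defined), it lies in an open
cell and satisfies the differential equation. -/
structure IsTrajectory {d : ℕ} (Ω : Set (Sp d)) (M : Set (Set (Sp d))) (φ : Sp d → ℝ)
    (V : Sp d → Sp d) (T : ℝ) (x : Sp d) (γ : ℝ → Sp d) : Prop where
  init : γ 0 = x
  mem : ∀ t ∈ Set.Icc (-T) T, γ t ∈ Ω
  lipschitz : ∃ L : NNReal, LipschitzOnWith L γ (Set.Icc (-T) T)
  ode : ∃ N : Set ℝ, N.Countable ∧ ∀ t ∈ Set.Icc (-T) T \ N,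
    γ t ∈ ⋃₀ M ∧
      HasDerivWithinAt γ ((φ (γ t))⁻¹ • V (γ t)) (Set.Icc (-T) T) t

/-- `F` (written `F t x` for `F_t(x)`) is the flow of `V / φ` on `[-T, T]`, defined outside of a
relatively closed negligible subset `C` of `Ω`. -/
structure IsFlow {d : ℕ} (Ω : Set (Sp d)) (M : Set (Set (Sp d))) (φ : Sp d → ℝ)
    (V : Sp d → Sp d) (T : ℝ) (C : Set (Sp d)) (F : ℝ → Sp d → Sp d) : Prop where
  subset : C ⊆ Ω
  isOpen_compl : IsOpen (Ω \ C)
  null : MeasureTheory.volume C = 0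
  trajectory : ∀ x ∈ Ω \ C, IsTrajectory Ω M φ V T x (fun t => F t x)

/-- The Jacobian determinant `JF_t(x)`. -/
noncomputable def jac {d : ℕ} (F : ℝ → Sp d → Sp d) (t : ℝ) (x : Sp d) : ℝ :=
  (fderiv ℝ (F t) x).det

/-- `C₁(s) = (φ^* / φ_*) exp (Γ |s| / φ_*)`. -/
noncomputable def C₁ (φmin φmax Γ s : ℝ) : ℝ :=
  φmax / φmin * Real.exp (Γ / φmin * |s|)

/-- `w` (written `w x t`) is a solution of `φ ∂ₜ w + V · ∇ w = 0` on `Ω × [-T, T]`, in the sense of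
characteristics: `w(x, t) = w(F_{s-t}(x), s)`. -/
structure IsAdvectionSolution {d : ℕ} (Ω : Set (Sp d)) (T : ℝ) (F : ℝ → Sp d → Sp d)
    (w : Sp d → ℝ → ℝ) : Prop where
  aemeasurable : ∀ t ∈ Set.Icc (-T) T,
    AEMeasurable (fun x => w x t) (MeasureTheory.volume.restrict Ω)
  transport : ∀ s ∈ Set.Icc (-T) T, ∀ t ∈ Set.Icc (-T) T, s - t ∈ Set.Icc (-T) T →
    ∀ᵐ x ∂(MeasureTheory.volume.restrict Ω), w x t = w (F (s - t) x) s

end EllamFlow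

/-! Inside a cell the velocity `V / φ` is smooth, so solutions are differentiable in their initial
data, and Liouville's formula says that φ times the Jacobian determinant grows at the rate div V /
φ. Across a face with normal a that is crossed transversally, with velocity v₁ before and v₂ after,
the derivative of the flow jumps by w ↦ w + (⟪a, w⟫ / ⟪a, v₁⟫)(v₂ - v₁), whose determinant is ⟪a,
v₂⟫ / ⟪a, v₁⟫. Since V is in H_div, its normal component is continuous across the face
(`IsExtension.inner_eq_of_isFaceAt`), so this ratio is φ₁ / φ₂ and φ times the determinant does not
jump (`IsSteepCrossing.isRegular`). Hence φ(F_t) JF_t = φ exp(∫ div V / φ) along every trajectory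
which meets the faces only in this way. Integration in time gives the identity of the first part, a
bound on the exponential gives `C₁`, and the change of variables y = F_s(x) gives the second part.

It remains to see that almost every trajectory is of this kind. The faces lie in finitely many
hyperplanes. The critical set consists of the points of a hyperplane which lie on a different one,
or at which a normal velocity vanishes without vanishing on the whole hyperplane. Outside of it, a
point on a face is either a transversal crossing or a point of a hyperplane to which the velocities
are everywhere tangent. The second case is impossible: the normal velocity is then controlled by the
distance to the hyperplane, so the trajectory would stay on the face during an interval of times
(`Frame.not_isTangency`).

As V is polynomial in each cell, the critical set is made of proper analytic subsets of hyperplanes,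
and its δ-neighbourhoods have measure o(δ) (`IsExtension.isThin_critical`). Cut [0, T] into about T
/ δ steps. A trajectory whose first visit to the critical set falls in a given step is, at the start
of the step, within Lδ of that set, L being the maximal speed. Up to then the flow is injective with
a Jacobian bounded from below, so the starting points concerned have measure o(δ), and o(1) after
summation (`Frame.volume_hitting`).

The flow is neither assumed unique nor a group. Derivatives are therefore taken among all
trajectories (`HasTangentMap`), and injectivity comes from backward uniqueness off the critical set
(`Frame.eq_of_eq`). Negative times follow by reversing V. -/

open MeasureTheory Set Filter Topology Metric Asymptotics
open scoped ContDiff ENNReal NNReal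

namespace EllamFlow

/-! ### Zero sets of analytic functions -/

section ZeroSets

/-- The zero set of an analytic function on the real line which is nonzero somewhere is
negligible. -/
theorem volume_zeros_of_analytic {g : ℝ → ℝ} (hg : AnalyticOnNhd ℝ g univ) {t₀ : ℝ}
    (h0 : g t₀ ≠ 0) : volume {t | g t = 0} = 0 := by
  have hc := hg.preimage_zero_mem_codiscrete h0
  have h1 := ae_restrict_le_codiscreteWithin (μ := volume) MeasurableSet.univ hc
  rw [Measure.restrict_univ, mem_ae_iff] at h1
  refine measure_mono_null ?_ h1
  intro t ht
  simpa using ht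

variable {W : Type*} [NormedAddCommGroup W] [NormedSpace ℝ W] [FiniteDimensional ℝ W]
  [MeasurableSpace W] [BorelSpace W]

/-- The zero set of an analytic function which is nonzero somewhere is negligible. -/
theorem measure_zeros_of_analytic (μ : Measure W) [μ.IsAddHaarMeasure] {q : W → ℝ}
    (hq : AnalyticOnNhd ℝ q univ) {w₀ : W} (h0 : q w₀ ≠ 0) : μ {w | q w = 0} = 0 := by
  set g : W → ℝ := fun w => q (w₀ + w) with hg
  have hqc : Continuous q := continuousOn_univ.1 hq.continuousOn
  have hgc : Continuous g := by fun_prop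
  have hga : ∀ w : W, AnalyticOnNhd ℝ (fun t : ℝ => g (t • w)) univ := by
    intro w t _
    have h1 : AnalyticAt ℝ (fun t : ℝ => w₀ + t • w) t := by fun_prop
    exact (hq (w₀ + t • w) (mem_univ _)).comp_of_eq h1 rfl
  -- Fubini on pairs (w, t): each line t ↦ g (t • w) is nonzero at t = 0, so `P` is null. Some slice
  -- at a time t ≠ 0 is then null, and this slice is a dilation of the zero set of g.
  set P : Set (W × ℝ) := {p : W × ℝ | g (p.2 • p.1) = 0} with hP
  have hPm : MeasurableSet P :=
    (isClosed_eq (hgc.comp (continuous_snd.smul continuous_fst)) continuous_const).measurableSet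
  have key : (μ.prod (volume : Measure ℝ)) P = 0 := by
    rw [Measure.measure_prod_null hPm]
    refine Eventually.of_forall fun w => ?_
    refine volume_zeros_of_analytic (hga w) (t₀ := 0) ?_
    simpa [hg] using h0
  rw [Measure.prod_apply_symm hPm, lintegral_eq_zero_iff (measurable_measure_prodMk_right hPm)]
    at key
  have hex : ∃ t : ℝ, t ≠ 0 ∧ μ ((fun w => (w, t)) ⁻¹' P) = 0 := by
    have h2 : ∀ᵐ t : ℝ, t ≠ 0 := by
      simp [ae_iff]
    obtain ⟨t, ht⟩ := (h2.and key).exists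
    exact ⟨t, ht.1, by simpa using ht.2⟩
  obtain ⟨t, ht0, ht⟩ := hex
  have h3 : (fun w => (w, t)) ⁻¹' P = (fun w => t • w) ⁻¹' {w | g w = 0} := rfl
  rw [h3, Measure.addHaar_preimage_smul μ ht0, mul_eq_zero] at ht
  have h4 : μ {w | g w = 0} = 0 := by
    rcases ht with h | h
    · exfalso
      have := ENNReal.ofReal_eq_zero.1 h
      have hp : 0 < |(t ^ Module.finrank ℝ W)⁻¹| := by positivity
      linarith
    · exact h
  have h5 : {w | g w = 0} = (fun w => w₀ + w) ⁻¹' {w | q w = 0} := rfl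
  rwa [h5, measure_preimage_add] at h4

end ZeroSets

/-! ### Measure of neighbourhoods of analytic subsets of a hyperplane -/

section Slab

variable {E : Type*} [NormedAddCommGroup E] [InnerProductSpace ℝ E] [FiniteDimensional ℝ E]
  [MeasurableSpace E] [BorelSpace E]

/-- Sublevel sets of a continuous function in a compact set shrink to the zero set. -/
theorem exists_measure_sublevel_le (μ : Measure E) [IsFiniteMeasureOnCompacts μ] {q : E → ℝ}
    (hq : Continuous q) (hz : μ {x | q x = 0} = 0) (R : ℝ) {ε : ℝ≥0∞} (hε : 0 < ε) :
    ∃ η > 0, μ {x ∈ closedBall (0 : E) R | |q x| ≤ η} ≤ ε := by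
  set s : ℕ → Set E := fun n => {x ∈ closedBall (0 : E) R | |q x| ≤ 1 / ((n : ℝ) + 1)} with hs
  have hcl : ∀ n, IsClosed (s n) := fun n =>
    isClosed_closedBall.inter (isClosed_le hq.abs continuous_const)
  have hanti : Antitone s := by
    intro m n hmn x hx
    refine ⟨hx.1, hx.2.trans ?_⟩
    have : (m : ℝ) ≤ n := by exact_mod_cast hmn
    exact one_div_le_one_div_of_le (by positivity) (by linarith)
  have hlim := tendsto_measure_iInter_atTop (μ := μ) (fun n => (hcl n).measurableSet.nullMeasurableSet) hanti
    ⟨0, ((measure_mono (fun x hx => hx.1)).trans_lt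
      (isCompact_closedBall (0 : E) R).measure_lt_top).ne⟩
  have h0 : μ (⋂ n, s n) = 0 := by
    refine measure_mono_null (fun x hx => ?_) hz
    have hx' : ∀ n : ℕ, |q x| ≤ 1 / ((n : ℝ) + 1) := fun n => (mem_iInter.1 hx n).2
    have h1 : |q x| ≤ 0 :=
      ge_of_tendsto' tendsto_one_div_add_atTop_nhds_zero_nat hx'
    simpa using h1
  rw [h0] at hlim
  obtain ⟨n, hn⟩ := (hlim.eventually (ge_mem_nhds hε)).exists
  exact ⟨1 / ((n : ℝ) + 1), by positivity, hn⟩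

/-- A small neighbourhood of a proper analytic subset of a hyperplane has a measure which is
negligible with respect to its width. -/
theorem exists_measure_thickening_le (μ : Measure E) [μ.IsAddHaarMeasure] {a : E} (ha : a ≠ 0)
    (b : ℝ) {q : E → ℝ} (hq : AnalyticOnNhd ℝ q univ) {x₀ : E} (hx₀ : inner ℝ a x₀ = b)
    (hq0 : q x₀ ≠ 0) (R L : ℝ) (hL : 0 < L) {ε : ℝ} (hε : 0 < ε) :
    ∃ δ₀ > 0, ∀ δ, 0 < δ → δ ≤ δ₀ →
      μ {x | ∃ y ∈ closedBall (0 : E) R, inner ℝ a y = b ∧ q y = 0 ∧ dist x y ≤ L * δ}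
        ≤ ENNReal.ofReal (ε * δ) := by
  have hna : 0 < ‖a‖ := norm_pos_iff.2 ha
  have haa : inner ℝ a a = ‖a‖ ^ 2 := real_inner_self_eq_norm_sq a
  -- Composing q with the orthogonal projection onto the hyperplane gives an analytic function Q,
  -- invariant along a and not identically zero. The neighbourhood then lies in a slab of width of
  -- order δ on which |Q| is small.
  set pr : E → E := fun x => x - ((inner ℝ a x - b) / ‖a‖ ^ 2) • a with hpr
  set Q : E → ℝ := fun x => q (pr x) with hQ
  have hqc : Continuous q := continuousOn_univ.1 hq.continuousOn
  have hinner : ∀ z : E, AnalyticAt ℝ (fun x : E => inner ℝ a x) z := fun z =>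
    (innerSL ℝ a).analyticAt z
  have hpra : ∀ z, AnalyticAt ℝ pr z := by
    intro z
    have h1 : AnalyticAt ℝ (fun x : E => (inner ℝ a x - b) / ‖a‖ ^ 2) z :=
      ((hinner z).sub analyticAt_const).div analyticAt_const (by positivity)
    exact analyticAt_id.sub (h1.smul analyticAt_const)
  have hQa : AnalyticOnNhd ℝ Q univ := fun z _ =>
    (hq (pr z) (mem_univ _)).comp_of_eq (hpra z) rfl
  have hQc : Continuous Q := continuousOn_univ.1 hQa.continuousOn
  have hpr_on : ∀ y : E, inner ℝ a y = b → pr y = y := by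
    intro y hy; simp [hpr, hy]
  have hpr_tr : ∀ (x : E) (τ : ℝ), pr (x - τ • a) = pr x := by
    intro x τ
    simp only [hpr, inner_sub_right, inner_smul_right, haa]
    have : ((inner ℝ a x - τ * ‖a‖ ^ 2 - b) / ‖a‖ ^ 2 : ℝ) = (inner ℝ a x - b) / ‖a‖ ^ 2 - τ := by
      field_simp
      ring
    rw [this, sub_smul]
    abel
  have hQnull : μ {x | Q x = 0} = 0 :=
    measure_zeros_of_analytic μ hQa (w₀ := x₀) (by simpa [hQ, hpr_on x₀ hx₀] using hq0)
  -- Chosen so that the product of ε' with the length 2 L δ / ‖a‖ found below is ε δ.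
  set ε' : ℝ := ε * ‖a‖ / (2 * L) with hε'
  have hε'0 : 0 < ε' := by positivity
  obtain ⟨η, hη, hηle⟩ := exists_measure_sublevel_le μ hQc hQnull (R + L + ‖a‖)
    (ENNReal.ofReal_pos.2 hε'0)
  have huc : UniformContinuousOn Q (closedBall (0 : E) (R + L)) :=
    (isCompact_closedBall _ _).uniformContinuousOn_of_continuous hQc.continuousOn
  obtain ⟨δ₁, hδ₁, hδ₁'⟩ := Metric.uniformContinuousOn_iff_le.1 huc η hη
  refine ⟨min 1 (δ₁ / L), by positivity, fun δ hδ hδle => ?_⟩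
  have hδ1 : δ ≤ 1 := hδle.trans (min_le_left _ _)
  have hδ2 : L * δ ≤ δ₁ := by
    have := hδle.trans (min_le_right _ _)
    rw [le_div_iff₀ hL] at this
    linarith
  have hLδ : L * δ ≤ L := by nlinarith
  set S : Set E := {x | x ∈ closedBall (0 : E) (R + L) ∧ |inner ℝ a x - b| ≤ ‖a‖ * (L * δ) ∧
    |Q x| ≤ η} with hS
  have hcont : Continuous fun x : E => |inner ℝ a x - b| := by fun_prop
  have hScl : IsClosed S :=
    isClosed_closedBall.inter ((isClosed_le hcont continuous_const).inter
      (isClosed_le hQc.abs continuous_const))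
  have hsub : {x | ∃ y ∈ closedBall (0 : E) R, inner ℝ a y = b ∧ q y = 0 ∧ dist x y ≤ L * δ} ⊆ S := by
    rintro x ⟨y, hyR, hyb, hyq, hxy⟩
    have hxR : x ∈ closedBall (0 : E) (R + L) := by
      rw [mem_closedBall] at hyR ⊢
      linarith [dist_triangle x y 0]
    refine ⟨hxR, ?_, ?_⟩
    · rw [← hyb, ← inner_sub_right]
      calc |inner ℝ a (x - y)| ≤ ‖a‖ * ‖x - y‖ := abs_real_inner_le_norm _ _
        _ ≤ ‖a‖ * (L * δ) := by
          rw [← dist_eq_norm]; gcongr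
    · have hQy : Q y = 0 := by simp [hQ, hpr_on y hyb, hyq]
      have := hδ₁' x hxR y (closedBall_subset_closedBall (by linarith) hyR) (hxy.trans hδ2)
      rwa [hQy, Real.dist_eq, sub_zero] at this
  refine (measure_mono hsub).trans ?_
  -- Average over the translates of S by τ a with τ in [0, 1], which all have the measure of S. A
  -- point belongs to such translates only if |Q| ≤ η there, and then only for τ in an interval of
  -- length `len`. This yields μ S ≤ len * μ Z; the extra ‖a‖ in the radius of Z leaves room for the
  -- translations.
  set G : ℝ → E → ℝ≥0∞ := fun τ x => S.indicator 1 (x - τ • a) with hG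
  have hSm : MeasurableSet S := hScl.measurableSet
  have hGm : Measurable (Function.uncurry G) := by
    have h1 : Measurable (fun p : ℝ × E => p.2 - p.1 • a) := by
      have : Continuous (fun p : ℝ × E => p.2 - p.1 • a) := by fun_prop
      exact this.measurable
    exact (measurable_one.indicator hSm).comp h1
  have hin : ∀ τ : ℝ, ∫⁻ x, G τ x ∂μ = μ S := by
    intro τ
    rw [hG]
    simp only
    rw [lintegral_sub_right_eq_self (fun x => S.indicator (1 : E → ℝ≥0∞) x) (τ • a),
      lintegral_indicator_one hSm]
  have h1 : μ S = ∫⁻ τ in Icc (0 : ℝ) 1, ∫⁻ x, G τ x ∂μ := by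
    simp [hin]
  rw [h1, lintegral_lintegral_swap hGm.aemeasurable]
  set Z : Set E := {x ∈ closedBall (0 : E) (R + L + ‖a‖) | |Q x| ≤ η} with hZ
  have hZm : MeasurableSet Z :=
    (isClosed_closedBall.inter (isClosed_le hQc.abs continuous_const)).measurableSet
  set len : ℝ := 2 * (L * δ) / ‖a‖ with hlen
  have hbound : ∀ x : E, ∫⁻ τ in Icc (0 : ℝ) 1, G τ x ≤ Z.indicator (fun _ => ENNReal.ofReal len) x := by
    intro x
    by_cases hx : x ∈ Z
    · rw [indicator_of_mem hx]
      set c : ℝ := (inner ℝ a x - b) / ‖a‖ ^ 2 with hc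
      have hle : ∀ τ, G τ x ≤ (Icc (c - L * δ / ‖a‖) (c + L * δ / ‖a‖)).indicator 1 τ := by
        intro τ
        by_cases hτ : x - τ • a ∈ S
        · have h2 := hτ.2.1
          rw [inner_sub_right, inner_smul_right, haa] at h2
          have h3 : τ ∈ Icc (c - L * δ / ‖a‖) (c + L * δ / ‖a‖) := by
            have h4 : inner ℝ a x - τ * ‖a‖ ^ 2 - b = (c - τ) * ‖a‖ ^ 2 := by
              rw [hc]; field_simp; ring
            rw [h4, abs_mul, abs_of_pos (by positivity : 0 < ‖a‖ ^ 2)] at h2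
            have h5 : |c - τ| ≤ L * δ / ‖a‖ := by
              rw [le_div_iff₀ hna]
              nlinarith
            rw [abs_le] at h5
            constructor <;> linarith
          rw [indicator_of_mem h3]
          simp [hG, hτ]
        · simp [hG, hτ]
      calc ∫⁻ τ in Icc (0 : ℝ) 1, G τ x
          ≤ ∫⁻ τ, G τ x := setLIntegral_le_lintegral _ _
        _ ≤ ∫⁻ τ, (Icc (c - L * δ / ‖a‖) (c + L * δ / ‖a‖)).indicator 1 τ := lintegral_mono hle
        _ = ENNReal.ofReal len := by
          rw [lintegral_indicator_one measurableSet_Icc, Real.volume_Icc]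
          congr 1
          rw [hlen]; ring
    · rw [indicator_of_notMem hx]
      have : ∀ τ ∈ Icc (0 : ℝ) 1, G τ x = 0 := by
        intro τ hτ
        have hn : x - τ • a ∉ S := by
          intro h
          apply hx
          refine ⟨?_, ?_⟩
          · have h6 := h.1
            rw [mem_closedBall_zero_iff] at h6 ⊢
            have h7 : ‖τ • a‖ ≤ ‖a‖ := by
              rw [norm_smul, Real.norm_of_nonneg hτ.1]
              nlinarith [hτ.2]
            have h8 : ‖x‖ ≤ ‖x - τ • a‖ + ‖τ • a‖ := by
              simpa using norm_add_le (x - τ • a) (τ • a)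
            linarith
          · have := h.2.2
            simpa only [hQ, hpr_tr] using this
        simp [hG, hn]
      rw [setLIntegral_congr_fun measurableSet_Icc this]
      simp
  calc ∫⁻ x, (∫⁻ τ in Icc (0 : ℝ) 1, G τ x) ∂μ
      ≤ ∫⁻ x, Z.indicator (fun _ => ENNReal.ofReal len) x ∂μ := lintegral_mono hbound
    _ = ENNReal.ofReal len * μ Z := by rw [lintegral_indicator_const hZm]
    _ ≤ ENNReal.ofReal len * ENNReal.ofReal ε' := by gcongr
    _ = ENNReal.ofReal (ε * δ) := by
      rw [← ENNReal.ofReal_mul (by positivity)]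
      congr 1
      rw [hlen, hε']
      field_simp

end Slab

/-! ### Liouville's formula and dependence on the initial data -/

section Variation

variable {E : Type*} [NormedAddCommGroup E] [NormedSpace ℝ E] [FiniteDimensional ℝ E]

/-- The divergence of a vector field, as the trace of its derivative. -/
noncomputable def dv (U : E → E) (x : E) : ℝ := LinearMap.trace ℝ E (fderiv ℝ U x : E →ₗ[ℝ] E)

theorem differentiable_det : Differentiable ℝ (fun A : E →L[ℝ] E => A.det) := by
  let b := Module.finBasis ℝ E
  have h : (fun A : E →L[ℝ] E => A.det) =
      fun A : E →L[ℝ] E => ∑ σ : Equiv.Perm (Fin (Module.finrank ℝ E)),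
        (Equiv.Perm.sign σ : ℤ) • ∏ i, b.coord (σ i) (A (b i)) := by
    ext A
    rw [ContinuousLinearMap.det, ← LinearMap.det_toMatrix b, Matrix.det_apply]
    simp [LinearMap.toMatrix_apply, Units.smul_def]
  rw [h]
  have h2 : ∀ i j, Differentiable ℝ (fun A : E →L[ℝ] E => b.coord i (A (b j))) := by
    intro i j
    have : (fun A : E →L[ℝ] E => b.coord i (A (b j))) = fun A : E →L[ℝ] E =>
        (LinearMap.toContinuousLinearMap (b.coord i)) (A (b j)) := rfl
    rw [this]
    fun_prop
  fun_prop

/-- Jacobi's formula in the direction BA follows, without inverting A, from det(A + rBA) = det(1 +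
rB) det A and the expansion det(1 + rB) = 1 + r tr B + O(r²). -/
theorem fderiv_det_comp (A B : E →L[ℝ] E) :
    fderiv ℝ (fun A : E →L[ℝ] E => A.det) A (B ∘L A) =
      LinearMap.trace ℝ E (B : E →ₗ[ℝ] E) * A.det := by
  set b := Module.finBasis ℝ E
  have h1 : HasDerivAt (fun r : ℝ => (A + r • (B ∘L A)).det)
      (fderiv ℝ (fun A : E →L[ℝ] E => A.det) A (B ∘L A)) 0 := by
    have hd : HasFDerivAt (fun A : E →L[ℝ] E => A.det)
        (fderiv ℝ (fun A : E →L[ℝ] E => A.det) A) (A + (0 : ℝ) • (B ∘L A)) := by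
      rw [zero_smul, add_zero]
      exact (differentiable_det A).hasFDerivAt
    have hl : HasDerivAt (fun r : ℝ => A + r • (B ∘L A)) (B ∘L A) 0 := by
      simpa using ((hasDerivAt_id (0 : ℝ)).smul_const (B ∘L A)).const_add A
    exact hd.comp_hasDerivAt (0 : ℝ) hl
  set m := LinearMap.toMatrix b b (B : E →ₗ[ℝ] E) with hm
  set p := (Matrix.det (1 + (Polynomial.X : Polynomial ℝ) • m.map Polynomial.C)).divX.divX with hp
  have h2 : ∀ r : ℝ, (A + r • (B ∘L A)).det = (1 + m.trace * r + p.eval r * r ^ 2) * A.det := by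
    intro r
    have e1 : A + r • (B ∘L A) = (1 + r • B) ∘L A := by
      ext x; simp
    have e2 : ((1 + r • B) ∘L A).det = (1 + r • B).det * A.det := by
      simp only [ContinuousLinearMap.det]
      exact LinearMap.det_comp _ _
    rw [e1, e2, ← Matrix.det_one_add_smul, ContinuousLinearMap.det, ← LinearMap.det_toMatrix b]
    congr 2
    have e3 : ((1 + r • B : E →L[ℝ] E) : E →ₗ[ℝ] E) = LinearMap.id + r • (B : E →ₗ[ℝ] E) := by
      ext x; simp
    rw [e3, map_add, LinearMap.toMatrix_id, map_smul]
  have h3 : HasDerivAt (fun r : ℝ => (1 + m.trace * r + p.eval r * r ^ 2) * A.det)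
      (m.trace * A.det) 0 := by
    have i1 : HasDerivAt (fun r : ℝ => p.eval r * r ^ 2) 0 0 := by
      simpa using (p.hasDerivAt 0).fun_mul (hasDerivAt_pow 2 (0 : ℝ))
    have i2 : HasDerivAt (fun r : ℝ => 1 + m.trace * r) m.trace 0 := by
      simpa using ((hasDerivAt_id (0 : ℝ)).const_mul m.trace).const_add 1
    simpa using (i2.add i1).mul_const A.det
  have h4 : m.trace = LinearMap.trace ℝ E (B : E →ₗ[ℝ] E) :=
    (LinearMap.trace_eq_matrix_trace ℝ b _).symm
  simp_rw [h2] at h1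
  rw [← h4]
  exact h1.unique h3

/-- Liouville's formula. -/
theorem hasDerivWithinAt_det {A : ℝ → E →L[ℝ] E} {B : E →L[ℝ] E} {s : Set ℝ} {t : ℝ}
    (h : HasDerivWithinAt A (B ∘L A t) s t) :
    HasDerivWithinAt (fun r => (A r).det) (LinearMap.trace ℝ E (B : E →ₗ[ℝ] E) * (A t).det) s t := by
  rw [← fderiv_det_comp]
  exact (differentiable_det (A t)).hasFDerivAt.comp_hasDerivWithinAt t h

/-- Solvability of linear differential equations on short intervals. -/
theorem exists_resolvent {B : ℝ → E →L[ℝ] E} {a b : ℝ} (hab : a ≤ b)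
    (hB : ContinuousOn B (Icc a b)) {K : ℝ} (hK : 0 ≤ K) (hBK : ∀ t ∈ Icc a b, ‖B t‖ ≤ K)
    (hsmall : 2 * K * (b - a) ≤ 1) :
    ∃ A : ℝ → E →L[ℝ] E, A a = 1 ∧
      ∀ t ∈ Icc a b, HasDerivWithinAt A (B t ∘L A t) (Icc a b) t := by
  -- On the unit ball around the identity ‖A‖ ≤ 2, so the field is bounded by 2K; the smallness of
  -- the interval keeps solutions in that ball.
  have hpl : IsPicardLindelof (fun t (A : E →L[ℝ] E) => B t ∘L A)
      (⟨a, left_mem_Icc.2 hab⟩ : Icc a b) (1 : E →L[ℝ] E) 1 0 (2 * K).toNNReal K.toNNReal := by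
    refine ⟨fun t ht => ?_, fun A _ => ?_, fun t ht A hA => ?_, ?_⟩
    · refine LipschitzOnWith.of_dist_le_mul fun A _ A' _ => ?_
      rw [dist_eq_norm, dist_eq_norm, ← ContinuousLinearMap.comp_sub, Real.coe_toNNReal _ hK]
      exact (ContinuousLinearMap.opNorm_comp_le _ _).trans
        (mul_le_mul_of_nonneg_right (hBK t ht) (norm_nonneg _))
    · exact hB.clm_comp continuousOn_const
    · have h1 : ‖A‖ ≤ 2 := by
        have h2 : ‖A - 1‖ ≤ 1 := by simpa [dist_eq_norm] using hA
        have h3 : ‖(1 : E →L[ℝ] E)‖ ≤ 1 := ContinuousLinearMap.norm_id_le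
        calc ‖A‖ = ‖(A - 1) + 1‖ := by simp
          _ ≤ ‖A - 1‖ + ‖(1 : E →L[ℝ] E)‖ := norm_add_le _ _
          _ ≤ 2 := by linarith
      rw [Real.coe_toNNReal _ (by positivity)]
      calc ‖B t ∘L A‖ ≤ ‖B t‖ * ‖A‖ := ContinuousLinearMap.opNorm_comp_le _ _
        _ ≤ K * 2 := mul_le_mul (hBK t ht) h1 (norm_nonneg _) hK
        _ = 2 * K := by ring
    · rw [Real.coe_toNNReal _ (by positivity)]
      simpa [max_eq_left (sub_nonneg.2 hab)] using hsmall
  obtain ⟨A, hA0, hA⟩ := hpl.exists_eq_forall_mem_Icc_hasDerivWithinAt₀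
  exact ⟨A, hA0, hA⟩

/-- `η` is a solution of the autonomous equation `η' = f(η)` on `[a, b]`. -/
def Solves (f : E → E) (η : ℝ → E) (a b : ℝ) : Prop :=
  ∀ t ∈ Icc a b, HasDerivWithinAt η (f (η t)) (Icc a b) t

theorem Solves.mono {f : E → E} {η : ℝ → E} {a b a' b' : ℝ} (h : Solves f η a b) (ha : a ≤ a')
    (hb : b' ≤ b) : Solves f η a' b' := fun t ht =>
  (h t ⟨ha.trans ht.1, ht.2.trans hb⟩).mono (Icc_subset_Icc ha hb)

theorem Solves.continuousOn {f : E → E} {η : ℝ → E} {a b : ℝ} (h : Solves f η a b) :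
    ContinuousOn η (Icc a b) := fun t ht => (h t ht).continuousWithinAt

theorem hasDerivWithinAt_Ici_of_Icc {F : Type*} [NormedAddCommGroup F] [NormedSpace ℝ F]
    {η : ℝ → F} {η' : F} {a b t : ℝ}
    (h : HasDerivWithinAt η η' (Icc a b) t) (ht : t ∈ Ico a b) : HasDerivWithinAt η η' (Ici t) t :=
  h.mono_of_mem_nhdsWithin (Icc_mem_nhdsGE_of_mem ht)

/-- Compactness bounds the derivative, and convexity of the ball turns this into a Lipschitz bound.
The normalisation 1 ≤ K makes the division by K in Gronwall's inequality harmless. -/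
theorem exists_fderiv_bound {f : E → E} (hf : ContDiff ℝ 1 f) (R : ℝ) :
    ∃ K : ℝ≥0, 1 ≤ K ∧ (∀ x ∈ closedBall (0 : E) R, ‖fderiv ℝ f x‖ ≤ K) ∧
      LipschitzOnWith K f (closedBall (0 : E) R) := by
  have hc : Continuous (fderiv ℝ f) := hf.continuous_fderiv one_ne_zero
  obtain ⟨K, hK⟩ := (isCompact_closedBall (0 : E) R).exists_bound_of_continuousOn hc.continuousOn
  refine ⟨max 1 K.toNNReal, le_max_left _ _, ?_, ?_⟩
  · intro x hx
    exact (hK x hx).trans ((Real.le_coe_toNNReal K).trans (by exact_mod_cast le_max_right _ _))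
  · refine (convex_closedBall (0 : E) R).lipschitzOnWith_of_nnnorm_fderiv_le (𝕜 := ℝ)
      (fun x _ => (hf.differentiable one_ne_zero) x) fun x hx => ?_
    have := (hK x hx).trans ((Real.le_coe_toNNReal K).trans
      (by exact_mod_cast le_max_right 1 K.toNNReal : (K.toNNReal : ℝ) ≤ max 1 K.toNNReal))
    exact_mod_cast this

/-- Uniform first order expansion of a `C^1` map on a ball. -/
theorem exists_uniform_expansion {f : E → E} (hf : ContDiff ℝ 1 f) (R : ℝ) {ε : ℝ} (hε : 0 < ε) :
    ∃ δ > 0, ∀ x ∈ closedBall (0 : E) R, ∀ y ∈ closedBall (0 : E) R, ‖y - x‖ ≤ δ →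
      ‖f y - f x - fderiv ℝ f x (y - x)‖ ≤ ε * ‖y - x‖ := by
  have hc : Continuous (fderiv ℝ f) := hf.continuous_fderiv one_ne_zero
  have huc := (isCompact_closedBall (0 : E) R).uniformContinuousOn_of_continuous hc.continuousOn
  obtain ⟨δ, hδ, h⟩ := Metric.uniformContinuousOn_iff_le.1 huc ε hε
  refine ⟨δ, hδ, fun x hx y hy hxy => ?_⟩
  have hconv : Convex ℝ (closedBall (0 : E) R ∩ closedBall x δ) :=
    (convex_closedBall _ _).inter (convex_closedBall _ _)
  refine hconv.norm_image_sub_le_of_norm_fderiv_le' (𝕜 := ℝ)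
    (fun z _ => (hf.differentiable one_ne_zero) z) (fun z hz => ?_)
    ⟨hx, mem_closedBall_self hδ.le⟩ ⟨hy, by rwa [mem_closedBall, dist_eq_norm]⟩
  rw [← dist_eq_norm]
  exact h z hz.1 x hx hz.2

/-- Differentiability of the solutions with respect to the initial data, in a form which allows for
a perturbation of the initial time. -/
theorem exists_variation_bound {f : E → E} (hf : ContDiff ℝ 1 f) {R a b : ℝ} {γ : ℝ → E}
    {A : ℝ → E →L[ℝ] E} (hγ : Solves f γ a b) (hγR : ∀ t ∈ Icc a b, γ t ∈ closedBall (0 : E) R)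
    (hA : ∀ t ∈ Icc a b, HasDerivWithinAt A (fderiv ℝ f (γ t) ∘L A t) (Icc a b) t) :
    ∃ C > 0, ∀ ε > 0, ∃ δ > 0, ∀ (η : ℝ → E) (c c' : ℝ), a ≤ c → c ≤ c' → c' ≤ b →
      Solves f η c c' → (∀ t ∈ Icc c c', η t ∈ closedBall (0 : E) R) → ‖η c - γ c‖ ≤ δ →
      ‖η c' - γ c'‖ ≤ C * ‖η c - γ c‖ ∧
      ∀ w : E, ‖η c' - γ c' - A c' w‖ ≤ C * ‖η c - γ c - A c w‖ + ε * ‖η c - γ c‖ := by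
  obtain ⟨K, hK1, hKb, hKL⟩ := exists_fderiv_bound hf R
  have hK1' : (1 : ℝ) ≤ K := by exact_mod_cast hK1
  set C : ℝ := Real.exp (K * (b - a)) with hC
  have hC0 : 0 < C := Real.exp_pos _
  refine ⟨C, hC0, fun ε hε => ?_⟩
  -- One factor C is lost because ‖η - γ‖ ≤ C ‖η c - γ c‖, the other in Gronwall's inequality.
  obtain ⟨δ, hδ, hexp⟩ := exists_uniform_expansion hf R (ε := ε / C ^ 2) (by positivity)
  refine ⟨δ / C, by positivity, fun η c c' hac hcc' hcb hη hηR hd => ?_⟩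
  have hγ' := hγ.mono hac hcb
  have hγR' : ∀ t ∈ Icc c c', γ t ∈ closedBall (0 : E) R := fun t ht =>
    hγR t ⟨hac.trans ht.1, ht.2.trans hcb⟩
  have hexpC : ∀ t ∈ Icc c c', Real.exp (K * (t - c)) ≤ C := by
    intro t ht
    rw [hC]
    apply Real.exp_le_exp.2
    have : t - c ≤ b - a := by linarith [ht.2]
    gcongr
  have hz : ∀ t ∈ Icc c c', ‖η t - γ t‖ ≤ C * ‖η c - γ c‖ := by
    intro t ht
    have := dist_le_of_trajectories_ODE_of_mem (v := fun _ => f) (s := fun _ => closedBall (0 : E) R)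
      (K := K) (fun _ _ => hKL) hη.continuousOn
      (fun t ht => hasDerivWithinAt_Ici_of_Icc (hη t (Ico_subset_Icc_self ht)) ht)
      (fun t ht => hηR t (Ico_subset_Icc_self ht)) hγ'.continuousOn
      (fun t ht => hasDerivWithinAt_Ici_of_Icc (hγ' t (Ico_subset_Icc_self ht)) ht)
      (fun t ht => hγR' t (Ico_subset_Icc_self ht)) le_rfl t ht
    rw [dist_eq_norm, dist_eq_norm] at this
    calc _ ≤ _ := this
      _ ≤ ‖η c - γ c‖ * C := by gcongr; exact hexpC t ht
      _ = _ := mul_comm _ _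
  have hcc : c' ∈ Icc c c' := right_mem_Icc.2 hcc'
  refine ⟨hz c' hcc, fun w => ?_⟩
  set z0 := ‖η c - γ c‖ with hz0
  -- The error solves the linearised equation up to the Taylor remainder of f. The vector w is free
  -- because at a crossing the starting time c depends on η, while A is normalised at a fixed time.
  have hder : ∀ t ∈ Icc c c', HasDerivWithinAt (fun t => η t - γ t - A t w)
      (f (η t) - f (γ t) - fderiv ℝ f (γ t) (A t w)) (Icc c c') t := by
    intro t ht
    have h1 := (hA t ⟨hac.trans ht.1, ht.2.trans hcb⟩).mono (Icc_subset_Icc hac hcb)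
    have h2 := h1.clm_apply (hasDerivWithinAt_const t (Icc c c') w)
    simpa using ((hη t ht).fun_sub (hγ' t ht)).fun_sub h2
  have hbd : ∀ t ∈ Ico c c', ‖f (η t) - f (γ t) - fderiv ℝ f (γ t) (A t w)‖ ≤
      K * ‖η t - γ t - A t w‖ + ε / C * z0 := by
    intro t ht
    have ht' := Ico_subset_Icc_self ht
    have h1 : ‖η t - γ t‖ ≤ C * z0 := hz t ht'
    have h2 : ‖η t - γ t‖ ≤ δ := by
      refine h1.trans ?_
      calc C * z0 ≤ C * (δ / C) := by gcongr
        _ = δ := by field_simp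
    have h3 := hexp (γ t) (hγR' t ht') (η t) (hηR t ht') h2
    have e : f (η t) - f (γ t) - fderiv ℝ f (γ t) (A t w) =
        fderiv ℝ f (γ t) (η t - γ t - A t w) +
          (f (η t) - f (γ t) - fderiv ℝ f (γ t) (η t - γ t)) := by
      simp only [map_sub]; abel
    rw [e]
    refine (norm_add_le _ _).trans (add_le_add ?_ ?_)
    · exact (ContinuousLinearMap.le_opNorm _ _).trans
        (mul_le_mul_of_nonneg_right (hKb _ (hγR' t ht')) (norm_nonneg _))
    · calc _ ≤ _ := h3
        _ ≤ ε / C ^ 2 * (C * z0) := by gcongr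
        _ = ε / C * z0 := by field_simp
  have hg := norm_le_gronwallBound_of_norm_deriv_right_le
    (f := fun t => η t - γ t - A t w) (f' := fun t => f (η t) - f (γ t) - fderiv ℝ f (γ t) (A t w))
    (δ := ‖η c - γ c - A c w‖) (K := K) (ε := ε / C * z0)
    (fun t ht => (hder t ht).continuousWithinAt)
    (fun t ht => hasDerivWithinAt_Ici_of_Icc (hder t (Ico_subset_Icc_self ht)) ht) le_rfl hbd c' hcc
  refine hg.trans ?_
  rw [gronwallBound_of_K_ne_0 (by positivity)]
  have hCe := hexpC c' hcc
  have hz00 : 0 ≤ z0 := norm_nonneg _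
  have t1 : ‖η c - γ c - A c w‖ * Real.exp (K * (c' - c)) ≤ C * ‖η c - γ c - A c w‖ := by
    rw [mul_comm]; gcongr
  have t2 : ε / C * z0 / K * (Real.exp (K * (c' - c)) - 1) ≤ ε * z0 := by
    have h5 : ε / C * z0 / K ≤ ε / C * z0 := div_le_self (by positivity) hK1'
    have h6 : 0 ≤ Real.exp (K * (c' - c)) - 1 := by
      have : 0 ≤ (K : ℝ) * (c' - c) := mul_nonneg (by positivity) (by linarith)
      linarith [Real.one_le_exp this]
    calc ε / C * z0 / K * (Real.exp (K * (c' - c)) - 1) ≤ ε / C * z0 * C := by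
          apply mul_le_mul h5 _ h6 (by positivity)
          linarith
      _ = ε * z0 := by field_simp
  exact add_le_add t1 t2

/-- Backward uniqueness. -/
theorem Solves.eqOn_of_eq_right {f : E → E} (hf : ContDiff ℝ 1 f) {a b : ℝ} {γ η : ℝ → E}
    (hγ : Solves f γ a b) (hη : Solves f η a b) {R : ℝ}
    (hγR : ∀ t ∈ Icc a b, γ t ∈ closedBall (0 : E) R)
    (hηR : ∀ t ∈ Icc a b, η t ∈ closedBall (0 : E) R) (h : γ b = η b) : EqOn γ η (Icc a b) := by
  obtain ⟨K, -, -, hKL⟩ := exists_fderiv_bound hf R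
  have aux : ∀ {ζ : ℝ → E}, Solves f ζ a b → ∀ t ∈ Ioc a b,
      HasDerivWithinAt ζ (f (ζ t)) (Iic t) t := fun hζ t ht =>
    (hζ t (Ioc_subset_Icc_self ht)).mono_of_mem_nhdsWithin (Icc_mem_nhdsLE_of_mem ht)
  exact ODE_solution_unique_of_mem_Icc_left (v := fun _ => f) (s := fun _ => closedBall (0 : E) R)
    (fun _ _ => hKL) hγ.continuousOn (aux hγ) (fun t ht => hγR t (Ioc_subset_Icc_self ht))
    hη.continuousOn (aux hη) (fun t ht => hηR t (Ioc_subset_Icc_self ht)) h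

end Variation

/-! ### Flux of a vector field through a hyperplane -/

section HalfSpace

variable {E : Type*} [NormedAddCommGroup E] [InnerProductSpace ℝ E] [FiniteDimensional ℝ E]
  [MeasurableSpace E] [BorelSpace E]

theorem continuous_dv {U : E → E} (hU : ContDiff ℝ 1 U) : Continuous (dv U) := by
  have h1 : Continuous (fderiv ℝ U) := hU.continuous_fderiv one_ne_zero
  let T : (E →L[ℝ] E) →ₗ[ℝ] ℝ := (LinearMap.trace ℝ E) ∘ₗ (ContinuousLinearMap.coeLM ℝ)
  exact (LinearMap.continuous_of_finiteDimensional T).comp h1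

theorem dv_eq_sum (U : E → E) (x : E) :
    dv U x = ∑ i, inner ℝ (stdOrthonormalBasis ℝ E i)
      (fderiv ℝ U x (stdOrthonormalBasis ℝ E i)) :=
  LinearMap.trace_eq_sum_inner _ _

/-- The divergence theorem for compactly supported fields. -/
theorem integral_fderiv_add_mul_dv {U : E → E} (hU : ContDiff ℝ 1 U) {ψ : E → ℝ}
    (hψ : ContDiff ℝ 1 ψ) (hc : HasCompactSupport ψ) :
    ∫ x, (fderiv ℝ ψ x (U x) + ψ x * dv U x) = 0 := by
  set e := stdOrthonormalBasis ℝ E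
  have hψ' : Continuous (fderiv ℝ ψ) := hψ.continuous_fderiv one_ne_zero
  have hU' : Continuous (fderiv ℝ U) := hU.continuous_fderiv one_ne_zero
  have hUd : Differentiable ℝ U := hU.differentiable one_ne_zero
  have hUc := hU.continuous
  have hψc := hψ.continuous
  have hgd : ∀ i, Differentiable ℝ (fun x => inner ℝ (e i) (U x)) := fun i =>
    (innerSL ℝ (e i)).differentiable.comp hUd
  have hg' : ∀ i x, fderiv ℝ (fun x => inner ℝ (e i) (U x)) x (e i)
      = inner ℝ (e i) (fderiv ℝ U x (e i)) := by
    intro i x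
    have h1 : HasFDerivAt (fun x => inner ℝ (e i) (U x))
        ((innerSL ℝ (e i)) ∘L fderiv ℝ U x) x :=
      (innerSL ℝ (e i)).hasFDerivAt.comp x (hUd x).hasFDerivAt
    rw [h1.fderiv]
    simp
  have hcf : ∀ v, HasCompactSupport (fun x => fderiv ℝ ψ x v) := fun v =>
    hc.fderiv_apply (𝕜 := ℝ) v
  have i1 : ∀ i, Integrable (fun x => inner ℝ (e i) (U x) * fderiv ℝ ψ x (e i)) := fun i =>
    Continuous.integrable_of_hasCompactSupport (by fun_prop) ((hcf _).mul_left)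
  have i2 : ∀ i, Integrable (fun x => inner ℝ (e i) (fderiv ℝ U x (e i)) * ψ x) := fun i =>
    Continuous.integrable_of_hasCompactSupport (by fun_prop) (hc.mul_left)
  have i3 : ∀ i, Integrable (fun x => inner ℝ (e i) (U x) * ψ x) := fun i =>
    Continuous.integrable_of_hasCompactSupport (by fun_prop) (hc.mul_left)
  have key : ∀ i, ∫ x, (inner ℝ (e i) (U x) * fderiv ℝ ψ x (e i) +
      inner ℝ (e i) (fderiv ℝ U x (e i)) * ψ x) = 0 := by
    intro i
    rw [integral_add (i1 i) (i2 i), integral_mul_fderiv_eq_neg_fderiv_mul_of_integrable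
      (by simpa only [hg'] using i2 i) (i1 i) (i3 i) (fun x _ => hgd i x)
      (fun x _ => hψ.differentiable one_ne_zero x)]
    simp only [hg']
    ring
  have hsum : ∀ x, fderiv ℝ ψ x (U x) + ψ x * dv U x =
      ∑ i, (inner ℝ (e i) (U x) * fderiv ℝ ψ x (e i) +
        inner ℝ (e i) (fderiv ℝ U x (e i)) * ψ x) := by
    intro x
    rw [Finset.sum_add_distrib, ← Finset.sum_mul, dv_eq_sum, mul_comm (ψ x)]
    congr 1
    conv_lhs => rw [← e.sum_repr' (U x)]
    simp
  simp_rw [hsum]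
  rw [integral_finsetSum _ fun i _ => (i1 i).fun_add (i2 i)]
  exact Finset.sum_eq_zero fun i _ => key i

/-- The flux of a field which points into a half-space is nonnegative. -/
theorem setIntegral_halfSpace_nonpos {U : E → E} (hU : ContDiff ℝ 1 U) {ψ : E → ℝ}
    (hψ : ContDiff ℝ ∞ ψ) (hc : HasCompactSupport ψ) (h0 : ∀ x, 0 ≤ ψ x) (a : E) (b : ℝ)
    (ha : ∀ x, ψ x ≠ 0 → 0 ≤ inner ℝ a (U x)) :
    ∫ x in {x | b < inner ℝ a x}, (fderiv ℝ ψ x (U x) + ψ x * dv U x) ≤ 0 := by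
  set s := Real.smoothTransition
  set ℓ : E → ℝ := fun x => inner ℝ a x - b with hℓ
  set h : E → ℝ := fun x => fderiv ℝ ψ x (U x) + ψ x * dv U x with hh
  -- Smooth cutoffs converging to the indicator of the half-space. Testing the divergence theorem
  -- with ρ n * ψ produces an additional term in ∇ρ n · U, which is nonnegative since the cutoff
  -- increases in the direction a; no boundary trace is needed.
  set ρ : ℕ → E → ℝ := fun n x => s (n * ℓ x) with hρ
  have hs1 : ContDiff ℝ ∞ s := Real.smoothTransition.contDiff
  have hsd : Differentiable ℝ s := hs1.differentiable (by simp)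
  have hs' : ∀ t, 0 ≤ deriv s t := fun t => Real.smoothTransition.monotone.deriv_nonneg
  have hℓc : Continuous ℓ := by fun_prop
  have hρC : ∀ n, ContDiff ℝ ∞ (ρ n) := fun n => by
    refine hs1.comp ?_
    exact contDiff_const.mul (((innerSL ℝ a).contDiff).sub contDiff_const)
  have hρd : ∀ n x, HasFDerivAt (ρ n) ((deriv s (n * ℓ x) * n) • innerSL ℝ a) x := by
    intro n x
    have h1 : HasFDerivAt (fun x => n * ℓ x) ((n : ℝ) • innerSL ℝ a) x :=
      (((innerSL ℝ a).hasFDerivAt).sub_const b).const_mul (n : ℝ)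
    have h2 := (hsd (n * ℓ x)).hasDerivAt.comp_hasFDerivAt x h1
    rwa [smul_smul] at h2
  have hψc := hψ.continuous
  have hψ' : Continuous (fderiv ℝ ψ) := hψ.continuous_fderiv (by simp)
  have hUc := hU.continuous
  have hdc := continuous_dv hU
  have hhc : Continuous h := by fun_prop
  have hhs : HasCompactSupport h := by
    refine HasCompactSupport.intro' hc (isClosed_tsupport ψ) fun x hx => ?_
    have hx2 : fderiv ℝ ψ x = 0 := by
      have := (support_fderiv_subset ℝ (f := ψ)).trans (subset_refl _)
      by_contra hne
      exact hx (this hne)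
    simp [hh, image_eq_zero_of_notMem_tsupport hx, hx2]
  have hhi : Integrable h := hhc.integrable_of_hasCompactSupport hhs
  have hle : ∀ n, ∫ x, ρ n x * h x ≤ 0 := by
    intro n
    have hρn := (hρC n).continuous
    have hψρ : ContDiff ℝ 1 (fun x => ρ n x * ψ x) := ((hρC n).mul hψ).of_le (by simp)
    have hcc : HasCompactSupport (fun x => ρ n x * ψ x) := hc.mul_left
    have h1 := integral_fderiv_add_mul_dv hU hψρ hcc
    have hfd : ∀ x, fderiv ℝ (fun x => ρ n x * ψ x) x (U x) =
        ρ n x * fderiv ℝ ψ x (U x) + ψ x * (deriv s (n * ℓ x) * n * inner ℝ a (U x)) := by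
      intro x
      have := (hρd n x).fun_mul ((hψ.differentiable (by simp) x).hasFDerivAt)
      rw [HasFDerivAt.fderiv this]
      simp
    have hρ' : Continuous (fun x => deriv s (n * ℓ x)) := by
      have : Continuous (deriv s) := hs1.continuous_deriv (by simp)
      fun_prop
    have e1 : ∀ x, fderiv ℝ (fun x => ρ n x * ψ x) x (U x) + ρ n x * ψ x * dv U x =
        ρ n x * h x + ψ x * (deriv s (n * ℓ x) * n * inner ℝ a (U x)) := by
      intro x
      rw [hfd, hh]; ring
    have i1 : Integrable (fun x => ρ n x * h x) :=
      Continuous.integrable_of_hasCompactSupport (by fun_prop) hhs.mul_left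
    have i2 : Integrable (fun x => ψ x * (deriv s (n * ℓ x) * n * inner ℝ a (U x))) :=
      Continuous.integrable_of_hasCompactSupport (by fun_prop) hc.mul_right
    simp_rw [e1] at h1
    rw [integral_add i1 i2] at h1
    have h2 : 0 ≤ ∫ x, ψ x * (deriv s (n * ℓ x) * n * inner ℝ a (U x)) := by
      refine integral_nonneg fun x => ?_
      by_cases hx : ψ x = 0
      · simp [hx]
      · have := ha x hx
        have h3 := hs' (n * ℓ x)
        have h4 := h0 x
        simp only [Pi.zero_apply]
        positivity
    linarith
  have hUm : MeasurableSet {x : E | b < inner ℝ a x} :=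
    (isOpen_lt continuous_const (by fun_prop)).measurableSet
  rw [← integral_indicator hUm]
  refine le_of_tendsto' (tendsto_integral_of_dominated_convergence (fun x => |h x|)
    (fun n => ((hρC n).continuous.fun_mul hhc).aestronglyMeasurable) hhi.abs (fun n => ?_) ?_) hle
  · refine Eventually.of_forall fun x => ?_
    rw [norm_mul, Real.norm_eq_abs, Real.norm_eq_abs]
    have : |ρ n x| ≤ 1 := by
      rw [abs_of_nonneg (Real.smoothTransition.nonneg _)]
      exact Real.smoothTransition.le_one _
    exact mul_le_of_le_one_left (abs_nonneg _) this
  · refine Eventually.of_forall fun x => ?_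
    by_cases hx : b < inner ℝ a x
    · rw [indicator_of_mem (by exact hx)]
      have hpos : 0 < ℓ x := sub_pos.2 hx
      have : ∀ᶠ n : ℕ in atTop, ρ n x * h x = h x := by
        have := (tendsto_natCast_atTop_atTop (R := ℝ)).atTop_mul_const hpos
        filter_upwards [this.eventually_ge_atTop 1] with n hn
        rw [hρ]
        change Real.smoothTransition (n * ℓ x) * h x = h x
        rw [Real.smoothTransition.one_of_one_le hn, one_mul]
      exact tendsto_nhds_of_eventually_eq this
    · rw [indicator_of_notMem (by exact hx)]
      have : ∀ n : ℕ, ρ n x * h x = 0 := by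
        intro n
        have : (n : ℝ) * ℓ x ≤ 0 :=
          mul_nonpos_of_nonneg_of_nonpos (by positivity) (sub_nonpos.2 (not_lt.1 hx))
        rw [hρ]
        change Real.smoothTransition (n * ℓ x) * h x = 0
        rw [Real.smoothTransition.zero_of_nonpos this, zero_mul]
      simp [this]

/-- A radial bump centred at q is nonincreasing along a in the half-space beyond q. If the integral
vanished, so would this derivative on the whole half-space; but the bump is positive at q and zero
further along the ray, which contradicts the mean value theorem. -/
theorem exists_bump_halfSpace {a : E} (ha : a ≠ 0) (q : E) {r : ℝ} (hr : 0 < r) :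
    ∃ ψ : E → ℝ, ContDiff ℝ ∞ ψ ∧ HasCompactSupport ψ ∧ tsupport ψ ⊆ ball q r ∧ (∀ x, 0 ≤ ψ x) ∧
      ∫ x in {x | inner ℝ a q < inner ℝ a x}, fderiv ℝ ψ x a < 0 := by
  set s := Real.smoothTransition
  have hs1 : ContDiff ℝ ∞ s := Real.smoothTransition.contDiff
  have hsd : Differentiable ℝ s := hs1.differentiable (by simp)
  have hs' : ∀ t, 0 ≤ deriv s t := fun t => Real.smoothTransition.monotone.deriv_nonneg
  set ψ : E → ℝ := fun x => s ((r / 2) ^ 2 - ‖x - q‖ ^ 2) with hψdef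
  have hψ : ContDiff ℝ ∞ ψ :=
    hs1.comp (contDiff_const.sub ((contDiff_id.sub contDiff_const).norm_sq ℝ))
  have hzero : ∀ x, x ∉ closedBall q (r / 2) → ψ x = 0 := by
    intro x hx
    rw [mem_closedBall, dist_eq_norm, not_le] at hx
    refine Real.smoothTransition.zero_of_nonpos ?_
    have : (r / 2) ^ 2 ≤ ‖x - q‖ ^ 2 := by gcongr
    linarith
  have hc : HasCompactSupport ψ := HasCompactSupport.intro (isCompact_closedBall q (r / 2)) hzero
  have hts : tsupport ψ ⊆ closedBall q (r / 2) := by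
    refine closure_minimal (fun x hx => ?_) isClosed_closedBall
    by_contra h
    exact hx (hzero x h)
  have hd : ∀ x v, fderiv ℝ ψ x v =
      deriv s ((r / 2) ^ 2 - ‖x - q‖ ^ 2) * (-(2 * inner ℝ (x - q) v)) := by
    intro x v
    have h1 : HasFDerivAt (fun x : E => (r / 2) ^ 2 - ‖x - q‖ ^ 2)
        (-(2 • (innerSL ℝ (x - q)).comp (ContinuousLinearMap.id ℝ E))) x :=
      (((hasFDerivAt_id x).sub_const q).norm_sq).const_sub _
    have h2 := (hsd _).hasDerivAt.comp_hasFDerivAt x h1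
    have h3 : fderiv ℝ ψ x = _ := h2.fderiv
    rw [h3]
    simp [inner_sub_left]
  set H : Set E := {x | inner ℝ a q < inner ℝ a x} with hH
  have hHo : IsOpen H := isOpen_lt continuous_const (by fun_prop)
  have hcont : Continuous (fun x => fderiv ℝ ψ x a) :=
    (hψ.continuous_fderiv (by simp)).clm_apply continuous_const
  have hint : Integrable (fun x => fderiv ℝ ψ x a) :=
    hcont.integrable_of_hasCompactSupport (hc.fderiv_apply (𝕜 := ℝ) a)
  have hnonpos : ∀ x ∈ H, fderiv ℝ ψ x a ≤ 0 := by
    intro x hx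
    rw [hd]
    have h1 : 0 ≤ inner ℝ (x - q) a := by
      rw [real_inner_comm, inner_sub_right]
      exact (sub_pos.2 hx).le
    have := hs' ((r / 2) ^ 2 - ‖x - q‖ ^ 2)
    nlinarith
  refine ⟨ψ, hψ, hc, hts.trans (closedBall_subset_ball (by linarith)),
    fun x => Real.smoothTransition.nonneg _, ?_⟩
  refine lt_of_le_of_ne (setIntegral_nonpos hHo.measurableSet hnonpos) fun heq => ?_
  have hae : (fun x => fderiv ℝ ψ x a) =ᵐ[volume.restrict H] 0 := by
    have h1 : 0 ≤ᵐ[volume.restrict H] fun x => -fderiv ℝ ψ x a := by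
      refine (ae_restrict_iff' hHo.measurableSet).2 (Eventually.of_forall fun x hx => ?_)
      have := hnonpos x hx
      simpa using this
    have h2 : ∫ x in H, -fderiv ℝ ψ x a = 0 := by rw [integral_neg, heq, neg_zero]
    have h3 := (setIntegral_eq_zero_iff_of_nonneg_ae h1 hint.neg.integrableOn).1 h2
    filter_upwards [h3] with x hx
    simpa using hx
  have hon : EqOn (fun x => fderiv ℝ ψ x a) 0 H :=
    Measure.eqOn_open_of_ae_eq hae hHo hcont.continuousOn continuousOn_const
  have hna : 0 < ‖a‖ := norm_pos_iff.2 ha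
  set g : ℝ → ℝ := fun t => ψ (q + t • a) with hg
  have hgd : ∀ t, HasDerivAt g (fderiv ℝ ψ (q + t • a) a) t := by
    intro t
    have h1 : HasDerivAt (fun t : ℝ => q + t • a) a t := by
      simpa using ((hasDerivAt_id t).smul_const a).const_add q
    exact ((hψ.differentiable (by simp)) _).hasFDerivAt.comp_hasDerivAt t h1
  set t₁ : ℝ := r / ‖a‖ with ht₁
  have ht₁0 : 0 < t₁ := by positivity
  obtain ⟨c, hc1, hc2⟩ := exists_hasDerivAt_eq_slope g _ ht₁0
    (fun t _ => (hgd t).continuousAt.continuousWithinAt) (fun t _ => hgd t)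
  have hcH : q + c • a ∈ H := by
    simp only [hH, mem_ofPred_eq, inner_add_right, inner_smul_right, real_inner_self_eq_norm_sq]
    have : 0 < c * ‖a‖ ^ 2 := mul_pos hc1.1 (by positivity)
    linarith
  have hz := hon hcH
  simp only [Pi.zero_apply] at hz
  rw [hz] at hc2
  have hg1 : g t₁ = 0 := by
    refine hzero _ ?_
    rw [mem_closedBall, dist_eq_norm, not_le]
    rw [add_sub_cancel_left, norm_smul, Real.norm_of_nonneg ht₁0.le, ht₁, div_mul_cancel₀ _ hna.ne']
    linarith
  have hg0 : 0 < g 0 := by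
    simp only [hg, hψdef]
    apply Real.smoothTransition.pos_of_pos
    simp
    positivity
  rw [hg1, eq_comm, div_eq_zero_iff] at hc2
  rcases hc2 with h | h <;> linarith

/-- A field whose restriction to a half-space has no distributional flux through the bounding
hyperplane near `q` is tangent to the hyperplane at `q`. -/
theorem inner_eq_zero_of_no_flux {U : E → E} (hU : ContDiff ℝ 1 U) {a : E} (ha : a ≠ 0) {q : E}
    {r : ℝ} (hr : 0 < r)
    (h : ∀ ψ : E → ℝ, ContDiff ℝ ∞ ψ → HasCompactSupport ψ → tsupport ψ ⊆ ball q r →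
      ∫ x in {x | inner ℝ a q < inner ℝ a x}, (fderiv ℝ ψ x (U x) + ψ x * dv U x) = 0) :
    inner ℝ a (U q) = 0 := by
  have key : ∀ W : E → E, ContDiff ℝ 1 W → (∀ ψ : E → ℝ, ContDiff ℝ ∞ ψ → HasCompactSupport ψ →
      tsupport ψ ⊆ ball q r →
      ∫ x in {x | inner ℝ a q < inner ℝ a x}, (fderiv ℝ ψ x (W x) + ψ x * dv W x) = 0) →
      inner ℝ a (W q) ≤ 0 := by
    intro W hW hWψ
    by_contra! hpos
    set c := inner ℝ a (W q) / 2 with hc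
    have hc0 : 0 < c := by positivity
    have hWc := hW.continuous
    have hev : ∀ᶠ x in 𝓝 q, c < inner ℝ a (W x) := by
      have : ContinuousAt (fun x => inner ℝ a (W x)) q := by fun_prop
      exact this.eventually (lt_mem_nhds (by rw [hc]; linarith))
    obtain ⟨r', hr', hball⟩ := Metric.eventually_nhds_iff_ball.1 hev
    obtain ⟨ψ, hψ, hψc, hψs, hψ0, hψn⟩ := exists_bump_halfSpace ha q (lt_min hr hr')
    have hψ1 := hWψ ψ hψ hψc (hψs.trans (ball_subset_ball (min_le_left _ _)))
    -- Near q the normal component of W exceeds c, so X still points into the half-space. As W has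
    -- no flux, the integral for X reduces to -c ∫ ∂ψ/∂a, which is positive by the choice of ψ: a
    -- contradiction.
    set X : E → E := fun x => ‖a‖ ^ 2 • W x - c • a with hX
    have hXC : ContDiff ℝ 1 X := (contDiff_const.smul hW).sub contDiff_const
    have hXdv : ∀ x, dv X x = ‖a‖ ^ 2 * dv W x := by
      intro x
      have : fderiv ℝ X x = ‖a‖ ^ 2 • fderiv ℝ W x :=
        ((((hW.differentiable one_ne_zero) x).hasFDerivAt.const_smul (‖a‖ ^ 2)).sub_const _).fderiv
      simp [dv, this]
    have h1 := setIntegral_halfSpace_nonpos hXC hψ hψc hψ0 a (inner ℝ a q) (by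
      intro x hx
      have hx' : x ∈ ball q r' :=
        (ball_subset_ball (min_le_right _ _)) (hψs (subset_tsupport _ hx))
      have := hball x hx'
      simp only [hX, inner_sub_right, inner_smul_right, real_inner_self_eq_norm_sq]
      nlinarith [sq_nonneg ‖a‖])
    have hψ' : Continuous (fderiv ℝ ψ) := hψ.continuous_fderiv (by simp)
    have hψcont := hψ.continuous
    have hdc := continuous_dv hW
    have i1 : Integrable (fun x => fderiv ℝ ψ x (W x)) := by
      refine Continuous.integrable_of_hasCompactSupport (by fun_prop) ?_
      refine HasCompactSupport.intro' (hψc.fderiv (𝕜 := ℝ)) (isClosed_tsupport _) fun x hx => ?_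
      rw [image_eq_zero_of_notMem_tsupport hx]; rfl
    have i2 : Integrable (fun x => ψ x * dv W x) :=
      Continuous.integrable_of_hasCompactSupport (by fun_prop) hψc.mul_right
    have i3 : Integrable (fun x => fderiv ℝ ψ x a) :=
      Continuous.integrable_of_hasCompactSupport (by fun_prop) (hψc.fderiv_apply (𝕜 := ℝ) a)
    have e1 : ∀ x, fderiv ℝ ψ x (X x) + ψ x * dv X x =
        ‖a‖ ^ 2 * (fderiv ℝ ψ x (W x) + ψ x * dv W x) - c * fderiv ℝ ψ x a := by
      intro x
      rw [hXdv, show X x = ‖a‖ ^ 2 • W x - c • a from rfl, map_sub, map_smul, map_smul, smul_eq_mul,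
        smul_eq_mul]
      ring
    simp_rw [e1] at h1
    rw [integral_sub ((i1.fun_add i2).const_mul _).integrableOn (i3.const_mul _).integrableOn,
      integral_const_mul, integral_const_mul, hψ1] at h1
    nlinarith
  refine le_antisymm (key U hU h) ?_
  have hneg := key (fun x => -U x) hU.neg (by
    intro ψ hψ hψc hψs
    have e : ∀ x, fderiv ℝ ψ x (-U x) + ψ x * dv (fun x => -U x) x =
        -(fderiv ℝ ψ x (U x) + ψ x * dv U x) := by
      intro x
      have : fderiv ℝ (fun x => -U x) x = -fderiv ℝ U x := fderiv_fun_neg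
      simp [dv, this]
      ring
    simp_rw [e]
    rw [integral_neg, h ψ hψ hψc hψs, neg_zero])
  rw [inner_neg_right] at hneg
  linarith

end HalfSpace

variable {d : ℕ} {Ω : Set (Sp d)} {M : Set (Set (Sp d))} {φ : Sp d → ℝ} {V : Sp d → Sp d}
  {D : Sp d → ℝ} {φmin φmax Γ : ℝ}

/-! ### Hyperplanes carrying the faces of the mesh -/

section Geometry

/-- A finite set of hyperplanes `{x | ⟪h.1, x⟫ = h.2}` which carry the boundaries of the cells. -/
structure CarriesFaces (M : Set (Set (Sp d))) (H : Finset (Sp d × ℝ)) : Prop where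
  ne_zero : ∀ h ∈ H, h.1 ≠ 0
  sides : ∀ K ∈ M, ∀ U : Set (Sp d), IsOpen U → IsPreconnected U →
    (∀ x ∈ U, ∀ h ∈ H, inner ℝ h.1 x ≠ h.2) → U ⊆ K ∨ Disjoint U K

/-- Intermediate value theorem on a connected set. A constraint with zero normal is either always or
never satisfied, hence the restriction to h.1 ≠ 0 in the hypothesis. -/
theorem sides_of_constraint {U : Set (Sp d)} (hU : IsPreconnected U) (h : Sp d × ℝ)
    (hne : h.1 ≠ 0 → ∀ x ∈ U, inner ℝ h.1 x ≠ h.2) :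
    (∀ x ∈ U, inner ℝ h.1 x ≤ h.2) ∨ ∀ x ∈ U, ¬ inner ℝ h.1 x ≤ h.2 := by
  by_cases h0 : h.1 = 0
  · simp only [h0, inner_zero_left]
    by_cases hb : 0 ≤ h.2
    · exact Or.inl fun _ _ => hb
    · exact Or.inr fun _ _ => hb
  · have hc : ContinuousOn (fun x : Sp d => inner ℝ h.1 x) U := by fun_prop
    have himg := (hU.image _ hc).ordConnected
    by_contra! hcon
    obtain ⟨⟨x, hx, hx'⟩, y, hy, hy'⟩ := hcon
    obtain ⟨z, hz, hz'⟩ := himg.out (mem_image_of_mem _ hy) (mem_image_of_mem _ hx) ⟨hy', hx'.le⟩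
    exact hne h0 z hz hz'

/-- Take every constraint with nonzero normal in the descriptions of the cells. On a connected open
set avoiding these hyperplanes each constraint has a constant truth value: either one polyhedron
contains the set, or none meets it. -/
theorem IsMesh.exists_carriesFaces (hM : IsMesh Ω M) : ∃ H, CarriesFaces M H := by
  classical
  have hS : ∀ K : Set (Sp d), ∃ S : Finset (Finset (Sp d × ℝ)), K ∈ M →
      K = interior (⋃ P ∈ S, {x : Sp d | ∀ h ∈ P, inner ℝ h.1 x ≤ h.2}) := by
    intro K
    by_cases hK : K ∈ M
    · obtain ⟨S, hS⟩ := (hM.polytopal K hK).2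
      exact ⟨S, fun _ => hS⟩
    · exact ⟨∅, fun h => absurd h hK⟩
  choose S hS using hS
  refine ⟨(hM.finite.toFinset.biUnion fun K => (S K).biUnion id).filter (fun h => h.1 ≠ 0),
    fun h hh => (Finset.mem_filter.1 hh).2, fun K hK U hUo hU hne => ?_⟩
  have hne' : ∀ P ∈ S K, ∀ h ∈ P, h.1 ≠ 0 → ∀ x ∈ U, inner ℝ h.1 x ≠ h.2 := by
    intro P hP h hh h0 x hx
    refine hne x hx h (Finset.mem_filter.2 ⟨Finset.mem_biUnion.2 ⟨K, ?_, ?_⟩, h0⟩)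
    · simpa using hK
    · exact Finset.mem_biUnion.2 ⟨P, hP, hh⟩
  by_cases hex : ∃ P ∈ S K, ∀ h ∈ P, ∀ x ∈ U, inner ℝ h.1 x ≤ h.2
  · obtain ⟨P, hP, hPU⟩ := hex
    left
    rw [hS K hK]
    refine interior_maximal (fun x hx => ?_) hUo
    exact mem_iUnion₂.2 ⟨P, hP, fun h hh => hPU h hh x hx⟩
  · right
    push Not at hex
    rw [Set.disjoint_left]
    intro x hx hxK
    rw [hS K hK] at hxK
    obtain ⟨P, hP, hPx⟩ := mem_iUnion₂.1 (interior_subset hxK)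
    obtain ⟨h, hh, y, hy, hhy⟩ := hex P hP
    rcases sides_of_constraint hU h (hne' P hP h hh) with h1 | h1
    · exact absurd (h1 y hy) (not_le.2 hhy)
    · exact h1 x hx (hPx h hh)

theorem IsPolytopal.isOpen {K : Set (Sp d)} (hK : IsPolytopal K) : IsOpen K := by
  obtain ⟨-, S, rfl⟩ := hK
  exact isOpen_interior

/-- A cell which fills a neighbourhood of a point up to a nowhere dense set contains it. -/
theorem IsPolytopal.mem_of_closure {K W U : Set (Sp d)} (hK : IsPolytopal K) (hW : W ⊆ K)
    (hU : IsOpen U) (hUW : U ⊆ closure W) : U ⊆ K := by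
  obtain ⟨-, S, rfl⟩ := hK
  refine interior_maximal ?_ hU
  have hcl : IsClosed (⋃ P ∈ S, {x : Sp d | ∀ h ∈ P, inner ℝ h.1 x ≤ h.2}) := by
    refine isClosed_biUnion_finset fun P _ => ?_
    simp only [ofPred_forall]
    refine isClosed_iInter fun h => isClosed_iInter fun _ => ?_
    exact isClosed_le (by fun_prop) continuous_const
  exact hUW.trans (closure_minimal (hW.trans interior_subset) hcl)

theorem CarriesFaces.exists_cell {H : Finset (Sp d × ℝ)} (hH : CarriesFaces M H)
    (hM : IsMesh Ω M) {U : Set (Sp d)} (hUo : IsOpen U) (hUc : IsPreconnected U) (hUn : U.Nonempty)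
    (hUΩ : U ⊆ Ω) (hne : ∀ x ∈ U, ∀ h ∈ H, inner ℝ h.1 x ≠ h.2) : ∃ K ∈ M, U ⊆ K := by
  obtain ⟨x, hx⟩ := hUn
  obtain ⟨K, hK, hxK⟩ := mem_iUnion₂.1 (hM.cover (hUΩ hx))
  obtain ⟨y, hyU, hyK⟩ := mem_closure_iff.1 hxK U hUo hx
  refine ⟨K, hK, (hH.sides K hK U hUo hUc hne).resolve_right fun hd => ?_⟩
  exact Set.disjoint_left.1 hd hyU hyK

theorem exists_ball_avoiding (H : Finset (Sp d × ℝ)) (hΩ : IsOpen Ω) {p : Sp d} (hp : p ∈ Ω) :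
    ∃ ρ > 0, ball p ρ ⊆ Ω ∧ ∀ h ∈ H, inner ℝ h.1 p ≠ h.2 → ∀ x ∈ ball p ρ, inner ℝ h.1 x ≠ h.2 := by
  have h1 : ∀ᶠ x in 𝓝 p, ∀ h ∈ H, inner ℝ h.1 p ≠ h.2 → inner ℝ h.1 x ≠ h.2 := by
    rw [Filter.eventually_all_finset]
    intro h _
    by_cases hh : inner ℝ h.1 p = h.2
    · simp [hh]
    · have : ContinuousAt (fun x : Sp d => inner ℝ h.1 x) p := by fun_prop
      filter_upwards [this.eventually_ne hh] with x hx _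
      exact hx
  obtain ⟨ρ, hρ, hb⟩ := Metric.eventually_nhds_iff_ball.1 (h1.and (hΩ.mem_nhds hp))
  exact ⟨ρ, hρ, fun x hx => (hb x hx).2, fun h hh hne x hx => (hb x hx).1 h hh hne⟩

theorem CarriesFaces.mem_hyperplane {H : Finset (Sp d × ℝ)} (hH : CarriesFaces M H)
    (hM : IsMesh Ω M) (hΩ : IsOpen Ω) {p : Sp d} (hp : p ∈ Ω) (hpM : p ∉ ⋃₀ M) :
    ∃ h ∈ H, inner ℝ h.1 p = h.2 := by
  by_contra! hcon
  obtain ⟨ρ, hρ, hb, hne⟩ := exists_ball_avoiding H hΩ hp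
  obtain ⟨K, hK, hs⟩ := hH.exists_cell hM isOpen_ball (convex_ball p ρ).isPreconnected
    ⟨p, mem_ball_self hρ⟩ hb fun x hx h hh => hne h hh (hcon h hh) x hx
  exact hpM ⟨K, hK, hs (mem_ball_self hρ)⟩

theorem volume_hyperplane {a : Sp d} (ha : a ≠ 0) (b : ℝ) :
    volume {x : Sp d | inner ℝ a x = b} = 0 := by
  have hq : AnalyticOnNhd ℝ (fun x : Sp d => inner ℝ a x - b) univ := fun z _ =>
    ((innerSL ℝ a).analyticAt z).sub analyticAt_const
  have hn : 0 < ‖a‖ ^ 2 := by positivity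
  have := measure_zeros_of_analytic (volume : Measure (Sp d)) hq (w₀ := ((b + 1) / ‖a‖ ^ 2) • a) (by
    rw [inner_smul_right, real_inner_self_eq_norm_sq, div_mul_cancel₀ _ hn.ne']
    simp)
  simpa [sub_eq_zero] using this

theorem CarriesFaces.volume_diff {H : Finset (Sp d × ℝ)} (hH : CarriesFaces M H)
    (hM : IsMesh Ω M) (hΩ : IsOpen Ω) : volume (Ω \ ⋃₀ M) = 0 := by
  refine measure_mono_null (t := ⋃ h ∈ H, {x : Sp d | inner ℝ h.1 x = h.2}) ?_ ?_
  · rintro x ⟨hx, hxM⟩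
    obtain ⟨h, hh, hx'⟩ := hH.mem_hyperplane hM hΩ hx hxM
    exact mem_iUnion₂.2 ⟨h, hh, hx'⟩
  · exact (measure_biUnion_null_iff H.countable_toSet).2 fun h hh =>
      volume_hyperplane (hH.ne_zero h hh) h.2

/-- Near `p`, the hyperplane `{x | ⟪a, x⟫ = b}` separates the cells `K₁` and `K₂`. -/
structure IsFaceAt (Ω : Set (Sp d)) (M : Set (Set (Sp d))) (p a : Sp d) (b ρ : ℝ)
    (K₁ K₂ : Set (Sp d)) : Prop where
  pos : 0 < ρ
  ne_zero : a ≠ 0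
  mem : inner ℝ a p = b
  subset : ball p ρ ⊆ Ω
  mem₁ : K₁ ∈ M
  mem₂ : K₂ ∈ M
  side₁ : ∀ x ∈ ball p ρ, inner ℝ a x < b → x ∈ K₁
  side₂ : ∀ x ∈ ball p ρ, b < inner ℝ a x → x ∈ K₂
  face : ∀ x ∈ ball p ρ, inner ℝ a x = b → x ∉ ⋃₀ M

theorem IsFaceAt.symm {p a : Sp d} {b ρ : ℝ} {K₁ K₂ : Set (Sp d)}
    (h : IsFaceAt Ω M p a b ρ K₁ K₂) : IsFaceAt Ω M p (-a) (-b) ρ K₂ K₁ where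
  pos := h.pos
  ne_zero := neg_ne_zero.2 h.ne_zero
  mem := by rw [inner_neg_left, h.mem]
  subset := h.subset
  mem₁ := h.mem₂
  mem₂ := h.mem₁
  side₁ := fun x hx hlt => h.side₂ x hx (by rw [inner_neg_left] at hlt; linarith)
  side₂ := fun x hx hlt => h.side₁ x hx (by rw [inner_neg_left] at hlt; linarith)
  face := fun x hx heq => h.face x hx (by rw [inner_neg_left] at heq; linarith)

theorem mem_closure_halfSpace {a : Sp d} (ha : a ≠ 0) {b : ℝ} {U : Set (Sp d)} (hU : IsOpen U)
    {x : Sp d} (hx : x ∈ U) (hxb : inner ℝ a x = b) : x ∈ closure {y ∈ U | inner ℝ a y < b} := by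
  rw [Metric.mem_closure_iff]
  intro ε hε
  have hc : Tendsto (fun t : ℝ => x - t • a) (𝓝[>] 0) (𝓝 x) := by
    have : Continuous (fun t : ℝ => x - t • a) := by fun_prop
    have h2 := this.tendsto 0
    simp only [zero_smul, sub_zero] at h2
    exact h2.mono_left nhdsWithin_le_nhds
  have h1 := hc.eventually ((hU.mem_nhds hx))
  have h2 := hc.eventually (Metric.ball_mem_nhds x hε)
  obtain ⟨t, ⟨ht1, ht2⟩, ht3⟩ := ((h1.and h2).and self_mem_nhdsWithin).exists
  refine ⟨x - t • a, ⟨ht1, ?_⟩, by rwa [dist_comm]⟩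
  rw [inner_sub_right, inner_smul_right, real_inner_self_eq_norm_sq, hxb]
  have : 0 < ‖a‖ := norm_pos_iff.2 ha
  have ht3' : 0 < t := ht3
  have : 0 < t * ‖a‖ ^ 2 := by positivity
  linarith

/-- If a hyperplane contains another one, the two coincide. -/
theorem hyperplane_eq_of_subset {a a' : Sp d} {b b' : ℝ} (ha' : a' ≠ 0) {p : Sp d}
    (hp : inner ℝ a p = b) (hsub : ∀ y : Sp d, inner ℝ a y = b → inner ℝ a' y = b')
    {x : Sp d} (hx : inner ℝ a' x = b') : inner ℝ a x = b := by
  by_contra hne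
  have hxp : inner ℝ a (x - p) ≠ 0 := by
    rw [inner_sub_right, hp]; exact sub_ne_zero.2 hne
  have hall : ∀ y : Sp d, inner ℝ a' (y - p) = 0 := by
    intro y
    set s : ℝ := inner ℝ a (y - p) / inner ℝ a (x - p) with hs
    have h1 : inner ℝ a (y - s • (x - p)) = b := by
      rw [inner_sub_right, inner_smul_right, hs, div_mul_cancel₀ _ hxp, inner_sub_right, hp]
      ring
    have h2 := hsub _ h1
    have h3 := hsub _ hp
    rw [inner_sub_right, inner_smul_right, inner_sub_right, hx, h3] at h2
    rw [inner_sub_right, h3]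
    linarith
  have := hall (p + a')
  rw [add_sub_cancel_left, inner_self_eq_zero] at this
  exact ha' this

/-- If all the hyperplanes through p coincide, a small ball is cut into two half-balls, and each of
them, being connected, lies in a single cell. -/
theorem CarriesFaces.exists_isFaceAt {H : Finset (Sp d × ℝ)} (hH : CarriesFaces M H)
    (hM : IsMesh Ω M) (hΩ : IsOpen Ω) {p : Sp d} (hp : p ∈ Ω) (hpM : p ∉ ⋃₀ M)
    {h : Sp d × ℝ} (hh : h ∈ H) (hph : inner ℝ h.1 p = h.2)
    (hone : ∀ h' ∈ H, inner ℝ h'.1 p = h'.2 → ∀ y : Sp d, inner ℝ h.1 y = h.2 →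
      inner ℝ h'.1 y = h'.2) :
    ∃ ρ K₁ K₂, IsFaceAt Ω M p h.1 h.2 ρ K₁ K₂ := by
  obtain ⟨a, b⟩ := h
  simp only at hph hone ⊢
  have ha : a ≠ 0 := hH.ne_zero _ hh
  obtain ⟨ρ, hρ, hb, hne⟩ := exists_ball_avoiding H hΩ hp
  have havoid : ∀ x ∈ ball p ρ, inner ℝ a x ≠ b → ∀ h' ∈ H, inner ℝ h'.1 x ≠ h'.2 := by
    intro x hx hxb h' hh' heq
    by_cases hp' : inner ℝ h'.1 p = h'.2
    · exact hxb (hyperplane_eq_of_subset (hH.ne_zero _ hh') hph (hone h' hh' hp') heq)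
    · exact hne h' hh' hp' x hx heq
  have hlt : ∀ a' : Sp d, ∀ b', a' ≠ 0 → inner ℝ a' p = b' →
      (∀ x : Sp d, inner ℝ a' x < b' → inner ℝ a x ≠ b) →
      ∃ K ∈ M, ball p ρ ∩ {x | inner ℝ a' x < b'} ⊆ K := by
    intro a' b' ha' hpb' hsub
    have hcl := mem_closure_halfSpace ha' isOpen_ball (mem_ball_self hρ) hpb'
    refine hH.exists_cell hM (isOpen_ball.inter (isOpen_lt (by fun_prop) continuous_const))
      ((convex_ball p ρ).inter ?_).isPreconnected ?_ (inter_subset_left.trans hb) ?_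
    · exact convex_halfSpace_lt (innerSL ℝ a').isLinear b'
    · exact closure_nonempty_iff.1 ⟨p, hcl⟩
    · rintro x ⟨hx, hx'⟩
      exact havoid x hx (hsub x hx')
  obtain ⟨K₁, hK₁, hs₁⟩ := hlt a b ha hph fun x hx => hx.ne
  obtain ⟨K₂, hK₂, hs₂⟩ := hlt (-a) (-b) (neg_ne_zero.2 ha) (by rw [inner_neg_left, hph])
    fun x hx => by rw [inner_neg_left] at hx; intro h; linarith
  have hs₂' : ball p ρ ∩ {x | b < inner ℝ a x} ⊆ K₂ := by
    rintro x ⟨hx, hx'⟩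
    refine hs₂ ⟨hx, ?_⟩
    have hx'' : b < inner ℝ a x := hx'
    simp only [mem_ofPred_eq, inner_neg_left]
    linarith
  -- A cell is the interior of a closed set: if it filled both half-balls it would contain the face
  -- between them, hence p.
  have hKK : K₁ ≠ K₂ := by
    rintro rfl
    have hU : ball p ρ ⊆ K₁ := by
      refine (hM.polytopal K₁ hK₁).mem_of_closure
        (W := {x ∈ ball p ρ | inner ℝ a x < b} ∪ {x ∈ ball p ρ | b < inner ℝ a x})
        (union_subset hs₁ hs₂') isOpen_ball fun x hx => ?_
      rcases lt_trichotomy (inner ℝ a x) b with h1 | h1 | h1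
      · exact subset_closure (Or.inl ⟨hx, h1⟩)
      · exact closure_mono subset_union_left (mem_closure_halfSpace ha isOpen_ball hx h1)
      · exact subset_closure (Or.inr ⟨hx, h1⟩)
    exact hpM ⟨K₁, hK₁, hU (mem_ball_self hρ)⟩
  refine ⟨ρ, K₁, K₂, hρ, ha, hph, hb, hK₁, hK₂, fun x hx h1 => hs₁ ⟨hx, h1⟩,
    fun x hx h1 => hs₂' ⟨hx, h1⟩, fun x hx hxb ⟨K, hK, hxK⟩ => ?_⟩
  -- A cell containing a point of the face is open, so it meets both half-balls and would be equal
  -- to both K₁ and K₂.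
  have hUo : IsOpen (ball p ρ ∩ K) := isOpen_ball.inter (hM.polytopal K hK).isOpen
  obtain ⟨y, -, hy⟩ := mem_closure_iff.1
    (mem_closure_halfSpace ha hUo ⟨hx, hxK⟩ hxb) univ isOpen_univ (mem_univ _)
  obtain ⟨z, -, hz⟩ := mem_closure_iff.1
    (mem_closure_halfSpace (neg_ne_zero.2 ha) (b := -b) hUo ⟨hx, hxK⟩
      (by rw [inner_neg_left, hxb])) univ isOpen_univ (mem_univ _)
  have e1 : K = K₁ := by
    by_contra hcon
    exact Set.disjoint_left.1 (hM.disjoint hK hK₁ hcon) hy.1.2 (hs₁ ⟨hy.1.1, hy.2⟩)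
  have e2 : K = K₂ := by
    by_contra hcon
    refine Set.disjoint_left.1 (hM.disjoint hK hK₂ hcon) hz.1.2 (hs₂' ⟨hz.1.1, ?_⟩)
    have h5 := hz.2
    simp only [inner_neg_left] at h5
    simp only [mem_ofPred_eq]
    linarith
  exact hKK (e1.symm.trans e2)

end Geometry

/-! ### Global extensions of the data, and continuity of the normal velocity -/

section Extensions

/-- `W K` and `p K` are global extensions of the restrictions of `V` and `φ` to the cell `K`. -/
structure IsExtension (M : Set (Set (Sp d))) (φ : Sp d → ℝ) (V : Sp d → Sp d)
    (W : Set (Sp d) → Sp d → Sp d) (p : Set (Sp d) → Sp d → ℝ) : Prop where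
  analytic : ∀ K ∈ M, AnalyticOnNhd ℝ (W K) univ
  eq_field : ∀ K ∈ M, EqOn V (W K) K
  smooth : ∀ K ∈ M, ContDiff ℝ ∞ (p K)
  pos : ∀ K ∈ M, ∀ x, 0 < p K x
  eq_porosity : ∀ K ∈ M, EqOn φ (p K) K

theorem exists_analytic_extension (hV : IsPiecewisePolynomial M V) {K : Set (Sp d)} (hK : K ∈ M) :
    ∃ W : Sp d → Sp d, AnalyticOnNhd ℝ W univ ∧ EqOn V W K := by
  choose P hP using hV K hK
  refine ⟨fun x => WithLp.toLp 2 fun i => MvPolynomial.eval (fun j => x j) (P i), ?_, ?_⟩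
  · have h1 : ∀ i, AnalyticOnNhd ℝ (fun x : Sp d => MvPolynomial.eval (fun j => x j) (P i)) univ := by
      intro i
      exact AnalyticOnNhd.eval_linearMap' (fun j => (EuclideanSpace.proj (𝕜 := ℝ) j : Sp d →L[ℝ] ℝ).toLinearMap) (P i)
    have h2 : AnalyticOnNhd ℝ (fun (x : Sp d) (i : Fin d) => MvPolynomial.eval (fun j => x j) (P i)) univ :=
      fun x hx => AnalyticAt.pi fun i => h1 i x hx
    intro x hx
    exact ((PiLp.continuousLinearEquiv 2 ℝ (fun _ : Fin d => ℝ)).symm.toContinuousLinearMap.analyticAt _).comp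
      (h2 x hx)
  · intro x hx
    ext i
    exact hP i x hx

/-- The given extension g may vanish away from K. With c = φmin / 2, the function c + (g - c) χ((g -
c) / c), where χ is the smooth step, equals g where g ≥ φmin and is at least c everywhere. -/
theorem exists_smooth_extension (hφ : IsPiecewiseSmooth M φ) (h0 : 0 < φmin) {K : Set (Sp d)}
    (hK : K ∈ M) (hmin : ∀ x ∈ K, φmin ≤ φ x) :
    ∃ p : Sp d → ℝ, ContDiff ℝ ∞ p ∧ (∀ x, 0 < p x) ∧ EqOn φ p K := by
  obtain ⟨g, hg, hgK⟩ := hφ K hK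
  set c := φmin / 2 with hc
  have hc0 : 0 < c := by positivity
  refine ⟨fun x => c + (g x - c) * Real.smoothTransition ((g x - c) / c), ?_, ?_, ?_⟩
  · have h1 : ContDiff ℝ ∞ (fun x => Real.smoothTransition ((g x - c) / c)) :=
      Real.smoothTransition.contDiff.comp ((hg.sub contDiff_const).div_const c)
    exact contDiff_const.add ((hg.sub contDiff_const).mul h1)
  · intro x
    simp only
    rcases le_total (g x) c with h | h
    · rw [Real.smoothTransition.zero_of_nonpos
        (div_nonpos_of_nonpos_of_nonneg (sub_nonpos.2 h) hc0.le)]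
      simpa using hc0
    · have := Real.smoothTransition.nonneg ((g x - c) / c)
      have := mul_nonneg (sub_nonneg.2 h) this
      linarith
  · intro x hx
    have h1 : φmin ≤ g x := by rw [← hgK hx]; exact hmin x hx
    have h2 : 1 ≤ (g x - c) / c := by
      rw [le_div_iff₀ hc0]; linarith
    simp only [Real.smoothTransition.one_of_one_le h2]
    rw [hgK hx]; ring

theorem IsData.exists_extension (h : IsData Ω M φ V D φmin φmax Γ) (h0 : 0 < φmin) :
    ∃ W p, IsExtension M φ V W p := by
  have h1 : ∀ K : Set (Sp d), ∃ W : Sp d → Sp d, K ∈ M → AnalyticOnNhd ℝ W univ ∧ EqOn V W K := by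
    intro K
    by_cases hK : K ∈ M
    · obtain ⟨W, hW⟩ := exists_analytic_extension h.polynomial hK
      exact ⟨W, fun _ => hW⟩
    · exact ⟨0, fun h => absurd h hK⟩
  have h2 : ∀ K : Set (Sp d), ∃ p : Sp d → ℝ, K ∈ M →
      ContDiff ℝ ∞ p ∧ (∀ x, 0 < p x) ∧ EqOn φ p K := by
    intro K
    by_cases hK : K ∈ M
    · obtain ⟨p, hp⟩ := exists_smooth_extension h.smooth h0 hK
        fun x hx => (h.bounds x (h.mesh.subset K hK hx)).1
      exact ⟨p, fun _ => hp⟩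
    · exact ⟨0, fun h => absurd h hK⟩
  choose W hW using h1
  choose p hp using h2
  exact ⟨W, p, fun K hK => (hW K hK).1, fun K hK => (hW K hK).2, fun K hK => (hp K hK).1,
    fun K hK => (hp K hK).2.1, fun K hK => (hp K hK).2.2⟩

variable {W : Set (Sp d) → Sp d → Sp d} {p : Set (Sp d) → Sp d → ℝ}

theorem IsExtension.contDiff (hE : IsExtension M φ V W p) {K : Set (Sp d)} (hK : K ∈ M) :
    ContDiff ℝ 1 (W K) :=
  contDiff_iff_contDiffAt.2 fun x => (hE.analytic K hK x (mem_univ x)).contDiffAt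

theorem IsExtension.dv_eq (hE : IsExtension M φ V W p) (hM : IsMesh Ω M) {K : Set (Sp d)}
    (hK : K ∈ M) {x : Sp d} (hx : x ∈ K) : dv V x = dv (W K) x := by
  have : V =ᶠ[𝓝 x] W K :=
    (hE.eq_field K hK).eventuallyEq_of_mem ((hM.polytopal K hK).isOpen.mem_nhds hx)
  rw [dv, dv, this.fderiv_eq]

theorem IsHDiv.integrable (h : IsHDiv Ω V D) (hΩ : IsPolytopal Ω) : IntegrableOn D Ω := by
  have : IsFiniteMeasure (volume.restrict Ω) :=
    ⟨by rw [Measure.restrict_apply_univ]; exact hΩ.1.measure_lt_top⟩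
  exact h.memLp_div.integrable (by norm_num)

theorem fderiv_eq_zero_of_notMem {ψ : Sp d → ℝ} {x : Sp d} (hx : x ∉ tsupport ψ) :
    fderiv ℝ ψ x = 0 := by
  by_contra hne
  exact hx (support_fderiv_subset ℝ hne)

theorem integrable_fderiv_apply {ψ : Sp d → ℝ} (hψ : ContDiff ℝ ∞ ψ) (hc : HasCompactSupport ψ)
    {U : Sp d → Sp d} (hU : Continuous U) : Integrable (fun x => fderiv ℝ ψ x (U x)) := by
  have h1 : Continuous (fderiv ℝ ψ) := hψ.continuous_fderiv (by simp)
  refine Continuous.integrable_of_hasCompactSupport (by fun_prop) ?_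
  refine HasCompactSupport.intro' hc (isClosed_tsupport _) fun x hx => ?_
  rw [fderiv_eq_zero_of_notMem hx]; rfl

/-- In the cells, the weak divergence is the classical divergence. -/
theorem IsExtension.weak_div_ae_eq (hE : IsExtension M φ V W p) (hM : IsMesh Ω M)
    (hΩ : IsPolytopal Ω) (h : IsHDiv Ω V D) {K : Set (Sp d)} (hK : K ∈ M) :
    ∀ᵐ x ∂(volume.restrict Ω), x ∈ K → D x = dv (W K) x := by
  have hKo := (hM.polytopal K hK).isOpen
  have hKΩ := hM.subset K hK
  have hWc := hE.contDiff hK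
  have hdc := continuous_dv hWc
  have hDi : IntegrableOn D Ω := h.integrable hΩ
  have hli : LocallyIntegrableOn (fun x => D x - dv (W K) x) K (volume.restrict Ω) := by
    have h1 : LocallyIntegrable D (volume.restrict Ω) := Integrable.locallyIntegrable hDi
    exact (h1.sub hdc.locallyIntegrable).locallyIntegrableOn K
  have hz := hKo.ae_eq_zero_of_integral_contDiff_smul_eq_zero hli (by
    intro ψ hψ hc hs
    have hψc := hψ.continuous
    have h1 := h.weak_div ψ hψ hc (hs.trans hKΩ)
    have h2 := integral_fderiv_add_mul_dv hWc (hψ.of_le (by simp)) hc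
    have i1 := integrable_fderiv_apply hψ hc hWc.continuous
    have i2 : Integrable (fun x => ψ x * dv (W K) x) :=
      Continuous.integrable_of_hasCompactSupport (by fun_prop) hc.mul_right
    have e1 : ∫ x in Ω, fderiv ℝ ψ x (V x) = ∫ x, fderiv ℝ ψ x (W K x) := by
      rw [← setIntegral_eq_integral_of_forall_compl_eq_zero (s := Ω)
        (f := fun x => fderiv ℝ ψ x (W K x))]
      · refine setIntegral_congr_fun hΩ.isOpen.measurableSet fun x hx => ?_
        by_cases hx' : x ∈ tsupport ψ
        · simp only [hE.eq_field K hK (hs hx')]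
        · simp [fderiv_eq_zero_of_notMem hx']
      · intro x hx
        rw [fderiv_eq_zero_of_notMem fun h => hx (hKΩ (hs h))]; rfl
    have e2 : ∫ x in Ω, ψ x * dv (W K) x = ∫ x, ψ x * dv (W K) x := by
      refine setIntegral_eq_integral_of_forall_compl_eq_zero fun x hx => ?_
      rw [image_eq_zero_of_notMem_tsupport fun h => hx (hKΩ (hs h)), zero_mul]
    have i3 : IntegrableOn (fun x => ψ x * D x) Ω := by
      obtain ⟨C, hC⟩ := hc.exists_bound_of_continuous hψc
      exact hDi.bdd_mul hψc.aestronglyMeasurable (Eventually.of_forall hC)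
    simp only [smul_eq_mul, mul_sub]
    rw [integral_sub i3 i2.integrableOn, e2]
    rw [integral_add i1 i2] at h2
    rw [e1] at h1
    linarith)
  filter_upwards [hz] with x hx hxK
  linarith [hx hxK]

/-- Used with S a half-space and G₁, G₂ coming from the two cells along a face: the divergence
theorem removes the integral of G₁ and leaves the flux of the jump through the face. -/
theorem setIntegral_split {G G₁ G₂ : Sp d → ℝ} (hΩ : MeasurableSet Ω) {S : Set (Sp d)}
    (hS : MeasurableSet S) (h1 : Integrable G₁) (h2 : Integrable G₂) (z1 : ∀ x ∉ Ω, G₁ x = 0)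
    (z2 : ∀ x ∉ Ω, G₂ x = 0)
    (hG : ∀ᵐ x ∂(volume.restrict Ω), (x ∈ S → G x = G₂ x) ∧ (x ∉ S → G x = G₁ x)) :
    ∫ x in Ω, G x = (∫ x, G₁ x) + ∫ x in S, (G₂ x - G₁ x) := by
  have h21 : Integrable (fun x => G₂ x - G₁ x) := h2.sub h1
  rw [← integral_indicator hS, ← integral_add h1 (h21.indicator hS),
    ← setIntegral_eq_integral_of_forall_compl_eq_zero (s := Ω)
      (f := fun x => G₁ x + S.indicator (fun x => G₂ x - G₁ x) x)]
  · refine integral_congr_ae ?_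
    filter_upwards [hG] with x hx
    by_cases hxS : x ∈ S
    · simp [hxS, hx.1 hxS]
    · simp [hxS, hx.2 hxS]
  · intro x hx
    by_cases hxS : x ∈ S <;> simp [hxS, z1 x hx, z2 x hx]

/-- Continuity of the normal component of the velocity across the faces. -/
theorem IsExtension.inner_eq_of_isFaceAt (hE : IsExtension M φ V W p) (hM : IsMesh Ω M)
    (hΩ : IsPolytopal Ω) (h : IsHDiv Ω V D) {x₀ a : Sp d} {b ρ : ℝ} {K₁ K₂ : Set (Sp d)}
    (hf : IsFaceAt Ω M x₀ a b ρ K₁ K₂) {q : Sp d} (hq : q ∈ ball x₀ ρ) (hqb : inner ℝ a q = b) :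
    inner ℝ a (W K₁ q) = inner ℝ a (W K₂ q) := by
  obtain ⟨r, hr, hrs⟩ := Metric.isOpen_iff.1 isOpen_ball q hq
  have hW₁ := hE.contDiff hf.mem₁
  have hW₂ := hE.contDiff hf.mem₂
  have hd₁ := continuous_dv hW₁
  have hd₂ := continuous_dv hW₂
  -- Subtracting the divergence theorem for W K₁ from the weak divergence identity of V shows that W
  -- K₂ - W K₁, restricted to the half-space of K₂, has no flux through the face.
  have key := inner_eq_zero_of_no_flux (hW₂.sub hW₁) hf.ne_zero (q := q) hr (by
    intro ψ hψ hc hs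
    rw [hqb]
    have hψc := hψ.continuous
    have hsΩ : tsupport ψ ⊆ Ω := hs.trans (hrs.trans hf.subset)
    set S : Set (Sp d) := {x | b < inner ℝ a x} with hS
    have hSm : MeasurableSet S := (isOpen_lt continuous_const (by fun_prop)).measurableSet
    have i1 := fun {K} (hK : K ∈ M) => integrable_fderiv_apply hψ hc (hE.contDiff hK).continuous
    have i2 : ∀ {K}, K ∈ M → Integrable (fun x => ψ x * dv (W K) x) := fun {K} hK => by
      have := continuous_dv (hE.contDiff hK)
      exact Continuous.integrable_of_hasCompactSupport (by fun_prop) hc.mul_right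
    have hnull : ∀ᵐ x ∂(volume.restrict Ω), inner ℝ a x ≠ b := by
      refine ae_restrict_of_ae ?_
      rw [ae_iff]
      simpa using volume_hyperplane hf.ne_zero b
    have hside : ∀ x, inner ℝ a x ≠ b → x ∈ tsupport ψ → (x ∈ S → x ∈ K₂) ∧ (x ∉ S → x ∈ K₁) :=
      fun x hxb hx => ⟨fun hxS => hf.side₂ x (hrs (hs hx)) hxS,
        fun hxS => hf.side₁ x (hrs (hs hx)) (lt_of_le_of_ne (not_lt.1 hxS) hxb)⟩
    have s1 := setIntegral_split (G := fun x => fderiv ℝ ψ x (V x)) hΩ.isOpen.measurableSet hSm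
      (i1 hf.mem₁) (i1 hf.mem₂)
      (fun x hx => by rw [fderiv_eq_zero_of_notMem fun h => hx (hsΩ h)]; rfl)
      (fun x hx => by rw [fderiv_eq_zero_of_notMem fun h => hx (hsΩ h)]; rfl) (by
        filter_upwards [hnull] with x hx
        by_cases hx' : x ∈ tsupport ψ
        · exact ⟨fun hxS => by rw [hE.eq_field K₂ hf.mem₂ ((hside x hx hx').1 hxS)],
            fun hxS => by rw [hE.eq_field K₁ hf.mem₁ ((hside x hx hx').2 hxS)]⟩
        · simp [fderiv_eq_zero_of_notMem hx'])
    have s2 := setIntegral_split (G := fun x => ψ x * D x) hΩ.isOpen.measurableSet hSm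
      (i2 hf.mem₁) (i2 hf.mem₂)
      (fun x hx => by rw [image_eq_zero_of_notMem_tsupport fun h => hx (hsΩ h), zero_mul])
      (fun x hx => by rw [image_eq_zero_of_notMem_tsupport fun h => hx (hsΩ h), zero_mul]) (by
        filter_upwards [hnull, hE.weak_div_ae_eq hM hΩ h hf.mem₁,
          hE.weak_div_ae_eq hM hΩ h hf.mem₂] with x hx hx1 hx2
        by_cases hx' : x ∈ tsupport ψ
        · exact ⟨fun hxS => by rw [hx2 ((hside x hx hx').1 hxS)],
            fun hxS => by rw [hx1 ((hside x hx hx').2 hxS)]⟩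
        · simp [image_eq_zero_of_notMem_tsupport hx'])
    have h1 := h.weak_div ψ hψ hc hsΩ
    have h2 := integral_fderiv_add_mul_dv hW₁ (hψ.of_le (by simp)) hc
    rw [integral_add (i1 hf.mem₁) (i2 hf.mem₁)] at h2
    have hdv : ∀ x, dv (fun x => W K₂ x - W K₁ x) x = dv (W K₂) x - dv (W K₁) x := by
      intro x
      have : fderiv ℝ (fun x => W K₂ x - W K₁ x) x = fderiv ℝ (W K₂) x - fderiv ℝ (W K₁) x :=
        fderiv_fun_sub (hW₂.differentiable one_ne_zero x) (hW₁.differentiable one_ne_zero x)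
      simp [dv, this]
    have e : ∀ x, fderiv ℝ ψ x (W K₂ x - W K₁ x) + ψ x * dv (fun x => W K₂ x - W K₁ x) x =
        (fderiv ℝ ψ x (W K₂ x) - fderiv ℝ ψ x (W K₁ x)) +
          (ψ x * dv (W K₂) x - ψ x * dv (W K₁) x) := by
      intro x
      rw [hdv, map_sub]; ring
    simp_rw [e]
    have j1 : Integrable (fun x => fderiv ℝ ψ x (W K₂ x) - fderiv ℝ ψ x (W K₁ x)) :=
      (i1 hf.mem₂).sub (i1 hf.mem₁)
    have j2 : Integrable (fun x => ψ x * dv (W K₂) x - ψ x * dv (W K₁) x) :=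
      (i2 hf.mem₂).sub (i2 hf.mem₁)
    rw [integral_add j1.integrableOn j2.integrableOn]
    linarith)
  rw [inner_sub_right] at key
  linarith

end Extensions

variable {W : Set (Sp d) → Sp d → Sp d} {p : Set (Sp d) → Sp d → ℝ}

/-! ### The critical set and its thinness -/

section Critical

/-- The analytic functions whose zeros on the hyperplane `h` are critical: the equations of the
other hyperplanes, and the normal components of the velocities. -/
def faceFunctions (M : Set (Set (Sp d))) (H : Finset (Sp d × ℝ)) (W : Set (Sp d) → Sp d → Sp d)
    (h : Sp d × ℝ) : Set (Sp d → ℝ) :=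
  (fun (h' : Sp d × ℝ) (x : Sp d) => inner ℝ h'.1 x - h'.2) '' (H : Set (Sp d × ℝ)) ∪
    (fun (K : Set (Sp d)) (x : Sp d) => inner ℝ h.1 (W K x)) '' M

/-- The face functions which do not vanish identically on the hyperplane. -/
def properFaceFunctions (M : Set (Set (Sp d))) (H : Finset (Sp d × ℝ))
    (W : Set (Sp d) → Sp d → Sp d) (h : Sp d × ℝ) : Set (Sp d → ℝ) :=
  {q ∈ faceFunctions M H W h | ∃ y : Sp d, inner ℝ h.1 y = h.2 ∧ q y ≠ 0}

/-- The critical set: intersections of hyperplanes, and points where the velocity is tangent to a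
hyperplane. -/
def critical (M : Set (Set (Sp d))) (H : Finset (Sp d × ℝ)) (W : Set (Sp d) → Sp d → Sp d) :
    Set (Sp d) :=
  ⋃ h ∈ (H : Set (Sp d × ℝ)), ⋃ q ∈ properFaceFunctions M H W h,
    {x | inner ℝ h.1 x = h.2 ∧ q x = 0}

theorem finite_properFaceFunctions (hM : M.Finite) (H : Finset (Sp d × ℝ)) (h : Sp d × ℝ) :
    (properFaceFunctions M H W h).Finite :=
  ((H.finite_toSet.image _).union (hM.image _)).subset (sep_subset _ _)

theorem IsExtension.analytic_faceFunction (hE : IsExtension M φ V W p) {H : Finset (Sp d × ℝ)}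
    {h : Sp d × ℝ} {q : Sp d → ℝ} (hq : q ∈ properFaceFunctions M H W h) :
    AnalyticOnNhd ℝ q univ := by
  rcases hq.1 with ⟨h', -, rfl⟩ | ⟨K, hK, rfl⟩
  · exact fun z _ => ((innerSL ℝ h'.1).analyticAt z).sub analyticAt_const
  · exact fun z hz => ((innerSL ℝ h.1).analyticAt _).comp (hE.analytic K hK z hz)

theorem IsExtension.isClosed_critical (hE : IsExtension M φ V W p) (hM : M.Finite)
    (H : Finset (Sp d × ℝ)) : IsClosed (critical M H W) := by
  refine H.finite_toSet.isClosed_biUnion fun h _ =>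
    (finite_properFaceFunctions hM H h).isClosed_biUnion fun q hq => ?_
  have hqc : Continuous q := continuousOn_univ.1 (hE.analytic_faceFunction hq).continuousOn
  exact (isClosed_eq (by fun_prop) continuous_const).inter (isClosed_eq hqc continuous_const)

/-- The neighbourhoods of the bounded parts of `B` have a measure which is negligible with respect
to their width. -/
def IsThin (B : Set (Sp d)) : Prop :=
  ∀ R L ε : ℝ, 0 < L → 0 < ε → ∃ δ₀ > 0, ∀ δ, 0 < δ → δ ≤ δ₀ →
    volume {x | ∃ y ∈ closedBall (0 : Sp d) R, y ∈ B ∧ dist x y ≤ L * δ} ≤ ENNReal.ofReal (ε * δ)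

theorem isThin_empty : IsThin (∅ : Set (Sp d)) := fun R L ε _ _ => ⟨1, one_pos, fun δ _ _ => by simp⟩

theorem IsThin.union {A B : Set (Sp d)} (hA : IsThin A) (hB : IsThin B) : IsThin (A ∪ B) := by
  intro R L ε hL hε
  obtain ⟨δ₁, h1, h1'⟩ := hA R L (ε / 2) hL (by positivity)
  obtain ⟨δ₂, h2, h2'⟩ := hB R L (ε / 2) hL (by positivity)
  refine ⟨min δ₁ δ₂, lt_min h1 h2, fun δ hδ hδ' => ?_⟩
  calc volume {x | ∃ y ∈ closedBall (0 : Sp d) R, y ∈ A ∪ B ∧ dist x y ≤ L * δ}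
      ≤ volume ({x | ∃ y ∈ closedBall (0 : Sp d) R, y ∈ A ∧ dist x y ≤ L * δ} ∪
          {x | ∃ y ∈ closedBall (0 : Sp d) R, y ∈ B ∧ dist x y ≤ L * δ}) := by
        refine measure_mono ?_
        rintro x ⟨y, hy, hyA | hyB, hxy⟩
        · exact Or.inl ⟨y, hy, hyA, hxy⟩
        · exact Or.inr ⟨y, hy, hyB, hxy⟩
    _ ≤ _ := measure_union_le _ _
    _ ≤ ENNReal.ofReal (ε / 2 * δ) + ENNReal.ofReal (ε / 2 * δ) :=
        add_le_add (h1' δ hδ (hδ'.trans (min_le_left _ _))) (h2' δ hδ (hδ'.trans (min_le_right _ _)))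
    _ = ENNReal.ofReal (ε * δ) := by
        rw [← ENNReal.ofReal_add (by positivity) (by positivity)]
        congr 1; ring

theorem isThin_biUnion {ι : Type*} {s : Set ι} (hs : s.Finite) {B : ι → Set (Sp d)}
    (hB : ∀ i ∈ s, IsThin (B i)) : IsThin (⋃ i ∈ s, B i) := by
  induction s, hs using Set.Finite.induction_on with
  | empty => simpa using isThin_empty
  | insert _ _ ih =>
    rw [biUnion_insert]
    exact (hB _ (mem_insert _ _)).union (ih fun i hi => hB i (mem_insert_of_mem _ hi))

/-- Finitely many pieces, each the zero set in a hyperplane of an analytic function that does not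
vanish identically there. This is where V being polynomial in the cells, rather than merely smooth,
matters. -/
theorem IsExtension.isThin_critical (hE : IsExtension M φ V W p) (hM : M.Finite)
    {H : Finset (Sp d × ℝ)} (hH : CarriesFaces M H) : IsThin (critical M H W) := by
  refine isThin_biUnion H.finite_toSet fun h hh =>
    isThin_biUnion (finite_properFaceFunctions hM H h) fun q hq => ?_
  intro R L ε hL hε
  obtain ⟨y, hy, hqy⟩ := hq.2
  obtain ⟨δ₀, h0, hδ⟩ := exists_measure_thickening_le (volume : Measure (Sp d)) (hH.ne_zero h hh) h.2
    (hE.analytic_faceFunction hq) hy hqy R L hL hε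
  refine ⟨δ₀, h0, fun δ hδ0 hδ1 => ?_⟩
  simpa only [mem_ofPred_eq, and_assoc] using hδ δ hδ0 hδ1

theorem mem_critical {H : Finset (Sp d × ℝ)} {h : Sp d × ℝ} (hh : h ∈ H) {q : Sp d → ℝ}
    (hq : q ∈ faceFunctions M H W h) {x : Sp d} (hx : inner ℝ h.1 x = h.2) (hqx : q x = 0)
    {y : Sp d} (hy : inner ℝ h.1 y = h.2) (hqy : q y ≠ 0) : x ∈ critical M H W :=
  mem_iUnion₂.2 ⟨h, hh, mem_iUnion₂.2 ⟨q, ⟨hq, y, hy, hqy⟩, hx, hqx⟩⟩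

/-- The velocity crosses the face at `x₀`, from `K₁` to `K₂`. -/
structure IsCrossing (Ω : Set (Sp d)) (M : Set (Set (Sp d))) (W : Set (Sp d) → Sp d → Sp d)
    (x₀ a : Sp d) (b ρ : ℝ) (K₁ K₂ : Set (Sp d)) : Prop extends IsFaceAt Ω M x₀ a b ρ K₁ K₂ where
  inner_pos : 0 < inner ℝ a (W K₁ x₀)
  inner_eq : inner ℝ a (W K₁ x₀) = inner ℝ a (W K₂ x₀)

/-- The velocity is tangent to the face at `x₀` and near `x₀`. -/
structure IsTangency (Ω : Set (Sp d)) (M : Set (Set (Sp d))) (W : Set (Sp d) → Sp d → Sp d)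
    (x₀ a : Sp d) (b ρ : ℝ) (K₁ K₂ : Set (Sp d)) : Prop extends IsFaceAt Ω M x₀ a b ρ K₁ K₂ where
  inner_eq_zero : ∀ y : Sp d, inner ℝ a y = b → inner ℝ a (W K₁ y) = 0 ∧ inner ℝ a (W K₂ y) = 0

/-- Off the critical set all the hyperplanes through x₀ coincide, and a normal velocity which
vanishes at x₀ vanishes on the whole hyperplane. Continuity of the normal component carries this
over from K₁ to K₂, and a negative sign is corrected by reversing the normal. -/
theorem IsExtension.crossing_or_tangency (hE : IsExtension M φ V W p) (hM : IsMesh Ω M)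
    (hΩ : IsPolytopal Ω) (hV : IsHDiv Ω V D) {H : Finset (Sp d × ℝ)} (hH : CarriesFaces M H)
    {x₀ : Sp d} (hx₀ : x₀ ∈ Ω) (hM₀ : x₀ ∉ ⋃₀ M) (hc : x₀ ∉ critical M H W) :
    (∃ a b ρ K₁ K₂, IsCrossing Ω M W x₀ a b ρ K₁ K₂) ∨
      ∃ a b ρ K₁ K₂, IsTangency Ω M W x₀ a b ρ K₁ K₂ := by
  obtain ⟨h, hh, hxh⟩ := hH.mem_hyperplane hM hΩ.isOpen hx₀ hM₀
  obtain ⟨ρ, K₁, K₂, hf⟩ := hH.exists_isFaceAt hM hΩ.isOpen hx₀ hM₀ hh hxh (by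
    intro h' hh' hx' y hy
    by_contra hne
    exact hc (mem_critical hh (Or.inl ⟨h', hh', rfl⟩) hxh (sub_eq_zero.2 hx') hy
      (sub_ne_zero.2 hne)))
  have heq := hE.inner_eq_of_isFaceAt hM hΩ hV hf (mem_ball_self hf.pos) hxh
  rcases lt_trichotomy (inner ℝ h.1 (W K₁ x₀)) 0 with h1 | h1 | h1
  · exact Or.inl ⟨_, _, _, _, _, hf.symm, by rw [inner_neg_left]; linarith,
      by rw [inner_neg_left, inner_neg_left, heq]⟩
  · refine Or.inr ⟨_, _, _, _, _, hf, fun y hy => ⟨?_, ?_⟩⟩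
    · by_contra hne
      exact hc (mem_critical hh (Or.inr ⟨K₁, hf.mem₁, rfl⟩) hxh h1 hy hne)
    · by_contra hne
      exact hc (mem_critical hh (Or.inr ⟨K₂, hf.mem₂, rfl⟩) hxh (heq.symm.trans h1) hy hne)
  · exact Or.inl ⟨_, _, _, _, _, hf, h1, heq⟩

end Critical

variable {T R L : ℝ} {H : Finset (Sp d × ℝ)}

/-! ### Integral estimates along trajectories -/

section Trajectories

/-- The extension to the whole space of the velocity `V / φ` in the cell `K`. -/
noncomputable def speed (W : Set (Sp d) → Sp d → Sp d) (p : Set (Sp d) → Sp d → ℝ)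
    (K : Set (Sp d)) (x : Sp d) : Sp d := (p K x)⁻¹ • W K x

/-- The growth rate `div V / φ` of the Jacobian along the trajectories. -/
noncomputable def rate (φ : Sp d → ℝ) (V : Sp d → Sp d) (x : Sp d) : ℝ := dv V x / φ x

/-- The data of the problem, together with extensions, hyperplanes and bounds. -/
structure Frame (Ω : Set (Sp d)) (M : Set (Set (Sp d))) (φ : Sp d → ℝ) (V : Sp d → Sp d)
    (D : Sp d → ℝ) (φmin φmax Γ T : ℝ) (W : Set (Sp d) → Sp d → Sp d)
    (p : Set (Sp d) → Sp d → ℝ) (H : Finset (Sp d × ℝ)) (R L : ℝ) : Prop where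
  data : IsData Ω M φ V D φmin φmax Γ
  ext : IsExtension M φ V W p
  faces : CarriesFaces M H
  T_pos : 0 < T
  φmin_pos : 0 < φmin
  L_pos : 0 < L
  subset_ball : Ω ⊆ closedBall 0 R
  speed_le : ∀ K ∈ M, ∀ x ∈ K, ‖speed W p K x‖ ≤ L
  div_le : ∀ K ∈ M, ∀ x ∈ K, |dv (W K) x| ≤ Γ

theorem IsExtension.contDiff_speed (hE : IsExtension M φ V W p) {K : Set (Sp d)} (hK : K ∈ M) :
    ContDiff ℝ 1 (speed W p K) := by
  have h1 : ContDiff ℝ 1 (fun x => (p K x)⁻¹) :=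
    ((hE.smooth K hK).of_le (by simp)).inv fun x => (hE.pos K hK x).ne'
  exact h1.smul (hE.contDiff hK)

/-- The classical divergence is continuous and the cell is open, so the almost everywhere bound on
the weak divergence holds at every point of the cell. -/
theorem IsData.div_le (h : IsData Ω M φ V D φmin φmax Γ) (hE : IsExtension M φ V W p)
    {K : Set (Sp d)} (hK : K ∈ M) : ∀ x ∈ K, |dv (W K) x| ≤ Γ := by
  have hKo := (h.mesh.polytopal K hK).isOpen
  have hKΩ := h.mesh.subset K hK
  have hc := continuous_dv (hE.contDiff hK)
  have hae : ∀ᵐ x ∂(volume.restrict K), |dv (W K) x| ≤ Γ := by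
    have h1 := ae_restrict_of_ae_restrict_of_subset hKΩ h.div_bound
    have h2 := ae_restrict_of_ae_restrict_of_subset hKΩ
      (hE.weak_div_ae_eq h.mesh h.domain h.hdiv hK)
    filter_upwards [h1, h2, ae_restrict_mem hKo.measurableSet] with x hx1 hx2 hxK
    rwa [← hx2 hxK]
  have hon : EqOn (fun x => max (|dv (W K) x|) Γ) (fun _ => Γ) K := by
    refine Measure.eqOn_open_of_ae_eq (μ := volume) ?_ hKo (by fun_prop) continuousOn_const
    filter_upwards [hae] with x hx
    exact max_eq_right hx
  intro x hx
  exact max_eq_right_iff.1 (hon hx)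

theorem IsData.exists_frame (h : IsData Ω M φ V D φmin φmax Γ) (h0 : 0 < φmin) (hT : 0 < T) :
    ∃ W p H R L, Frame Ω M φ V D φmin φmax Γ T W p H R L := by
  obtain ⟨W, p, hE⟩ := h.exists_extension h0
  obtain ⟨H, hH⟩ := h.mesh.exists_carriesFaces
  obtain ⟨R, hR⟩ := h.domain.1.subset_closedBall 0
  have hL : ∃ L : ℝ, 0 < L ∧ ∀ K ∈ M, ∀ x ∈ K, ‖speed W p K x‖ ≤ L := by
    have h1 : ∀ K : Set (Sp d), ∃ L : ℝ, K ∈ M → ∀ x ∈ K, ‖speed W p K x‖ ≤ L := by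
      intro K
      by_cases hK : K ∈ M
      · obtain ⟨C, hC⟩ := (isCompact_closedBall (0 : Sp d) R).exists_bound_of_continuousOn
          (hE.contDiff_speed hK).continuous.continuousOn
        exact ⟨C, fun _ x hx => hC x (hR (h.mesh.subset K hK hx))⟩
      · exact ⟨0, fun h => absurd h hK⟩
    choose C hC using h1
    obtain ⟨L, hL⟩ := (h.mesh.finite.image C).bddAbove
    exact ⟨max L 1, by positivity, fun K hK x hx => (hC K hK x hx).trans
      ((hL (mem_image_of_mem C hK)).trans (le_max_left _ _))⟩
  obtain ⟨L, hL0, hL⟩ := hL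
  exact ⟨W, p, H, R, L, h, hE, hH, hT, h0, hL0, hR, hL, fun K hK => h.div_le hE hK⟩

/-- `γ` is a trajectory starting at `γ 0`. -/
def Traj (Ω : Set (Sp d)) (M : Set (Set (Sp d))) (φ : Sp d → ℝ) (V : Sp d → Sp d) (T : ℝ)
    (γ : ℝ → Sp d) : Prop := IsTrajectory Ω M φ V T (γ 0) γ

variable {γ η : ℝ → Sp d} {s t : ℝ}

theorem Traj.continuousOn (hγ : Traj Ω M φ V T γ) : ContinuousOn γ (Icc (-T) T) := by
  obtain ⟨L, hL⟩ := hγ.lipschitz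
  exact hL.continuousOn

theorem Traj.exists_countable (hγ : Traj Ω M φ V T γ) (hE : IsExtension M φ V W p) :
    ∃ N : Set ℝ, N.Countable ∧ ∀ t ∈ Ioo (-T) T \ N, ∃ K ∈ M, γ t ∈ K ∧
      HasDerivAt γ (speed W p K (γ t)) t := by
  obtain ⟨N, hN, h⟩ := hγ.ode
  refine ⟨N, hN, fun t ht => ?_⟩
  obtain ⟨⟨K, hK, htK⟩, hd⟩ := h t ⟨Ioo_subset_Icc_self ht.1, ht.2⟩
  refine ⟨K, hK, htK, ?_⟩
  have h1 := hd.hasDerivAt (Icc_mem_nhds ht.1.1 ht.1.2)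
  rwa [hE.eq_field K hK htK, hE.eq_porosity K hK htK] at h1

theorem Traj.countable (hγ : Traj Ω M φ V T γ) : {t ∈ Icc (-T) T | γ t ∉ ⋃₀ M}.Countable := by
  obtain ⟨N, hN, h⟩ := hγ.ode
  refine hN.mono fun t ht => ?_
  by_contra hcon
  exact ht.2 (h t ⟨ht.1, hcon⟩).1

theorem Traj.exists_mem_cell (hγ : Traj Ω M φ V T γ) (hs : -T ≤ s) (hst : s < t) (ht : t ≤ T) :
    ∃ r ∈ Ioo s t, γ r ∈ ⋃₀ M := by
  by_contra! hcon
  have h1 : Ioo s t ⊆ {t ∈ Icc (-T) T | γ t ∉ ⋃₀ M} := fun r hr =>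
    ⟨⟨hs.trans hr.1.le, hr.2.le.trans ht⟩, hcon r hr⟩
  have h2 := (hγ.countable.mono h1).measure_zero volume
  rw [Real.volume_Ioo, ENNReal.ofReal_eq_zero] at h2
  linarith

/-- The fundamental theorem of calculus along a trajectory. -/
theorem Frame.integral_deriv (hF : Frame Ω M φ V D φmin φmax Γ T W p H R L)
    (hγ : Traj Ω M φ V T γ) (hs : -T ≤ s) (hst : s ≤ t) (ht : t ≤ T) :
    IntervalIntegrable (deriv γ) volume s t ∧ ∫ r in s..t, deriv γ r = γ t - γ s ∧
      ∀ᵐ r, r ∈ Ioc s t → r ∈ Ioo s t ∧ ∃ K ∈ M, γ r ∈ K ∧ deriv γ r = speed W p K (γ r) := by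
  obtain ⟨N, hN, h⟩ := hγ.exists_countable hF.ext
  have hsub : Ioo s t ⊆ Ioo (-T) T := Ioo_subset_Ioo hs ht
  have hae : ∀ᵐ r, r ∈ Ioc s t → r ∈ Ioo s t ∧ ∃ K ∈ M, γ r ∈ K ∧ deriv γ r = speed W p K (γ r) := by
    have h1 : ∀ᵐ r : ℝ, r ∉ N := by
      rw [ae_iff]; simpa using hN.measure_zero volume
    have h2 : ∀ᵐ r : ℝ, r ≠ t := by rw [ae_iff]; simp
    filter_upwards [h1, h2] with r hr1 hr2 hr
    have hr' : r ∈ Ioo s t := ⟨hr.1, lt_of_le_of_ne hr.2 hr2⟩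
    obtain ⟨K, hK, hrK, hd⟩ := h r ⟨hsub hr', hr1⟩
    exact ⟨hr', K, hK, hrK, hd.deriv⟩
  have hint : IntervalIntegrable (deriv γ) volume s t := by
    rw [intervalIntegrable_iff_integrableOn_Ioc_of_le hst]
    refine Measure.integrableOn_of_bounded (M := L) measure_Ioc_lt_top.ne
      (stronglyMeasurable_deriv γ).aestronglyMeasurable ?_
    refine (ae_restrict_iff' measurableSet_Ioc).2 ?_
    filter_upwards [hae] with r hr hr'
    obtain ⟨-, K, hK, hrK, hd⟩ := hr hr'
    rw [hd]
    exact hF.speed_le K hK _ hrK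
  refine ⟨hint, ?_, hae⟩
  refine integral_eq_of_hasDerivAt_off_countable_of_le γ _ hst hN
    (hγ.continuousOn.mono (Icc_subset_Icc hs ht)) (fun r hr => ?_) hint
  obtain ⟨K, hK, hrK, hd⟩ := h r ⟨hsub hr.1, hr.2⟩
  rw [hd.deriv]
  exact hd

/-- Mean value inequality along a trajectory. -/
theorem Frame.norm_sub_sub_smul_le (hF : Frame Ω M φ V D φmin φmax Γ T W p H R L)
    (hγ : Traj Ω M φ V T γ) (hs : -T ≤ s) (hst : s ≤ t) (ht : t ≤ T) {v : Sp d} {ε : ℝ}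
    (h : ∀ r ∈ Ioo s t, ∀ K ∈ M, γ r ∈ K → ‖speed W p K (γ r) - v‖ ≤ ε) :
    ‖γ t - γ s - (t - s) • v‖ ≤ ε * (t - s) := by
  obtain ⟨h1, h2, h3⟩ := hF.integral_deriv hγ hs hst ht
  have h4 : ∫ r in s..t, (deriv γ r - v) = γ t - γ s - (t - s) • v := by
    rw [intervalIntegral.integral_sub h1 (by simp), h2]
    simp
  rw [← h4]
  refine (intervalIntegral.norm_integral_le_of_norm_le_const_ae (C := ε) ?_).trans
    (by rw [abs_of_nonneg (sub_nonneg.2 hst)])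
  filter_upwards [h3] with r hr hr'
  rw [uIoc_of_le hst] at hr'
  obtain ⟨hr1, K, hK, hrK, hd⟩ := hr hr'
  rw [hd]
  exact h r hr1 K hK hrK

/-- The Lipschitz constant in `IsTrajectory` may depend on the trajectory; the constant L is common
to all of them, which every comparison of trajectories requires. -/
theorem Frame.norm_sub_le (hF : Frame Ω M φ V D φmin φmax Γ T W p H R L)
    (hγ : Traj Ω M φ V T γ) (hs : s ∈ Icc (-T) T) (ht : t ∈ Icc (-T) T) :
    ‖γ t - γ s‖ ≤ L * |t - s| := by
  have key : ∀ {s t : ℝ}, s ∈ Icc (-T) T → t ∈ Icc (-T) T → s ≤ t → ‖γ t - γ s‖ ≤ L * |t - s| := by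
    intro s t hs ht hst
    have := hF.norm_sub_sub_smul_le hγ hs.1 hst ht.2 (v := 0) (ε := L)
      fun r _ K hK hrK => by simpa using hF.speed_le K hK _ hrK
    rw [abs_of_nonneg (sub_nonneg.2 hst)]
    simpa using this
  rcases le_total s t with h | h
  · exact key hs ht h
  · rw [norm_sub_rev, abs_sub_comm]
    exact key ht hs h

theorem Frame.mul_le_inner (hF : Frame Ω M φ V D φmin φmax Γ T W p H R L)
    (hγ : Traj Ω M φ V T γ) (hs : -T ≤ s) (hst : s ≤ t) (ht : t ≤ T) {a : Sp d} {c : ℝ}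
    (h : ∀ r ∈ Ioo s t, ∀ K ∈ M, γ r ∈ K → c ≤ inner ℝ a (speed W p K (γ r))) :
    c * (t - s) ≤ inner ℝ a (γ t) - inner ℝ a (γ s) := by
  obtain ⟨h1, h2, h3⟩ := hF.integral_deriv hγ hs hst ht
  have h4 : ∫ r in s..t, inner ℝ a (deriv γ r) = inner ℝ a (γ t) - inner ℝ a (γ s) := by
    rw [← inner_sub_right, ← h2]
    exact (innerSL ℝ a).intervalIntegral_comp_comm h1
  have h5 : IntervalIntegrable (fun r => inner ℝ a (deriv γ r)) volume s t := by
    rw [intervalIntegrable_iff_integrableOn_Ioc_of_le hst] at h1 ⊢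
    exact (innerSL ℝ a).integrable_comp h1
  have h6 : ∫ r in s..t, c = c * (t - s) := by simp [mul_comm]
  rw [← h4, ← h6]
  refine intervalIntegral.integral_mono_ae_restrict hst (by simp) h5 ?_
  have h7 : ∀ᵐ r, r ≠ s := by rw [ae_iff]; simp
  refine (ae_restrict_iff' measurableSet_Icc).2 ?_
  filter_upwards [h3, h7] with r hr hr7 hr'
  obtain ⟨hr1, K, hK, hrK, hd⟩ := hr ⟨lt_of_le_of_ne hr'.1 hr7.symm, hr'.2⟩
  rw [hd]
  exact h r hr1 K hK hrK

theorem exists_continuous_extension {F : Type*} [TopologicalSpace F] {g : ℝ → F} (hst : s ≤ t)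
    (hg : ContinuousOn g (Icc s t)) : ∃ h : ℝ → F, Continuous h ∧ EqOn h g (Icc s t) := by
  refine ⟨IccExtend hst ((Icc s t).domRestrict g), hg.domRestrict.Icc_extend', fun r hr => ?_⟩
  rw [IccExtend_of_mem hst _ hr]; rfl

/-- In a cell, a trajectory is a classical solution. -/
theorem Frame.solves (hF : Frame Ω M φ V D φmin φmax Γ T W p H R L)
    (hγ : Traj Ω M φ V T γ) (hs : -T ≤ s) (hst : s ≤ t) (ht : t ≤ T) {K : Set (Sp d)} (hK : K ∈ M)
    (h : ∀ r ∈ Ioo s t, γ r ∈ K) : Solves (speed W p K) γ s t := by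
  have hc : ContinuousOn γ (Icc s t) := hγ.continuousOn.mono (Icc_subset_Icc hs ht)
  obtain ⟨g, hg, hgeq⟩ := exists_continuous_extension hst
    ((hF.ext.contDiff_speed hK).continuous.comp_continuousOn hc)
  -- The differential equation is only given off a countable set. The integral equation with a
  -- continuous integrand recovers it at all times, including the endpoints, where γ may be on the
  -- boundary of K.
  have key : ∀ r ∈ Icc s t, γ r = γ s + ∫ u in s..r, g u := by
    intro r hr
    obtain ⟨h1, h2, h3⟩ := hF.integral_deriv hγ hs hr.1 (hr.2.trans ht)
    have : ∫ u in s..r, g u = ∫ u in s..r, deriv γ u := by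
      refine intervalIntegral.integral_congr_ae ?_
      rw [uIoc_of_le hr.1]
      filter_upwards [h3] with u hu hu'
      obtain ⟨hu1, K', hK', huK', hd⟩ := hu hu'
      have huK := h u ⟨hu1.1, hu1.2.trans_le hr.2⟩
      have : K' = K := by
        by_contra hne
        exact Set.disjoint_left.1 (hF.data.mesh.disjoint hK' hK hne) huK' huK
      rw [hd, this, hgeq ⟨hu1.1.le, hu1.2.le.trans hr.2⟩]
      rfl
    rw [this, h2]
    abel
  intro r hr
  have h1 : HasDerivAt (fun r => γ s + ∫ u in s..r, g u) (g r) r :=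
    ((hg.integral_hasStrictDerivAt s r).hasDerivAt).const_add _
  have h2 := h1.hasDerivWithinAt (s := Icc s t)
  rw [hgeq hr] at h2
  exact h2.congr key (key r hr)

end Trajectories

/-! ### Growth rate of the Jacobian -/

section Rate

/-- The extension of the rate from the cell `K`. -/
noncomputable def cellRate (W : Set (Sp d) → Sp d → Sp d) (p : Set (Sp d) → Sp d → ℝ)
    (K : Set (Sp d)) (x : Sp d) : ℝ := dv (W K) x / p K x

theorem IsExtension.continuous_cellRate (hE : IsExtension M φ V W p) {K : Set (Sp d)}
    (hK : K ∈ M) : Continuous (cellRate W p K) :=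
  (continuous_dv (hE.contDiff hK)).div (hE.smooth K hK).continuous fun x => (hE.pos K hK x).ne'

theorem Frame.rate_eq (hF : Frame Ω M φ V D φmin φmax Γ T W p H R L) {K : Set (Sp d)}
    (hK : K ∈ M) : EqOn (rate φ V) (cellRate W p K) K := fun x hx => by
  rw [rate, cellRate, hF.ext.dv_eq hF.data.mesh hK hx, hF.ext.eq_porosity K hK hx]

theorem Frame.φ_ge (hF : Frame Ω M φ V D φmin φmax Γ T W p H R L) {x : Sp d} (hx : x ∈ ⋃₀ M) :
    φmin ≤ φ x := by
  obtain ⟨K, hK, hx⟩ := hx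
  exact (hF.data.bounds x (hF.data.mesh.subset K hK hx)).1

theorem Frame.abs_rate_le (hF : Frame Ω M φ V D φmin φmax Γ T W p H R L) {x : Sp d}
    (hx : x ∈ ⋃₀ M) : |rate φ V x| ≤ Γ / φmin := by
  have h1 := hF.φ_ge hx
  have h0 := hF.φmin_pos
  obtain ⟨K, hK, hx⟩ := hx
  have h2 := hF.div_le K hK x hx
  rw [rate, hF.ext.dv_eq hF.data.mesh hK hx, abs_div, abs_of_pos (h0.trans_le h1)]
  exact div_le_div₀ ((abs_nonneg _).trans h2) h2 h0 h1

theorem measurable_indicator_sUnion {N : Set (Set (Sp d))} (hN : N.Finite) {g : Sp d → ℝ}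
    (h : ∀ K ∈ N, MeasurableSet K ∧ ∃ k : Sp d → ℝ, Measurable k ∧ EqOn g k K) :
    Measurable ((⋃₀ N).indicator g) := by
  classical
  induction N, hN using Set.Finite.induction_on with
  | empty => simp
  | @insert K N _ _ ih =>
    obtain ⟨hKm, k, hk, hkeq⟩ := h K (mem_insert _ _)
    have e : (⋃₀ insert K N).indicator g = K.piecewise k ((⋃₀ N).indicator g) := by
      ext x
      by_cases hx : x ∈ K
      · rw [piecewise_eq_of_mem _ _ _ hx, indicator_of_mem (by simp [hx]), hkeq hx]
      · rw [piecewise_eq_of_notMem _ _ _ hx, sUnion_insert]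
        by_cases hx' : x ∈ ⋃₀ N
        · rw [indicator_of_mem hx', indicator_of_mem (show x ∈ K ∪ ⋃₀ N from Or.inr hx')]
        · rw [indicator_of_notMem hx', indicator_of_notMem (by simp only [mem_union]; tauto)]
    rw [e]
    exact Measurable.piecewise hKm hk (ih fun K' hK' => h K' (mem_insert_of_mem _ hK'))

theorem Frame.measurable_rate (hF : Frame Ω M φ V D φmin φmax Γ T W p H R L) :
    Measurable ((⋃₀ M).indicator (rate φ V)) :=
  measurable_indicator_sUnion hF.data.mesh.finite fun K hK =>
    ⟨(hF.data.mesh.polytopal K hK).isOpen.measurableSet, _,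
      (hF.ext.continuous_cellRate hK).measurable, hF.rate_eq hK⟩

theorem Frame.isOpen_cells (hF : Frame Ω M φ V D φmin φmax Γ T W p H R L) : IsOpen (⋃₀ M) :=
  isOpen_sUnion fun K hK => (hF.data.mesh.polytopal K hK).isOpen

variable {γ η : ℝ → Sp d} {s t : ℝ}

theorem Frame.ae_mem_cells (hγ : Traj Ω M φ V T γ) :
    ∀ᵐ r, r ∈ Icc (-T) T → γ r ∈ ⋃₀ M := by
  have := hγ.countable.measure_zero volume
  rw [ae_iff]
  convert this using 2
  ext r
  simp [and_assoc]

theorem Frame.intervalIntegrable_rate (hF : Frame Ω M φ V D φmin φmax Γ T W p H R L)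
    (hγ : Traj Ω M φ V T γ) (hs : s ∈ Icc (-T) T) (ht : t ∈ Icc (-T) T) :
    IntervalIntegrable (fun r => rate φ V (γ r)) volume s t := by
  obtain ⟨g, hg, hgeq⟩ := exists_continuous_extension (by linarith [hF.T_pos]) hγ.continuousOn
  have h1 : Measurable (fun r => (⋃₀ M).indicator (rate φ V) (g r)) :=
    hF.measurable_rate.comp hg.measurable
  have hsub : Set.uIcc s t ⊆ Icc (-T) T := uIcc_subset_Icc hs ht
  have h2 : ∀ᵐ r, r ∈ Icc (-T) T →
      (⋃₀ M).indicator (rate φ V) (g r) = rate φ V (γ r) ∧ |rate φ V (γ r)| ≤ Γ / φmin := by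
    filter_upwards [Frame.ae_mem_cells hγ] with r hr hr'
    rw [hgeq hr', indicator_of_mem (hr hr')]
    exact ⟨rfl, hF.abs_rate_le (hr hr')⟩
  have h3 : IntegrableOn (fun r => rate φ V (γ r)) (Icc (-T) T) := by
    refine Integrable.of_bound (C := Γ / φmin) ?_ ?_
    · have h4 : AEStronglyMeasurable (fun r => (⋃₀ M).indicator (rate φ V) (g r))
          (volume.restrict (Icc (-T) T)) := h1.aestronglyMeasurable
      refine h4.congr ?_
      exact (ae_restrict_iff' measurableSet_Icc).2 (h2.mono fun r hr hr' => (hr hr').1)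
    · exact (ae_restrict_iff' measurableSet_Icc).2 (h2.mono fun r hr hr' => (hr hr').2)
  rw [intervalIntegrable_iff]
  exact h3.mono_set (uIoc_subset_uIcc.trans hsub)

theorem trace_smulRight (c : Sp d →L[ℝ] ℝ) (w : Sp d) :
    LinearMap.trace ℝ (Sp d) (c.smulRight w : Sp d →ₗ[ℝ] Sp d) = c w := by
  set e := stdOrthonormalBasis ℝ (Sp d)
  rw [LinearMap.trace_eq_sum_inner _ e]
  conv_rhs => rw [← e.sum_repr' w, map_sum]
  refine Finset.sum_congr rfl fun i _ => ?_
  simp [inner_smul_right, mul_comm]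

theorem IsExtension.hasFDerivAt_porosity (hE : IsExtension M φ V W p) {K : Set (Sp d)} (hK : K ∈ M)
    (x : Sp d) : HasFDerivAt (p K) (fderiv ℝ (p K) x) x :=
  ((hE.smooth K hK).differentiable (by simp) x).hasFDerivAt

/-- Leibniz rule for W = p · speed. The term in ∇p is the variation of the porosity along a
trajectory, which explains why φ times the Jacobian, and not the Jacobian alone, is the natural
quantity. -/
theorem IsExtension.mul_dv_speed (hE : IsExtension M φ V W p) {K : Set (Sp d)} (hK : K ∈ M)
    (x : Sp d) : p K x * dv (speed W p K) x + fderiv ℝ (p K) x (speed W p K x) = dv (W K) x := by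
  have hp := (hE.pos K hK x).ne'
  have h1 : HasFDerivAt (fun x => (p K x)⁻¹) ((-(p K x ^ 2)⁻¹) • fderiv ℝ (p K) x) x :=
    (hasDerivAt_inv hp).comp_hasFDerivAt x (hE.hasFDerivAt_porosity hK x)
  have h2 : HasFDerivAt (W K) (fderiv ℝ (W K) x) x :=
    ((hE.contDiff hK).differentiable one_ne_zero x).hasFDerivAt
  have h3 : fderiv ℝ (speed W p K) x = (p K x)⁻¹ • fderiv ℝ (W K) x +
      ((-(p K x ^ 2)⁻¹) • fderiv ℝ (p K) x).smulRight (W K x) := (h1.fun_smul h2).fderiv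
  have h4 : dv (speed W p K) x = (p K x)⁻¹ * dv (W K) x +
      (-(p K x ^ 2)⁻¹) * fderiv ℝ (p K) x (W K x) := by
    rw [dv, h3, ContinuousLinearMap.toLinearMap_add, map_add, trace_smulRight, ContinuousLinearMap.toLinearMap_smul,
      map_smul]
    rfl
  rw [h4, speed, map_smul, smul_eq_mul]
  field_simp
  ring

/-- Evolution of the Jacobian in a cell. -/
theorem IsExtension.mul_det_eq (hE : IsExtension M φ V W p) {K : Set (Sp d)} (hK : K ∈ M)
    {A : ℝ → Sp d →L[ℝ] Sp d} (hst : s ≤ t) (hγ : Solves (speed W p K) γ s t)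
    (hA : ∀ r ∈ Icc s t, HasDerivWithinAt A (fderiv ℝ (speed W p K) (γ r) ∘L A r) (Icc s t) r)
    (hA0 : A s = 1) :
    p K (γ t) * (A t).det = p K (γ s) * Real.exp (∫ r in s..t, cellRate W p K (γ r)) := by
  obtain ⟨g, hg, hgeq⟩ := exists_continuous_extension hst
    ((hE.continuous_cellRate hK).comp_continuousOn hγ.continuousOn)
  set I : ℝ → ℝ := fun r => ∫ u in s..r, g u with hI
  have hId : ∀ r, HasDerivAt I (g r) r := fun r => (hg.integral_hasStrictDerivAt s r).hasDerivAt
  -- Integrating factor: by Liouville's formula and `mul_dv_speed`, m is constant.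
  set m : ℝ → ℝ := fun r => p K (γ r) * (A r).det * Real.exp (-I r) with hm
  have hmd : ∀ r ∈ Icc s t, HasDerivWithinAt m 0 (Icc s t) r := by
    intro r hr
    have h1 : HasDerivWithinAt (fun r => p K (γ r))
        (fderiv ℝ (p K) (γ r) (speed W p K (γ r))) (Icc s t) r :=
      (hE.hasFDerivAt_porosity hK _).comp_hasDerivWithinAt r (hγ r hr)
    have h2 := hasDerivWithinAt_det (hA r hr)
    have h3 : HasDerivWithinAt (fun r => Real.exp (-I r)) (Real.exp (-I r) * -g r) (Icc s t) r :=
      ((hId r).neg.exp).hasDerivWithinAt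
    have h4 := (h1.fun_mul h2).fun_mul h3
    refine h4.congr_deriv ?_
    have hp := (hE.pos K hK (γ r)).ne'
    have e1 : g r = (p K (γ r) * dv (speed W p K) (γ r) +
        fderiv ℝ (p K) (γ r) (speed W p K (γ r))) / p K (γ r) := by
      rw [hE.mul_dv_speed hK, hgeq hr]; rfl
    have e2 : LinearMap.trace ℝ (Sp d) (fderiv ℝ (speed W p K) (γ r) : Sp d →ₗ[ℝ] Sp d) =
        dv (speed W p K) (γ r) := rfl
    rw [e2, e1]
    field_simp
    ring
  have hconst := constant_of_has_deriv_right_zero (fun r hr => (hmd r hr).continuousWithinAt)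
    (fun r hr => hasDerivWithinAt_Ici_of_Icc (hmd r (Ico_subset_Icc_self hr)) hr) t
    (right_mem_Icc.2 hst)
  have hI0 : I s = 0 := intervalIntegral.integral_same
  have hIt : I t = ∫ r in s..t, cellRate W p K (γ r) := by
    refine intervalIntegral.integral_congr fun r hr => ?_
    rw [uIcc_of_le hst] at hr
    exact hgeq hr
  have hdet1 : (A s).det = 1 := by rw [hA0]; simp [ContinuousLinearMap.det]
  simp only [hm, hI0, hdet1, neg_zero, Real.exp_zero, mul_one] at hconst
  rw [← hIt, ← hconst, mul_assoc, mul_assoc, ← Real.exp_add]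
  simp

end Rate

/-! ### Differentiability of the flow along a trajectory -/

section TangentMap

variable {γ η : ℝ → Sp d} {r s t : ℝ}

/-- The trajectories which are close to `γ` at time `t`. -/
def nearTraj (Ω : Set (Sp d)) (M : Set (Set (Sp d))) (φ : Sp d → ℝ) (V : Sp d → Sp d) (T : ℝ)
    (γ : ℝ → Sp d) (t : ℝ) : Filter (ℝ → Sp d) :=
  comap (fun η : ℝ → Sp d => η t - γ t) (𝓝 0) ⊓ 𝓟 {η | Traj Ω M φ V T η}

theorem eventually_traj : ∀ᶠ η in nearTraj Ω M φ V T γ t, Traj Ω M φ V T η :=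
  mem_inf_of_right (mem_principal_self _)

theorem tendsto_nearTraj : Tendsto (fun η : ℝ → Sp d => η t - γ t) (nearTraj Ω M φ V T γ t) (𝓝 0) :=
  tendsto_comap.mono_left inf_le_left

theorem eventually_norm_le {δ : ℝ} (hδ : 0 < δ) :
    ∀ᶠ η in nearTraj Ω M φ V T γ t, ‖η t - γ t‖ ≤ δ := by
  have := (tendsto_nearTraj (Ω := Ω) (M := M) (φ := φ) (V := V) (T := T) (γ := γ) (t := t)).eventually
    (Metric.closedBall_mem_nhds (0 : Sp d) hδ)
  simpa using this

/-- `A` is the derivative of the flow from time `s` to time `t`, along `γ`. -/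
def HasTangentMap (Ω : Set (Sp d)) (M : Set (Set (Sp d))) (φ : Sp d → ℝ) (V : Sp d → Sp d) (T : ℝ)
    (γ : ℝ → Sp d) (s t : ℝ) (A : Sp d →L[ℝ] Sp d) : Prop :=
  (fun η : ℝ → Sp d => η t - γ t - A (η s - γ s)) =o[nearTraj Ω M φ V T γ s]
    fun η : ℝ → Sp d => η s - γ s

theorem HasTangentMap.isBigO {A : Sp d →L[ℝ] Sp d} (h : HasTangentMap Ω M φ V T γ s t A) :
    (fun η : ℝ → Sp d => η t - γ t) =O[nearTraj Ω M φ V T γ s] fun η : ℝ → Sp d => η s - γ s := by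
  have h1 := (IsLittleO.isBigO h).add
    (A.isBigO_comp (fun η : ℝ → Sp d => η s - γ s) (nearTraj Ω M φ V T γ s))
  simpa only [sub_add_cancel] using h1

theorem nearTraj_le_of_isBigO
    (h : (fun η : ℝ → Sp d => η t - γ t) =O[nearTraj Ω M φ V T γ s] fun η : ℝ → Sp d => η s - γ s) :
    nearTraj Ω M φ V T γ s ≤ nearTraj Ω M φ V T γ t := by
  refine le_inf ?_ inf_le_right
  rw [← tendsto_iff_comap]
  exact h.trans_tendsto tendsto_nearTraj

/-- Trajectories close to γ at time r remain close at time s, so derivatives compose. Comparing all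
trajectories, and not only values of F, takes the place of a semigroup property of F. -/
theorem HasTangentMap.trans {A B : Sp d →L[ℝ] Sp d} (h : HasTangentMap Ω M φ V T γ r s A)
    (h' : HasTangentMap Ω M φ V T γ s t B) : HasTangentMap Ω M φ V T γ r t (B ∘L A) := by
  have h1 := (h'.mono (nearTraj_le_of_isBigO h.isBigO)).trans_isBigO h.isBigO
  have h2 := (B.isBigO_comp _ _).trans_isLittleO h
  refine (h1.add h2).congr_left fun η => ?_
  simp

/-- The flow from time `s` to time `t` is differentiable along `γ`, with the expected Jacobian. -/
def IsRegular (Ω : Set (Sp d)) (M : Set (Set (Sp d))) (φ : Sp d → ℝ) (V : Sp d → Sp d) (T : ℝ)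
    (γ : ℝ → Sp d) (s t : ℝ) : Prop :=
  ∃ A, HasTangentMap Ω M φ V T γ s t A ∧
    φ (γ t) * A.det = φ (γ s) * Real.exp (∫ r in s..t, rate φ V (γ r))

theorem Frame.isRegular_trans (hF : Frame Ω M φ V D φmin φmax Γ T W p H R L)
    (hγ : Traj Ω M φ V T γ) (hr : r ∈ Icc (-T) T) (hs : s ∈ Icc (-T) T) (ht : t ∈ Icc (-T) T)
    (h : IsRegular Ω M φ V T γ r s) (h' : IsRegular Ω M φ V T γ s t) :
    IsRegular Ω M φ V T γ r t := by
  obtain ⟨A, hA, hA'⟩ := h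
  obtain ⟨B, hB, hB'⟩ := h'
  refine ⟨B ∘L A, hA.trans hB, ?_⟩
  have e : (B ∘L A).det = B.det * A.det := LinearMap.det_comp _ _
  rw [e, ← mul_assoc, hB', ← intervalIntegral.integral_add_adjacent_intervals
    (hF.intervalIntegrable_rate hγ hr hs) (hF.intervalIntegrable_rate hγ hs ht), Real.exp_add]
  linear_combination Real.exp (∫ r in s..t, rate φ V (γ r)) * hA'

/-- Regularity of the flow inside a cell. -/
theorem Frame.isRegular_of_mem_cell (hF : Frame Ω M φ V D φmin φmax Γ T W p H R L)
    (hγ : Traj Ω M φ V T γ) {K : Set (Sp d)} (hK : K ∈ M) (hs : -T ≤ s) (hst : s ≤ t) (ht : t ≤ T)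
    {k : ℝ} (hk : 0 ≤ k) (hkb : ∀ x ∈ closedBall (0 : Sp d) R, ‖fderiv ℝ (speed W p K) x‖ ≤ k)
    (hsmall : 2 * k * (t - s) ≤ 1) (hmem : ∀ r ∈ Icc s t, γ r ∈ K)
    (hnear : ∀ᶠ η in nearTraj Ω M φ V T γ s, ∀ r ∈ Icc s t, η r ∈ K) :
    IsRegular Ω M φ V T γ s t := by
  have hKR : K ⊆ closedBall 0 R := (hF.data.mesh.subset K hK).trans hF.subset_ball
  have hf := hF.ext.contDiff_speed hK
  have hsol := hF.solves hγ hs hst ht hK fun r hr => hmem r (Ioo_subset_Icc_self hr)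
  obtain ⟨A, hA0, hA⟩ := exists_resolvent (B := fun r => fderiv ℝ (speed W p K) (γ r)) hst
    ((hf.continuous_fderiv one_ne_zero).comp_continuousOn hsol.continuousOn) hk
    (fun r hr => hkb _ (hKR (hmem r hr))) hsmall
  refine ⟨A t, ?_, ?_⟩
  · obtain ⟨C, hC, hvar⟩ := exists_variation_bound hf hsol (fun r hr => hKR (hmem r hr)) hA
    rw [HasTangentMap, isLittleO_iff]
    intro ε hε
    obtain ⟨δ, hδ, h⟩ := hvar ε hε
    filter_upwards [hnear, eventually_traj, eventually_norm_le hδ] with η h1 h2 h3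
    have h4 := (h η s t le_rfl hst le_rfl
      (hF.solves h2 hs hst ht hK fun r hr => h1 r (Ioo_subset_Icc_self hr))
      (fun r hr => hKR (h1 r hr)) h3).2 (η s - γ s)
    simpa [hA0] using h4
  · have h1 := hF.ext.mul_det_eq hK hst hsol hA hA0
    rw [hF.ext.eq_porosity K hK (hmem s (left_mem_Icc.2 hst)),
      hF.ext.eq_porosity K hK (hmem t (right_mem_Icc.2 hst)), h1]
    congr 2
    refine intervalIntegral.integral_congr fun r hr => ?_
    rw [uIcc_of_le hst] at hr
    exact (hF.rate_eq hK (hmem r hr)).symm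

end TangentMap

/-! ### Transversal crossings: geometry -/

section Crossing

variable {x₀ a x v₁ v₂ : Sp d} {b ρ ρ' c ε : ℝ} {K₁ K₂ K K' : Set (Sp d)} {γ η : ℝ → Sp d}
  {s t t₀ σ : ℝ}

theorem IsMesh.eq_of_mem (hM : IsMesh Ω M) (hK : K ∈ M) (hK' : K' ∈ M) (hx : x ∈ K) (hx' : x ∈ K') :
    K = K' := by
  by_contra hne
  exact Set.disjoint_left.1 (hM.disjoint hK hK' hne) hx hx'

theorem IsFaceAt.mono (h : IsFaceAt Ω M x₀ a b ρ K₁ K₂) (h0 : 0 < ρ') (hle : ρ' ≤ ρ) :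
    IsFaceAt Ω M x₀ a b ρ' K₁ K₂ where
  pos := h0
  ne_zero := h.ne_zero
  mem := h.mem
  subset := (ball_subset_ball hle).trans h.subset
  mem₁ := h.mem₁
  mem₂ := h.mem₂
  side₁ := fun x hx => h.side₁ x (ball_subset_ball hle hx)
  side₂ := fun x hx => h.side₂ x (ball_subset_ball hle hx)
  face := fun x hx => h.face x (ball_subset_ball hle hx)

theorem IsFaceAt.eq_or_eq (h : IsFaceAt Ω M x₀ a b ρ K₁ K₂) (hM : IsMesh Ω M) (hx : x ∈ ball x₀ ρ)
    (hK : K ∈ M) (hxK : x ∈ K) :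
    (K = K₁ ∧ inner ℝ a x < b) ∨ (K = K₂ ∧ b < inner ℝ a x) := by
  rcases lt_trichotomy (inner ℝ a x) b with hlt | heq | hlt
  · exact Or.inl ⟨hM.eq_of_mem hK h.mem₁ hxK (h.side₁ x hx hlt), hlt⟩
  · exact absurd ⟨K, hK, hxK⟩ (h.face x hx heq)
  · exact Or.inr ⟨hM.eq_of_mem hK h.mem₂ hxK (h.side₂ x hx hlt), hlt⟩

/-- A crossing, with a quantitative lower bound on the normal speed. -/
structure IsSteepCrossing (Ω : Set (Sp d)) (M : Set (Set (Sp d))) (W : Set (Sp d) → Sp d → Sp d)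
    (p : Set (Sp d) → Sp d → ℝ) (x₀ a : Sp d) (b ρ c : ℝ) (K₁ K₂ : Set (Sp d)) : Prop
    extends IsCrossing Ω M W x₀ a b ρ K₁ K₂ where
  c_pos : 0 < c
  le_inner₁ : ∀ x ∈ ball x₀ ρ, c ≤ inner ℝ a (speed W p K₁ x)
  le_inner₂ : ∀ x ∈ ball x₀ ρ, c ≤ inner ℝ a (speed W p K₂ x)

theorem IsSteepCrossing.mono (h : IsSteepCrossing Ω M W p x₀ a b ρ c K₁ K₂) (h0 : 0 < ρ')
    (hle : ρ' ≤ ρ) : IsSteepCrossing Ω M W p x₀ a b ρ' c K₁ K₂ where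
  toIsFaceAt := h.toIsFaceAt.mono h0 hle
  inner_pos := h.inner_pos
  inner_eq := h.inner_eq
  c_pos := h.c_pos
  le_inner₁ := fun x hx => h.le_inner₁ x (ball_subset_ball hle hx)
  le_inner₂ := fun x hx => h.le_inner₂ x (ball_subset_ball hle hx)

theorem IsCrossing.exists_steep (h : IsCrossing Ω M W x₀ a b ρ K₁ K₂)
    (hE : IsExtension M φ V W p) : ∃ ρ' c, IsSteepCrossing Ω M W p x₀ a b ρ' c K₁ K₂ := by
  have h1 : 0 < inner ℝ a (speed W p K₁ x₀) := by
    rw [speed, inner_smul_right]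
    exact mul_pos (inv_pos.2 (hE.pos K₁ h.mem₁ x₀)) h.inner_pos
  have h2 : 0 < inner ℝ a (speed W p K₂ x₀) := by
    rw [speed, inner_smul_right, ← h.inner_eq]
    exact mul_pos (inv_pos.2 (hE.pos K₂ h.mem₂ x₀)) h.inner_pos
  obtain ⟨c, hc0, hc⟩ := exists_between (lt_min h1 h2)
  have c1 : Continuous fun x => inner ℝ a (speed W p K₁ x) :=
    continuous_const.inner (hE.contDiff_speed h.mem₁).continuous
  have c2 : Continuous fun x => inner ℝ a (speed W p K₂ x) :=
    continuous_const.inner (hE.contDiff_speed h.mem₂).continuous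
  have e := (c1.continuousAt.eventually_const_lt (hc.trans_le (min_le_left _ _))).and
    (c2.continuousAt.eventually_const_lt (hc.trans_le (min_le_right _ _)))
  obtain ⟨r, hr, hball⟩ := Metric.eventually_nhds_iff_ball.1 e
  have hle := min_le_right ρ r
  exact ⟨min ρ r, c, { h.toIsFaceAt.mono (lt_min h.pos hr) (min_le_left _ _) with
    inner_pos := h.inner_pos
    inner_eq := h.inner_eq
    c_pos := hc0
    le_inner₁ := fun x hx => (hball x (ball_subset_ball hle hx)).1.le
    le_inner₂ := fun x hx => (hball x (ball_subset_ball hle hx)).2.le }⟩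

/-- In either cell the velocity component along a is at least c, so the height ⟪a, η⟫ keeps
increasing: within the ball a trajectory meets the face at most once. -/
theorem IsSteepCrossing.mul_le_inner (h : IsSteepCrossing Ω M W p x₀ a b ρ c K₁ K₂)
    (hF : Frame Ω M φ V D φmin φmax Γ T W p H R L) (hη : Traj Ω M φ V T η) (hs : -T ≤ s)
    (hst : s ≤ t) (ht : t ≤ T) (hb : ∀ r ∈ Icc s t, η r ∈ ball x₀ ρ) :
    c * (t - s) ≤ inner ℝ a (η t) - inner ℝ a (η s) := by
  refine hF.mul_le_inner hη hs hst ht fun r hr K hK hrK => ?_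
  have hrb := hb r (Ioo_subset_Icc_self hr)
  rcases h.eq_or_eq hF.data.mesh hrb hK hrK with ⟨rfl, -⟩ | ⟨rfl, -⟩
  · exact h.le_inner₁ _ hrb
  · exact h.le_inner₂ _ hrb

theorem IsSteepCrossing.inner_lt (h : IsSteepCrossing Ω M W p x₀ a b ρ c K₁ K₂)
    (hF : Frame Ω M φ V D φmin φmax Γ T W p H R L) (hη : Traj Ω M φ V T η) (hs : -T ≤ s)
    (hst : s < t) (ht : t ≤ T) (hb : ∀ r ∈ Icc s t, η r ∈ ball x₀ ρ) :
    inner ℝ a (η s) < inner ℝ a (η t) := by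
  have h1 := h.mul_le_inner hF hη hs hst.le ht hb
  have h2 := mul_pos h.c_pos (sub_pos.2 hst)
  linarith

/-- Before reaching the face, a trajectory is in the first cell. -/
theorem IsSteepCrossing.mem₁_of_le (h : IsSteepCrossing Ω M W p x₀ a b ρ c K₁ K₂)
    (hF : Frame Ω M φ V D φmin φmax Γ T W p H R L) (hη : Traj Ω M φ V T η) (hs : -T ≤ s)
    (ht : t ≤ T) (hb : ∀ r ∈ Icc s t, η r ∈ ball x₀ ρ) (hle : inner ℝ a (η t) ≤ b) :
    ∀ r ∈ Ico s t, η r ∈ K₁ := fun r hr =>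
  h.side₁ _ (hb r (Ico_subset_Icc_self hr)) ((h.inner_lt hF hη (hs.trans hr.1) hr.2 ht
    fun u hu => hb u ⟨hr.1.trans hu.1, hu.2⟩).trans_le hle)

theorem IsSteepCrossing.mem₂_of_le (h : IsSteepCrossing Ω M W p x₀ a b ρ c K₁ K₂)
    (hF : Frame Ω M φ V D φmin φmax Γ T W p H R L) (hη : Traj Ω M φ V T η) (hs : -T ≤ s)
    (ht : t ≤ T) (hb : ∀ r ∈ Icc s t, η r ∈ ball x₀ ρ) (hle : b ≤ inner ℝ a (η s)) :
    ∀ r ∈ Ioc s t, η r ∈ K₂ := fun r hr =>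
  h.side₂ _ (hb r (Ioc_subset_Icc_self hr)) (hle.trans_lt (h.inner_lt hF hη hs hr.1
    (hr.2.trans ht) fun u hu => hb u ⟨hu.1, hu.2.trans hr.2⟩))

theorem Frame.norm_sub_sub_smul_le_of_mem (hF : Frame Ω M φ V D φmin φmax Γ T W p H R L)
    (hγ : Traj Ω M φ V T γ) (hs : -T ≤ s) (hst : s ≤ t) (ht : t ≤ T) {v : Sp d} (hK : K ∈ M)
    (hmem : ∀ r ∈ Ioo s t, γ r ∈ K) (h : ∀ r ∈ Ioo s t, ‖speed W p K (γ r) - v‖ ≤ ε) :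
    ‖γ t - γ s - (t - s) • v‖ ≤ ε * (t - s) := by
  refine hF.norm_sub_sub_smul_le hγ hs hst ht fun r hr K' hK' hrK => ?_
  rw [hF.data.mesh.eq_of_mem hK' hK hrK (hmem r hr)]
  exact h r hr

/-- Between the crossing times of two trajectories. -/
theorem IsSteepCrossing.jump (h : IsSteepCrossing Ω M W p x₀ a b ρ c K₁ K₂)
    (hF : Frame Ω M φ V D φmin φmax Γ T W p H R L) (hγ : Traj Ω M φ V T γ) (hη : Traj Ω M φ V T η)
    (hσ : σ ∈ Icc (-T) T) (ht₀ : t₀ ∈ Icc (-T) T) (hγb : inner ℝ a (γ t₀) = b)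
    (hηb : inner ℝ a (η σ) = b) (hbγ : ∀ r ∈ Icc (min σ t₀) (max σ t₀), γ r ∈ ball x₀ ρ)
    (hbη : ∀ r ∈ Icc (min σ t₀) (max σ t₀), η r ∈ ball x₀ ρ)
    (hv₁ : ∀ x ∈ ball x₀ ρ, ‖speed W p K₁ x - v₁‖ ≤ ε)
    (hv₂ : ∀ x ∈ ball x₀ ρ, ‖speed W p K₂ x - v₂‖ ≤ ε) :
    c * |σ - t₀| ≤ ‖a‖ * ‖η (min σ t₀) - γ (min σ t₀)‖ ∧
    ‖η (max σ t₀) - γ (max σ t₀) - (η (min σ t₀) - γ (min σ t₀)) - (σ - t₀) • (v₁ - v₂)‖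
      ≤ 2 * ε * |σ - t₀| ∧
    |(σ - t₀) * inner ℝ a v₁ + inner ℝ a (η (min σ t₀) - γ (min σ t₀))| ≤ ‖a‖ * ε * |σ - t₀| := by
  have tri : ∀ A B : Sp d, ∀ k l : ℝ, ‖A‖ ≤ k → ‖B‖ ≤ l → ‖A - B‖ ≤ k + l := fun A B k l h1 h2 =>
    (norm_sub_le _ _).trans (add_le_add h1 h2)
  -- If σ ≤ t₀, then on [σ, t₀] η is already in K₂, with velocity close to v₂, while γ is still in
  -- K₁, with velocity close to v₁: subtraction gives the second estimate, and the height that γ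
  -- still has to gain gives the other two. If t₀ ≤ σ the cells are exchanged, and it is η which has
  -- height to gain.
  rcases le_total σ t₀ with hle | hle
  · rw [min_eq_left hle, max_eq_right hle] at *
    rw [abs_of_nonpos (sub_nonpos.2 hle)]
    have g1 := h.mem₁_of_le hF hγ hσ.1 ht₀.2 hbγ hγb.le
    have e1 := h.mem₂_of_le hF hη hσ.1 ht₀.2 hbη hηb.ge
    have g2 := hF.norm_sub_sub_smul_le_of_mem hγ hσ.1 hle ht₀.2 h.mem₁
      (fun r hr => g1 r (Ioo_subset_Ico_self hr))
      (fun r hr => hv₁ _ (hbγ r (Ioo_subset_Icc_self hr)))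
    have e2 := hF.norm_sub_sub_smul_le_of_mem hη hσ.1 hle ht₀.2 h.mem₂
      (fun r hr => e1 r (Ioo_subset_Ioc_self hr))
      (fun r hr => hv₂ _ (hbη r (Ioo_subset_Icc_self hr)))
    have g3 := h.mul_le_inner hF hγ hσ.1 hle ht₀.2 hbγ
    have i1 : inner ℝ a (η σ - γ σ) = inner ℝ a (γ t₀) - inner ℝ a (γ σ) := by
      rw [inner_sub_right, hηb, hγb]
    refine ⟨?_, ?_, ?_⟩
    · have := real_inner_le_norm a (η σ - γ σ)
      linarith
    · have := tri _ _ _ _ e2 g2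
      refine le_trans (le_of_eq ?_) (this.trans (le_of_eq (by ring)))
      congr 1
      module
    · have h1 := (abs_real_inner_le_norm a _).trans (mul_le_mul_of_nonneg_left g2 (norm_nonneg a))
      rw [i1]
      rw [inner_sub_right, inner_sub_right, inner_smul_right] at h1
      refine le_trans (le_of_eq ?_) (h1.trans (le_of_eq (by ring)))
      congr 1
      ring
  · rw [min_eq_right hle, max_eq_left hle] at *
    rw [abs_of_nonneg (sub_nonneg.2 hle)]
    have g1 := h.mem₂_of_le hF hγ ht₀.1 hσ.2 hbγ hγb.ge
    have e1 := h.mem₁_of_le hF hη ht₀.1 hσ.2 hbη hηb.le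
    have g2 := hF.norm_sub_sub_smul_le_of_mem hγ ht₀.1 hle hσ.2 h.mem₂
      (fun r hr => g1 r (Ioo_subset_Ioc_self hr))
      (fun r hr => hv₂ _ (hbγ r (Ioo_subset_Icc_self hr)))
    have e2 := hF.norm_sub_sub_smul_le_of_mem hη ht₀.1 hle hσ.2 h.mem₁
      (fun r hr => e1 r (Ioo_subset_Ico_self hr))
      (fun r hr => hv₁ _ (hbη r (Ioo_subset_Icc_self hr)))
    have e3 := h.mul_le_inner hF hη ht₀.1 hle hσ.2 hbη
    have i1 : inner ℝ a (η t₀ - γ t₀) = inner ℝ a (η t₀) - inner ℝ a (η σ) := by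
      rw [inner_sub_right, hηb, hγb]
    refine ⟨?_, ?_, ?_⟩
    · have := (abs_le.1 (abs_real_inner_le_norm a (η t₀ - γ t₀))).1
      linarith
    · have := tri _ _ _ _ e2 g2
      refine le_trans (le_of_eq ?_) (this.trans (le_of_eq (by ring)))
      congr 1
      module
    · have h1 := (abs_real_inner_le_norm a _).trans (mul_le_mul_of_nonneg_left e2 (norm_nonneg a))
      rw [i1]
      rw [inner_sub_right, inner_sub_right, inner_smul_right] at h1
      refine le_trans (le_of_eq ?_) (h1.trans (le_of_eq (by ring)))
      rw [← abs_neg]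
      congr 1
      ring

end Crossing

/-! ### Landau calculus -/

section Asymptotic

variable {α E : Type*} [NormedAddCommGroup E] {l : Filter α}

theorem isLittleO_apply [NormedSpace ℝ E] {f : α → E →L[ℝ] E} (z : α → E) (hf : Tendsto f l (𝓝 0)) :
    (fun η => f η (z η)) =o[l] z := by
  rw [isLittleO_iff]
  intro ε hε
  filter_upwards [hf.eventually (Metric.closedBall_mem_nhds 0 hε)] with η hη
  exact (f η).le_of_opNorm_le (by simpa using hη) _

theorem isLittleO_of_le_add {f g h k : α → E} {C : ℝ}
    (hf : ∀ ε > 0, ∀ᶠ η in l, ‖f η‖ ≤ C * ‖g η‖ + ε * ‖h η‖) (hg : g =o[l] k) (hh : h =O[l] k) :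
    f =o[l] k := by
  obtain ⟨B, hB, hh⟩ := hh.exists_pos
  rw [isLittleO_iff]
  intro ε hε
  have h1 := isLittleO_iff.1 hg (show 0 < ε / (2 * (|C| + 1)) by positivity)
  filter_upwards [hf (ε / (2 * B)) (by positivity), h1, hh.bound] with η h2 h3 h4
  have h5 : C * ‖g η‖ ≤ (|C| + 1) * (ε / (2 * (|C| + 1)) * ‖k η‖) :=
    mul_le_mul ((le_abs_self C).trans (by linarith)) h3 (norm_nonneg _) (by positivity)
  have h6 : ε / (2 * B) * ‖h η‖ ≤ ε / (2 * B) * (B * ‖k η‖) :=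
    mul_le_mul_of_nonneg_left h4 (by positivity)
  have e1 : (|C| + 1) * (ε / (2 * (|C| + 1)) * ‖k η‖) = ε / 2 * ‖k η‖ := by field_simp
  have e2 : ε / (2 * B) * (B * ‖k η‖) = ε / 2 * ‖k η‖ := by field_simp
  linarith

end Asymptotic

/-! ### Transversal crossings: the jump of the derivative -/

section Crossing

variable {a : Sp d} {b ρ ρ' c k : ℝ} {K₁ K₂ K K' : Set (Sp d)} {γ η : ℝ → Sp d}
  {t₀ t₁ t₂ : ℝ}

/-- The distance to γ t₀ is at most ρ/8 for the motion of η, ρ/4 for the initial gap and ρ/8 for the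
motion of γ. -/
theorem Frame.mem_ball_of_near (hF : Frame Ω M φ V D φmin φmax Γ T W p H R L)
    (hγ : Traj Ω M φ V T γ) (hη : Traj Ω M φ V T η) (h1 : -T ≤ t₁) (h2 : t₂ ≤ T)
    (h0 : t₀ ∈ Icc t₁ t₂) (hρ : 0 < ρ) (hL : L * (t₂ - t₁) ≤ ρ / 8)
    (hnear : ‖η t₁ - γ t₁‖ ≤ ρ / 4) : ∀ r ∈ Icc t₁ t₂, η r ∈ ball (γ t₀) ρ := by
  intro r hr
  have m1 : t₁ ∈ Icc (-T) T := ⟨h1, by linarith [h0.1, h0.2]⟩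
  have e1 := hF.norm_sub_le hη m1 (t := r) ⟨h1.trans hr.1, hr.2.trans h2⟩
  have e2 := hF.norm_sub_le hγ (s := t₀) ⟨h1.trans h0.1, h0.2.trans h2⟩ m1
  have a1 : L * |r - t₁| ≤ L * (t₂ - t₁) := mul_le_mul_of_nonneg_left
    (by rw [abs_of_nonneg (sub_nonneg.2 hr.1)]; linarith [hr.2]) hF.L_pos.le
  have a2 : L * |t₁ - t₀| ≤ L * (t₂ - t₁) := mul_le_mul_of_nonneg_left
    (by rw [abs_of_nonpos (sub_nonpos.2 h0.1)]; linarith [h0.2]) hF.L_pos.le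
  rw [mem_ball_iff_norm]
  have e : η r - γ t₀ = (η r - η t₁) + (η t₁ - γ t₁) + (γ t₁ - γ t₀) := by abel
  rw [e]
  have := norm_add₃_le (a := η r - η t₁) (b := η t₁ - γ t₁) (c := γ t₁ - γ t₀)
  linarith

theorem Frame.mem_closedBall (hF : Frame Ω M φ V D φmin φmax Γ T W p H R L)
    (hγ : Traj Ω M φ V T γ) {t : ℝ} (ht : t ∈ Icc (-T) T) : γ t ∈ closedBall (0 : Sp d) R :=
  hF.subset_ball (hγ.mem t ht)

/-- Nearby trajectories cross the face. -/
theorem IsSteepCrossing.eventually_crossing (h : IsSteepCrossing Ω M W p (γ t₀) a b ρ c K₁ K₂)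
    (hF : Frame Ω M φ V D φmin φmax Γ T W p H R L) (hγ : Traj Ω M φ V T γ) (h1 : -T ≤ t₁)
    (h10 : t₁ < t₀) (h02 : t₀ < t₂) (h2 : t₂ ≤ T) (hL : L * (t₂ - t₁) ≤ ρ / 8)
    {C δ : ℝ} (hδ : 0 < δ) (hvar : ∀ η, Traj Ω M φ V T η → Solves (speed W p K₁) η t₁ t₀ →
      ‖η t₁ - γ t₁‖ ≤ δ → ‖η t₀ - γ t₀‖ ≤ C * ‖η t₁ - γ t₁‖) :
    ∀ᶠ η in nearTraj Ω M φ V T γ t₁, ∃ σ ∈ Icc t₁ t₂, inner ℝ a (η σ) = b := by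
  have hρ := h.pos
  have hc := h.c_pos
  have hγball := hF.mem_ball_of_near hγ hγ h1 h2 ⟨h10.le, h02.le⟩ hρ hL
    (by simpa using by positivity)
  have hγ1 := h.mul_le_inner hF hγ h1 h10.le (h02.le.trans h2)
    fun r hr => hγball r ⟨hr.1, hr.2.trans h02.le⟩
  rw [h.mem] at hγ1
  have p1 : 0 < c * (t₀ - t₁) := mul_pos hc (sub_pos.2 h10)
  have p2 : 0 < c * (t₂ - t₀) := mul_pos hc (sub_pos.2 h02)
  have ev : ∀ m k : ℝ, 0 < m → ∀ᶠ η in nearTraj Ω M φ V T γ t₁, k * ‖η t₁ - γ t₁‖ < m := by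
    intro m k hm
    have := (tendsto_nearTraj (Ω := Ω) (M := M) (φ := φ) (V := V) (T := T) (γ := γ)
      (t := t₁)).norm.const_mul k
    rw [norm_zero, mul_zero] at this
    exact this.eventually_lt_const hm
  filter_upwards [eventually_traj, eventually_norm_le (show 0 < ρ / 4 by positivity),
    eventually_norm_le hδ, ev _ ‖a‖ p1, ev _ (‖a‖ * C) p2] with η hη n1 n2 n3 n4
  have hηball := hF.mem_ball_of_near hγ hη h1 h2 ⟨h10.le, h02.le⟩ hρ hL n1
  have hcont : ContinuousOn (fun r => inner ℝ a (η r)) (Icc t₁ t₂) :=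
    continuousOn_const.inner (hη.continuousOn.mono (Icc_subset_Icc h1 h2))
  have hleft : inner ℝ a (η t₁) ≤ b := by
    have := real_inner_le_norm a (η t₁ - γ t₁)
    rw [inner_sub_right] at this
    linarith
  by_cases hright : b ≤ inner ℝ a (η t₂)
  · obtain ⟨σ, hσ, hσb⟩ := intermediate_value_Icc (h10.le.trans h02.le) hcont ⟨hleft, hright⟩
    exact ⟨σ, hσ, hσb⟩
  -- Without a crossing η would stay in K₁, hence solve the smooth equation of K₁ up to t₀ and be
  -- close to γ there. It would then have nearly the height b at t₀, and gain at least c (t₂ - t₀)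
  -- afterwards.
  · exfalso
    push Not at hright
    have i1 := h.mul_le_inner hF hη (h1.trans h10.le) h02.le h2
      fun r hr => hηball r ⟨h10.le.trans hr.1, hr.2⟩
    have i2 := h.mem₁_of_le hF hη h1 h2 hηball hright.le
    have i3 := hvar η hη (hF.solves hη h1 h10.le (h02.le.trans h2) h.mem₁ fun r hr =>
      i2 r ⟨hr.1.le, hr.2.trans h02⟩) n2
    have i4 := (abs_le.1 (abs_real_inner_le_norm a (η t₀ - γ t₀))).1
    rw [inner_sub_right, h.mem] at i4
    have i5 := mul_le_mul_of_nonneg_left i3 (norm_nonneg a)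
    rw [← mul_assoc] at i5
    linarith

/-- The jump of the tangent map at a crossing. -/
noncomputable def jumpMap (a v₁ v₂ : Sp d) : Sp d →L[ℝ] Sp d :=
  ContinuousLinearMap.id ℝ (Sp d) +
    ((inner ℝ a v₁)⁻¹ • innerSL ℝ a).smulRight (v₂ - v₁)

theorem jumpMap_apply (a v₁ v₂ w : Sp d) :
    jumpMap a v₁ v₂ w = w + ((inner ℝ a v₁)⁻¹ * inner ℝ a w) • (v₂ - v₁) := rfl

/-- The map is a rank-one perturbation of the identity, whose determinant is 1 + ⟪a, v₂ - v₁⟫ / ⟪a,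
v₁⟫. -/
theorem det_jumpMap {a v₁ v₂ : Sp d} (h : inner ℝ a v₁ ≠ 0) :
    (jumpMap a v₁ v₂).det = inner ℝ a v₂ / inner ℝ a v₁ := by
  have e : ((jumpMap a v₁ v₂ : Sp d →L[ℝ] Sp d) : Sp d →ₗ[ℝ] Sp d) =
      LinearMap.transvection ((((inner ℝ a v₁)⁻¹ • innerSL ℝ a : Sp d →L[ℝ] ℝ)) : Sp d →ₗ[ℝ] ℝ)
        (v₂ - v₁) := by
    ext w : 1
    rw [LinearMap.transvection.apply]
    rfl
  have e2 : (jumpMap a v₁ v₂).det = 1 + (inner ℝ a v₁)⁻¹ * inner ℝ a (v₂ - v₁) := by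
    rw [ContinuousLinearMap.det, e, LinearMap.transvection.det]
    rfl
  rw [e2, inner_sub_right]
  field_simp
  ring

/-- The normal components of W agree on both sides, so those of the speeds W / p are in the inverse
ratio of the porosities. The Jacobian jumps, but its product with the porosity does not. -/
theorem IsSteepCrossing.det_jumpMap_eq (h : IsSteepCrossing Ω M W p (γ t₀) a b ρ c K₁ K₂)
    (hE : IsExtension M φ V W p) :
    p K₂ (γ t₀) * (jumpMap a (speed W p K₁ (γ t₀)) (speed W p K₂ (γ t₀))).det = p K₁ (γ t₀) := by
  have h1 := (h.le_inner₁ _ (mem_ball_self h.pos)).trans_lt' h.c_pos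
  rw [det_jumpMap h1.ne', speed, speed, inner_smul_right, inner_smul_right, ← h.inner_eq]
  have p1 := (hE.pos K₁ h.mem₁ (γ t₀)).ne'
  have p2 := (hE.pos K₂ h.mem₂ (γ t₀)).ne'
  have p3 := h.inner_pos.ne'
  field_simp

/-- Regularity of the flow across a face. -/
theorem IsSteepCrossing.isRegular (h : IsSteepCrossing Ω M W p (γ t₀) a b ρ c K₁ K₂)
    (hF : Frame Ω M φ V D φmin φmax Γ T W p H R L) (hγ : Traj Ω M φ V T γ) (h1 : -T ≤ t₁)
    (h10 : t₁ < t₀) (h02 : t₀ < t₂) (h2 : t₂ ≤ T) (hL : L * (t₂ - t₁) ≤ ρ / 8) (hk : 0 ≤ k)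
    (hk₁ : ∀ x ∈ closedBall (0 : Sp d) R, ‖fderiv ℝ (speed W p K₁) x‖ ≤ k)
    (hk₂ : ∀ x ∈ closedBall (0 : Sp d) R, ‖fderiv ℝ (speed W p K₂) x‖ ≤ k)
    (hsmall : 2 * k * (t₂ - t₁) ≤ 1) : IsRegular Ω M φ V T γ t₁ t₂ := by
  have hρ := h.pos
  have hc := h.c_pos
  have h20 : -T ≤ t₀ := h1.trans h10.le
  have h00 : t₀ ≤ T := h02.le.trans h2
  have hsub : Icc t₁ t₂ ⊆ Icc (-T) T := Icc_subset_Icc h1 h2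
  have hγball := hF.mem_ball_of_near hγ hγ h1 h2 ⟨h10.le, h02.le⟩ hρ hL
    (by simpa using by positivity)
  have γ1 := h.mem₁_of_le hF hγ h1 h00 (fun r hr => hγball r ⟨hr.1, hr.2.trans h02.le⟩) h.mem.le
  have γ2 := h.mem₂_of_le hF hγ h20 h2 (fun r hr => hγball r ⟨h10.le.trans hr.1, hr.2⟩) h.mem.ge
  have sol1 := hF.solves hγ h1 h10.le h00 h.mem₁ fun r hr => γ1 r (Ioo_subset_Ico_self hr)
  have sol2 := hF.solves hγ h20 h02.le h2 h.mem₂ fun r hr => γ2 r (Ioo_subset_Ioc_self hr)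
  have hf1 := hF.ext.contDiff_speed h.mem₁
  have hf2 := hF.ext.contDiff_speed h.mem₂
  have R1 : ∀ r ∈ Icc t₁ t₀, γ r ∈ closedBall (0 : Sp d) R := fun r hr =>
    hF.mem_closedBall hγ (hsub ⟨hr.1, hr.2.trans h02.le⟩)
  have R2 : ∀ r ∈ Icc t₀ t₂, γ r ∈ closedBall (0 : Sp d) R := fun r hr =>
    hF.mem_closedBall hγ (hsub ⟨h10.le.trans hr.1, hr.2⟩)
  obtain ⟨A₁, hA₁0, hA₁⟩ := exists_resolvent (B := fun r => fderiv ℝ (speed W p K₁) (γ r)) h10.le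
    ((hf1.continuous_fderiv one_ne_zero).comp_continuousOn sol1.continuousOn) hk
    (fun r hr => hk₁ _ (R1 r hr))
    ((mul_le_mul_of_nonneg_left (by linarith) (by positivity)).trans hsmall)
  obtain ⟨A₂, hA₂0, hA₂⟩ := exists_resolvent (B := fun r => fderiv ℝ (speed W p K₂) (γ r)) h02.le
    ((hf2.continuous_fderiv one_ne_zero).comp_continuousOn sol2.continuousOn) hk
    (fun r hr => hk₂ _ (R2 r hr))
    ((mul_le_mul_of_nonneg_left (by linarith) (by positivity)).trans hsmall)
  obtain ⟨C₁, hC₁, var1⟩ := exists_variation_bound hf1 sol1 R1 hA₁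
  obtain ⟨C₂, hC₂, var2⟩ := exists_variation_bound hf2 sol2 R2 hA₂
  set v₁ := speed W p K₁ (γ t₀) with hv₁
  set v₂ := speed W p K₂ (γ t₀) with hv₂
  have hα : inner ℝ a v₁ ≠ 0 := ((h.le_inner₁ _ (mem_ball_self hρ)).trans_lt' hc).ne'
  set S := jumpMap a v₁ v₂ with hS
  refine ⟨A₂ t₂ ∘L S ∘L A₁ t₀, ?_, ?_⟩
  · set l := nearTraj Ω M φ V T γ t₁ with hl
    set z₀ : (ℝ → Sp d) → Sp d := fun η => η t₁ - γ t₁ with hz₀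
    have hz₀0 : Tendsto z₀ l (𝓝 0) := tendsto_nearTraj
    have hcross : ∀ᶠ η in l, ∃ σ : ℝ, σ ∈ Icc t₁ t₂ ∧ inner ℝ a (η σ) = b := by
      obtain ⟨δ, hδ, hv⟩ := var1 1 one_pos
      exact h.eventually_crossing hF hγ h1 h10 h02 h2 hL hδ fun η hη hsol hd =>
        (hv η t₁ t₀ le_rfl h10.le le_rfl hsol (fun r hr =>
          hF.mem_closedBall hη (hsub ⟨hr.1, hr.2.trans h02.le⟩)) hd).1
    have hσ' : ∃ σ : (ℝ → Sp d) → ℝ, ∀ᶠ η in l, σ η ∈ Icc t₁ t₂ ∧ inner ℝ a (η (σ η)) = b := by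
      classical
      -- The value 0 only concerns trajectories which do not cross, and these are eventually absent.
      refine ⟨fun η => if hη : ∃ σ : ℝ, σ ∈ Icc t₁ t₂ ∧ inner ℝ a (η σ) = b then hη.choose else 0,
        hcross.mono fun η hη => ?_⟩
      simp only [dif_pos hη]
      exact hη.choose_spec
    obtain ⟨σ, hσ⟩ := hσ'
    -- `lo` and `hi` are the first and the last of the crossing times of γ and η. Up to `lo` both
    -- move in K₁, after `hi` both move in K₂, and in between they are in different cells.
    set lo : (ℝ → Sp d) → ℝ := fun η => min (σ η) t₀ with hlo
    set hi : (ℝ → Sp d) → ℝ := fun η => max (σ η) t₀ with hhi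
    set zlo : (ℝ → Sp d) → Sp d := fun η => η (lo η) - γ (lo η) with hzlo
    set zhi : (ℝ → Sp d) → Sp d := fun η => η (hi η) - γ (hi η) with hzhi
    have hall : ∀ᶠ η in l, Traj Ω M φ V T η ∧ (∀ r ∈ Icc t₁ t₂, η r ∈ ball (γ t₀) ρ) ∧
        σ η ∈ Icc t₁ t₂ ∧ inner ℝ a (η (σ η)) = b ∧ lo η ∈ Icc t₁ t₀ ∧ hi η ∈ Icc t₀ t₂ ∧
        Solves (speed W p K₁) η t₁ (lo η) ∧ Solves (speed W p K₂) η (hi η) t₂ := by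
      filter_upwards [hσ, eventually_traj, eventually_norm_le (show 0 < ρ / 4 by positivity)]
        with η hη1 hη n1
      have hb := hF.mem_ball_of_near hγ hη h1 h2 ⟨h10.le, h02.le⟩ hρ hL n1
      have hlo' : lo η ∈ Icc t₁ t₀ := ⟨le_min hη1.1.1 h10.le, min_le_right _ _⟩
      have hhi' : hi η ∈ Icc t₀ t₂ := ⟨le_max_right _ _, max_le hη1.1.2 h02.le⟩
      have m1 := h.mem₁_of_le hF hη h1 (hη1.1.2.trans h2)
        (fun r hr => hb r ⟨hr.1, hr.2.trans hη1.1.2⟩) hη1.2.le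
      have m2 := h.mem₂_of_le hF hη (h1.trans hη1.1.1) h2
        (fun r hr => hb r ⟨hη1.1.1.trans hr.1, hr.2⟩) hη1.2.ge
      exact ⟨hη, hb, hη1.1, hη1.2, hlo', hhi',
        hF.solves hη h1 hlo'.1 (hlo'.2.trans h00) h.mem₁ fun r hr =>
          m1 r ⟨hr.1.le, hr.2.trans_le (min_le_left _ _)⟩,
        hF.solves hη (h20.trans hhi'.1) hhi'.2 h2 h.mem₂ fun r hr =>
          m2 r ⟨(le_max_left _ _).trans_lt hr.1, hr.2.le⟩⟩
    have key1 : ∀ ε > 0, ∀ᶠ η in l, ‖zlo η‖ ≤ C₁ * ‖z₀ η‖ ∧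
        ‖zlo η - A₁ (lo η) (z₀ η)‖ ≤ ε * ‖z₀ η‖ := by
      intro ε hε
      obtain ⟨δ, hδ, hv⟩ := var1 ε hε
      filter_upwards [hall, eventually_norm_le hδ] with η ⟨hη, _, _, _, hlo', _, hs, _⟩ hd
      have := hv η t₁ (lo η) le_rfl hlo'.1 hlo'.2 hs (fun r hr =>
          hF.mem_closedBall hη (hsub ⟨hr.1, hr.2.trans (hlo'.2.trans h02.le)⟩)) hd
      refine ⟨this.1, ?_⟩
      have e := this.2 (z₀ η)
      rwa [hA₁0, one_apply_eq_self, sub_self, norm_zero, mul_zero, zero_add] at e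
    have O1 : zlo =O[l] z₀ := IsBigO.of_bound C₁ ((key1 1 one_pos).mono fun η hη => hη.1)
    have o1 : (fun η => zlo η - A₁ (lo η) (z₀ η)) =o[l] z₀ :=
      isLittleO_iff.2 fun ε hε => (key1 ε hε).mono fun η hη => hη.2
    have habs : ∀ η, max (σ η) t₀ - min (σ η) t₀ = |σ η - t₀| := fun η => max_sub_min_eq_abs' _ _
    have hIcc : ∀ η, lo η ∈ Icc t₁ t₀ → hi η ∈ Icc t₀ t₂ →
        Icc (min (σ η) t₀) (max (σ η) t₀) ⊆ Icc t₁ t₂ := fun η h h' => Icc_subset_Icc h.1 h'.2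
    have O2' : (fun η => σ η - t₀) =O[l] zlo := by
      refine IsBigO.of_bound (‖a‖ / c) ?_
      -- The first estimate of `jump` does not involve ε, so any bound on the speeds over the ball
      -- will do.
      have hcont1 := hf1.continuous
      obtain ⟨B₁, hB₁⟩ := (isCompact_closedBall (γ t₀) ρ).exists_bound_of_continuousOn
        (f := fun x => speed W p K₁ x - v₁) (by fun_prop)
      have hcont2 := hf2.continuous
      obtain ⟨B₂, hB₂⟩ := (isCompact_closedBall (γ t₀) ρ).exists_bound_of_continuousOn
        (f := fun x => speed W p K₂ x - v₂) (by fun_prop)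
      filter_upwards [hall] with η ⟨hη, hb, hσ1, hσ2, hlo', hhi', _, _⟩
      have := (h.jump hF hγ hη (hsub hσ1) ⟨h20, h00⟩ h.mem hσ2
        (fun r hr => hγball r (hIcc η hlo' hhi' hr)) (fun r hr => hb r (hIcc η hlo' hhi' hr))
        (ε := max B₁ B₂) (fun x hx => (hB₁ x (ball_subset_closedBall hx)).trans (le_max_left _ _))
        (fun x hx => (hB₂ x (ball_subset_closedBall hx)).trans (le_max_right _ _))).1
      rw [Real.norm_eq_abs, div_mul_eq_mul_div, le_div_iff₀ hc, mul_comm]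
      exact this
    have O2 : (fun η => σ η - t₀) =O[l] z₀ := O2'.trans O1
    have hzlo0 : Tendsto zlo l (𝓝 0) := O1.trans_tendsto hz₀0
    have hσ0 : Tendsto (fun η => σ η - t₀) l (𝓝 0) := O2.trans_tendsto hz₀0
    have hjump : ∀ ε > 0, ∀ᶠ η in l,
        ‖zhi η - zlo η - (σ η - t₀) • (v₁ - v₂)‖ ≤ 2 * ε * |σ η - t₀| ∧
        |(σ η - t₀) * inner ℝ a v₁ + inner ℝ a (zlo η)| ≤ ‖a‖ * ε * |σ η - t₀| := by
      intro ε hε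
      have c1 : ∀ᶠ x in 𝓝 (γ t₀), ‖speed W p K₁ x - v₁‖ < ε := by
        have : Tendsto (fun x => ‖speed W p K₁ x - v₁‖) (𝓝 (γ t₀)) (𝓝 ‖v₁ - v₁‖) :=
          ((hf1.continuous.tendsto _).sub_const v₁).norm
        rw [sub_self, norm_zero] at this
        exact this.eventually_lt_const hε
      have c2 : ∀ᶠ x in 𝓝 (γ t₀), ‖speed W p K₂ x - v₂‖ < ε := by
        have : Tendsto (fun x => ‖speed W p K₂ x - v₂‖) (𝓝 (γ t₀)) (𝓝 ‖v₂ - v₂‖) :=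
          ((hf2.continuous.tendsto _).sub_const v₂).norm
        rw [sub_self, norm_zero] at this
        exact this.eventually_lt_const hε
      obtain ⟨ρ₁, hρ₁, hclose⟩ := Metric.eventually_nhds_iff_ball.1 (c1.and c2)
      -- This quantity bounds the distance to γ t₀ of both trajectories between the two crossing
      -- times, so the speeds are then within ε of v₁ and v₂.
      have hsm : ∀ᶠ η in l, 2 * L * |σ η - t₀| + ‖zlo η‖ < min ρ ρ₁ := by
        have : Tendsto (fun η => 2 * L * |σ η - t₀| + ‖zlo η‖) l (𝓝 (2 * L * |0| + ‖(0 : Sp d)‖)) :=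
          (hσ0.abs.const_mul _).add hzlo0.norm
        rw [abs_zero, norm_zero, mul_zero, add_zero] at this
        exact this.eventually_lt_const (lt_min hρ hρ₁)
      filter_upwards [hall, hsm] with η ⟨hη, _, hσ1, hσ2, hlo', hhi', _, _⟩ hsm
      have mem : ∀ r ∈ Icc (min (σ η) t₀) (max (σ η) t₀), r ∈ Icc (-T) T :=
        fun r hr => hsub (hIcc η hlo' hhi' hr)
      have dist0 : ∀ r ∈ Icc (min (σ η) t₀) (max (σ η) t₀), |r - t₀| ≤ |σ η - t₀| := by
        intro r hr
        rw [← habs, abs_le]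
        constructor <;> linarith [hr.1, hr.2, min_le_right (σ η) t₀, le_max_right (σ η) t₀]
      have distlo : ∀ r ∈ Icc (min (σ η) t₀) (max (σ η) t₀), |r - lo η| ≤ |σ η - t₀| := by
        intro r hr
        rw [← habs, abs_of_nonneg (sub_nonneg.2 hr.1)]
        linarith [hr.2]
      have hlomem : lo η ∈ Icc (min (σ η) t₀) (max (σ η) t₀) :=
        left_mem_Icc.2 (min_le_max)
      have bγ : ∀ r ∈ Icc (min (σ η) t₀) (max (σ η) t₀), ‖γ r - γ t₀‖ ≤ L * |σ η - t₀| :=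
        fun r hr => (hF.norm_sub_le hγ ⟨h20, h00⟩ (mem r hr)).trans
          (mul_le_mul_of_nonneg_left (dist0 r hr) hF.L_pos.le)
      have nn : 0 ≤ L * |σ η - t₀| := mul_nonneg hF.L_pos.le (abs_nonneg _)
      refine ((h.mono (lt_min hρ hρ₁) (min_le_left _ _)).jump hF hγ hη (hsub hσ1) ⟨h20, h00⟩
        h.mem hσ2 (fun r hr => ?_) (fun r hr => ?_) (ε := ε)
        (fun x hx => (hclose x (ball_subset_ball (min_le_right _ _) hx)).1.le)
        (fun x hx => (hclose x (ball_subset_ball (min_le_right _ _) hx)).2.le)).2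
      · rw [mem_ball_iff_norm]
        have := bγ r hr
        linarith [norm_nonneg (zlo η)]
      · rw [mem_ball_iff_norm]
        have e1 := (hF.norm_sub_le hη (mem _ hlomem) (mem r hr)).trans
          (mul_le_mul_of_nonneg_left (distlo r hr) hF.L_pos.le)
        have e2 := bγ _ hlomem
        have e : η r - γ t₀ = (η r - η (lo η)) + zlo η + (γ (lo η) - γ t₀) := by
          simp only [hzlo]; abel
        rw [e]
        have := norm_add₃_le (a := η r - η (lo η)) (b := zlo η) (c := γ (lo η) - γ t₀)
        linarith
    have j1 : (fun η => zhi η - zlo η - (σ η - t₀) • (v₁ - v₂)) =o[l] fun η => σ η - t₀ := by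
      refine isLittleO_iff.2 fun ε hε => (hjump (ε / 2) (by positivity)).mono fun η hη => ?_
      rw [Real.norm_eq_abs]
      exact hη.1.trans (le_of_eq (by ring))
    have j2 : (fun η => (σ η - t₀) * inner ℝ a v₁ + inner ℝ a (zlo η)) =o[l] fun η => σ η - t₀ := by
      have ha : 0 < ‖a‖ := norm_pos_iff.2 h.ne_zero
      refine isLittleO_iff.2 fun ε hε => (hjump (ε / ‖a‖) (by positivity)).mono fun η hη => ?_
      rw [Real.norm_eq_abs, Real.norm_eq_abs]
      exact hη.2.trans (le_of_eq (by field_simp))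
    -- To first order σ - t₀ = -⟪a, zlo⟫ / ⟪a, v₁⟫; inserting this delay in zhi ≈ zlo + (σ - t₀)(v₁
    -- - v₂) gives the jump map.
    have o4 : (fun η => zhi η - S (zlo η)) =o[l] z₀ := by
      have j2' : (fun η => ((inner ℝ a v₁)⁻¹ * ((σ η - t₀) * inner ℝ a v₁ + inner ℝ a (zlo η))) •
          (v₁ - v₂)) =o[l] fun η => σ η - t₀ := by
        have := (j2.const_mul_left (inner ℝ a v₁)⁻¹).smul_isBigO
          (isBigO_refl (fun _ : ℝ → Sp d => v₁ - v₂) l)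
        refine this.trans_isBigO (IsBigO.of_bound ‖v₁ - v₂‖ (Eventually.of_forall fun η => ?_))
        rw [norm_smul, mul_comm]
      refine ((j1.add j2').trans_isBigO O2).congr_left fun η => ?_
      rw [hS, jumpMap_apply]
      have : (inner ℝ a v₁)⁻¹ * ((σ η - t₀) * inner ℝ a v₁ + inner ℝ a (zlo η)) =
        (σ η - t₀) + (inner ℝ a v₁)⁻¹ * inner ℝ a (zlo η) := by field_simp
      rw [this]
      module
    have hlot : Tendsto lo l (𝓝[Icc t₁ t₀] t₀) := by
      refine tendsto_nhdsWithin_iff.2 ⟨?_, hall.mono fun η hη => hη.2.2.2.2.1⟩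
      have h3 : Tendsto σ l (𝓝 t₀) := by simpa using hσ0.add_const t₀
      simpa using h3.min (tendsto_const_nhds (x := t₀))
    have hhit : Tendsto hi l (𝓝[Icc t₀ t₂] t₀) := by
      refine tendsto_nhdsWithin_iff.2 ⟨?_, hall.mono fun η hη => hη.2.2.2.2.2.1⟩
      have h3 : Tendsto σ l (𝓝 t₀) := by simpa using hσ0.add_const t₀
      simpa using h3.max (tendsto_const_nhds (x := t₀))
    have hA₁t : Tendsto (fun η => A₁ (lo η) - A₁ t₀) l (𝓝 0) := by
      have := ((hA₁ t₀ (right_mem_Icc.2 h10.le)).continuousWithinAt.tendsto.comp hlot).sub_const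
        (A₁ t₀)
      rwa [sub_self] at this
    have hA₂t : Tendsto (fun η => 1 - A₂ (hi η)) l (𝓝 0) := by
      have := ((hA₂ t₀ (left_mem_Icc.2 h02.le)).continuousWithinAt.tendsto.comp hhit).const_sub 1
      rwa [hA₂0, sub_self] at this
    -- The expected first order displacement at the crossing. The resolvents enter at the times `lo`
    -- and `hi` instead of t₀; their continuity at t₀ turns this into an error o(z₀).
    set w : (ℝ → Sp d) → Sp d := fun η => S (A₁ t₀ (z₀ η)) with hw
    have Ow : w =O[l] z₀ := (S ∘L A₁ t₀).isBigO_comp z₀ l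
    have u1 : (fun η => S (zlo η - A₁ (lo η) (z₀ η))) =o[l] z₀ :=
      (S.isBigO_comp _ l).trans_isLittleO o1
    have u2 : (fun η => S ((A₁ (lo η) - A₁ t₀) (z₀ η))) =o[l] z₀ :=
      (S.isBigO_comp _ l).trans_isLittleO (isLittleO_apply z₀ hA₁t)
    have u3 : (fun η => (1 - A₂ (hi η)) (w η)) =o[l] z₀ :=
      (isLittleO_apply w hA₂t).trans_isBigO Ow
    have u : (fun η => zhi η - A₂ (hi η) (w η)) =o[l] z₀ := by
      refine (((o4.add u1).add u2).add u3).congr_left fun η => ?_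
      simp only [hw, map_sub, sub_apply, one_apply_eq_self]
      abel
    have Ozhi : zhi =O[l] z₀ := by
      have := o4.isBigO.add ((S.isBigO_comp zlo l).trans O1)
      simpa only [sub_add_cancel] using this
    refine isLittleO_of_le_add (C := C₂) (fun ε hε => ?_) u Ozhi
    obtain ⟨δ, hδ, hv⟩ := var2 ε hε
    have hzhi0 : Tendsto zhi l (𝓝 0) := Ozhi.trans_tendsto hz₀0
    filter_upwards [hall, hzhi0.eventually (Metric.closedBall_mem_nhds 0 hδ)]
      with η ⟨hη, _, _, _, _, hhi', _, hs⟩ hd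
    replace hd : ‖zhi η‖ ≤ δ := by simpa using hd
    exact (hv η (hi η) t₂ hhi'.1 hhi'.2 le_rfl hs (fun r hr =>
      hF.mem_closedBall hη (hsub ⟨h10.le.trans (hhi'.1.trans hr.1), hr.2⟩)) hd).2 (w η)
  · have d1 := hF.ext.mul_det_eq h.mem₁ h10.le sol1 hA₁ hA₁0
    have d2 := hF.ext.mul_det_eq h.mem₂ h02.le sol2 hA₂ hA₂0
    have d3 := h.det_jumpMap_eq hF.ext
    have e1 : ∫ r in t₁..t₀, cellRate W p K₁ (γ r) = ∫ r in t₁..t₀, rate φ V (γ r) := by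
      refine intervalIntegral.integral_congr_ae ?_
      have hne : ∀ᵐ r : ℝ, r ≠ t₀ := by rw [ae_iff]; simp
      filter_upwards [hne] with r hr hr'
      rw [uIoc_of_le h10.le] at hr'
      exact (hF.rate_eq h.mem₁ (γ1 r ⟨hr'.1.le, lt_of_le_of_ne hr'.2 hr⟩)).symm
    have e2 : ∫ r in t₀..t₂, cellRate W p K₂ (γ r) = ∫ r in t₀..t₂, rate φ V (γ r) := by
      refine intervalIntegral.integral_congr_ae (Eventually.of_forall fun r hr' => ?_)
      rw [uIoc_of_le h02.le] at hr'
      exact (hF.rate_eq h.mem₂ (γ2 r hr')).symm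
    rw [e1] at d1
    rw [e2] at d2
    have e : (A₂ t₂ ∘L S ∘L A₁ t₀).det = (A₂ t₂).det * (S.det * (A₁ t₀).det) := by
      have e3 : (A₂ t₂ ∘L S ∘L A₁ t₀).det = (A₂ t₂).det * (S ∘L A₁ t₀).det := LinearMap.det_comp _ _
      have e4 : (S ∘L A₁ t₀).det = S.det * (A₁ t₀).det := LinearMap.det_comp _ _
      rw [e3, e4]
    rw [e, hF.ext.eq_porosity K₂ h.mem₂ (γ2 t₂ ⟨h02, le_rfl⟩),
      hF.ext.eq_porosity K₁ h.mem₁ (γ1 t₁ ⟨le_rfl, h10⟩),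
      ← intervalIntegral.integral_add_adjacent_intervals
        (hF.intervalIntegrable_rate hγ (s := t₁) (t := t₀) ⟨h1, h10.le.trans h00⟩ ⟨h20, h00⟩)
        (hF.intervalIntegrable_rate hγ (s := t₀) (t := t₂) ⟨h20, h00⟩ ⟨h20.trans h02.le, h2⟩),
      Real.exp_add]
    rw [← hS] at d3
    linear_combination (S.det * (A₁ t₀).det) * d2 +
      (A₁ t₀).det * Real.exp (∫ r in t₀..t₂, rate φ V (γ r)) * d3 +
      Real.exp (∫ r in t₀..t₂, rate φ V (γ r)) * d1

end Crossing

/-! ### Trajectories never meet a tangential face -/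

section Tangency

variable {x₀ a : Sp d} {b ρ c : ℝ} {K₁ K₂ K : Set (Sp d)} {γ η : ℝ → Sp d} {t₀ : ℝ}

/-- A normal velocity which vanishes on a hyperplane is controlled by the distance to it. -/
theorem exists_abs_inner_le {f : Sp d → Sp d} (hf : ContDiff ℝ 1 f) (ha : a ≠ 0)
    (h0 : ∀ y, inner ℝ a y = b → inner ℝ a (f y) = 0) (hx₀ : inner ℝ a x₀ = b) (r : ℝ) :
    ∃ k : ℝ, 0 < k ∧ ∀ x ∈ ball x₀ r, |inner ℝ a (f x)| ≤ k * |inner ℝ a x - b| := by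
  -- This ball contains x and its orthogonal projection y onto the hyperplane, where the normal
  -- component vanishes; the Lipschitz bound between x and y concludes.
  obtain ⟨k, hk1, -, hkL⟩ := exists_fderiv_bound hf (‖x₀‖ + 2 * r)
  have ha' : 0 < ‖a‖ := norm_pos_iff.2 ha
  refine ⟨k, by exact_mod_cast zero_lt_one.trans_le hk1, fun x hx => ?_⟩
  rw [mem_ball_iff_norm] at hx
  set m := inner ℝ a x - b with hm
  set y := x - (m / ‖a‖ ^ 2) • a with hy
  have hyb : inner ℝ a y = b := by
    rw [hy, inner_sub_right, inner_smul_right, real_inner_self_eq_norm_sq]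
    field_simp
    rw [hm]; ring
  have hmle : |m| ≤ ‖a‖ * ‖x - x₀‖ := by
    have := abs_real_inner_le_norm a (x - x₀)
    rwa [inner_sub_right, hx₀] at this
  have hxy : ‖x - y‖ = |m| / ‖a‖ := by
    rw [hy, sub_sub_cancel, norm_smul, Real.norm_eq_abs, abs_div, abs_of_pos (by positivity : 0 < ‖a‖ ^ 2)]
    field_simp
  have hxy' : ‖x - y‖ ≤ ‖x - x₀‖ := by
    rw [hxy, div_le_iff₀ ha', mul_comm]; exact hmle
  have hxR : x ∈ closedBall (0 : Sp d) (‖x₀‖ + 2 * r) := by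
    rw [mem_closedBall_zero_iff]
    have := norm_le_norm_add_norm_sub' x x₀
    linarith [norm_nonneg (x - x₀)]
  have hyR : y ∈ closedBall (0 : Sp d) (‖x₀‖ + 2 * r) := by
    rw [mem_closedBall_zero_iff]
    have h1 := norm_le_norm_add_norm_sub' x x₀
    have h2 := norm_le_norm_add_norm_sub x y
    linarith [norm_nonneg (x - x₀)]
  have e : inner ℝ a (f x) = inner ℝ a (f x - f y) := by rw [inner_sub_right, h0 y hyb, sub_zero]
  rw [e]
  refine (abs_real_inner_le_norm _ _).trans ?_
  have h3 := hkL.norm_sub_le hxR hyR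
  calc ‖a‖ * ‖f x - f y‖ ≤ ‖a‖ * (k * (|m| / ‖a‖)) := by
        rw [← hxy]; exact mul_le_mul_of_nonneg_left h3 ha'.le
    _ = k * |m| := by field_simp

/-- No trajectory meets a face at a point of tangency. -/
theorem Frame.not_isTangency (hF : Frame Ω M φ V D φmin φmax Γ T W p H R L)
    (hγ : Traj Ω M φ V T γ) (ht₀ : t₀ ∈ Icc (-T) T) :
    ¬ IsTangency Ω M W (γ t₀) a b ρ K₁ K₂ := by
  intro h
  have hρ := h.pos
  have hz : ∀ K ∈ M, (∀ y, inner ℝ a y = b → inner ℝ a (W K y) = 0) →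
      ∀ y, inner ℝ a y = b → inner ℝ a (speed W p K y) = 0 := fun K hK h0 y hy => by
    rw [speed, inner_smul_right, h0 y hy, mul_zero]
  obtain ⟨k₁, hk₁, hb₁⟩ := exists_abs_inner_le (hF.ext.contDiff_speed h.mem₁) h.ne_zero
    (hz _ h.mem₁ fun y hy => (h.inner_eq_zero y hy).1) h.mem ρ
  obtain ⟨k₂, hk₂, hb₂⟩ := exists_abs_inner_le (hF.ext.contDiff_speed h.mem₂) h.ne_zero
    (hz _ h.mem₂ fun y hy => (h.inner_eq_zero y hy).2) h.mem ρ
  set k := max k₁ k₂ with hk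
  have hk0 : 0 < k := hk₁.trans_le (le_max_left _ _)
  have hL := hF.L_pos
  have hT := hF.T_pos
  -- The first term keeps γ in the ball during the time ε, the second one makes k ε ≤ 1/2.
  set ε := min (ρ / (2 * L)) (1 / (2 * k)) with hε
  have hε0 : 0 < ε := by positivity
  have hεL : L * ε < ρ := by
    have : L * ε ≤ L * (ρ / (2 * L)) := mul_le_mul_of_nonneg_left (min_le_left _ _) hL.le
    have e : L * (ρ / (2 * L)) = ρ / 2 := by field_simp
    linarith
  have hεk : k * ε ≤ 1 / 2 := by
    have : k * ε ≤ k * (1 / (2 * k)) := mul_le_mul_of_nonneg_left (min_le_right _ _) hk0.le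
    have e : k * (1 / (2 * k)) = 1 / 2 := by field_simp
    linarith
  set s := max (-T) (t₀ - ε) with hs
  set t := min T (t₀ + ε) with ht
  have hst₀ : s ≤ t₀ := max_le ht₀.1 (by linarith)
  have ht₀t : t₀ ≤ t := le_min ht₀.2 (by linarith)
  have hst : s < t := by
    rcases lt_or_eq_of_le ht₀.1 with h1 | h1
    · exact (max_lt h1 (by linarith)).trans_le ht₀t
    · exact hst₀.trans_lt (lt_min (by linarith) (by linarith))
  have hsT : -T ≤ s := le_max_left _ _
  have htT : t ≤ T := min_le_left _ _
  have hsub : Icc s t ⊆ Icc (-T) T := Icc_subset_Icc hsT htT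
  have habs : ∀ r ∈ Icc s t, |r - t₀| ≤ ε := fun r hr => by
    rw [abs_le]
    constructor <;> linarith [hr.1, hr.2, le_max_right (-T) (t₀ - ε), min_le_right T (t₀ + ε)]
  have hball : ∀ r ∈ Icc s t, γ r ∈ ball (γ t₀) ρ := fun r hr => by
    rw [mem_ball_iff_norm]
    exact ((hF.norm_sub_le hγ ht₀ (hsub hr)).trans
      (mul_le_mul_of_nonneg_left (habs r hr) hL.le)).trans_lt hεL
  have hcont : ContinuousOn (fun r => |inner ℝ a (γ r) - b|) (Icc s t) :=
    ((continuousOn_const.inner (hγ.continuousOn.mono hsub)).sub continuousOn_const).abs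
  -- The normal speed is at most k m, where m is the largest height. Since the height is zero at t₀,
  -- m ≤ k m ε ≤ m / 2, so m = 0 and γ remains on the face during an interval, whereas it is in a
  -- cell at all but countably many times.
  obtain ⟨τ, hτ, hmax⟩ := isCompact_Icc.exists_isMaxOn ⟨t₀, hst₀, ht₀t⟩ hcont
  set m := |inner ℝ a (γ τ) - b| with hm
  have hmax' : ∀ r ∈ Icc s t, |inner ℝ a (γ r) - b| ≤ m := fun r hr => hmax hr
  have hspeed : ∀ r ∈ Icc s t, ∀ K ∈ M, γ r ∈ K → |inner ℝ a (speed W p K (γ r))| ≤ k * m := by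
    intro r hr K hK hrK
    have e1 := mul_le_mul_of_nonneg_left (hmax' r hr) hk0.le
    rcases h.eq_or_eq hF.data.mesh (hball r hr) hK hrK with ⟨rfl, -⟩ | ⟨rfl, -⟩
    · exact (hb₁ _ (hball r hr)).trans ((mul_le_mul_of_nonneg_right (le_max_left _ _)
        (abs_nonneg _)).trans e1)
    · exact (hb₂ _ (hball r hr)).trans ((mul_le_mul_of_nonneg_right (le_max_right _ _)
        (abs_nonneg _)).trans e1)
  have hdiff : ∀ u v : ℝ, s ≤ u → u ≤ v → v ≤ t →
      |inner ℝ a (γ v) - inner ℝ a (γ u)| ≤ k * m * (v - u) := by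
    intro u v hu huv hv
    have e1 := hF.mul_le_inner hγ (hsT.trans hu) huv (hv.trans htT) (a := a) (c := -(k * m))
      fun r hr K hK hrK => (abs_le.1 (hspeed r ⟨hu.trans hr.1.le, hr.2.le.trans hv⟩ K hK hrK)).1
    have e2 := hF.mul_le_inner hγ (hsT.trans hu) huv (hv.trans htT) (a := -a) (c := -(k * m))
      fun r hr K hK hrK => by
        rw [inner_neg_left]
        exact neg_le_neg (abs_le.1 (hspeed r ⟨hu.trans hr.1.le, hr.2.le.trans hv⟩ K hK hrK)).2
    rw [inner_neg_left, inner_neg_left] at e2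
    rw [abs_le]
    constructor <;> linarith
  have hm0 : 0 ≤ m := abs_nonneg _
  have hmle : m ≤ k * m * |τ - t₀| := by
    have hmeq : m = |inner ℝ a (γ τ) - inner ℝ a (γ t₀)| := by rw [hm, ← h.mem]
    conv_lhs => rw [hmeq]
    rcases le_total τ t₀ with hle | hle
    · rw [abs_sub_comm, abs_sub_comm τ, abs_of_nonneg (sub_nonneg.2 hle)]
      exact hdiff τ t₀ hτ.1 hle ht₀t
    · rw [abs_of_nonneg (sub_nonneg.2 hle)]
      exact hdiff t₀ τ hst₀ hle hτ.2
  have hmz : m = 0 := by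
    have e1 := mul_le_mul_of_nonneg_left (habs τ hτ) (mul_nonneg hk0.le hm0)
    have e2 := mul_le_mul_of_nonneg_right hεk hm0
    nlinarith
  obtain ⟨r, hr, hrM⟩ := hγ.exists_mem_cell hsT hst htT
  have hr' := Ioo_subset_Icc_self hr
  have := hmax' r hr'
  rw [hmz] at this
  exact h.face _ (hball r hr') (sub_eq_zero.1 (abs_nonpos_iff.1 this)) hrM

/-- Away from the critical set, a trajectory is in a cell or crosses a face. -/
theorem Frame.mem_cell_or_crossing (hF : Frame Ω M φ V D φmin φmax Γ T W p H R L)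
    (hγ : Traj Ω M φ V T γ) (ht₀ : t₀ ∈ Icc (-T) T) (hc : γ t₀ ∉ critical M H W) :
    (∃ K ∈ M, γ t₀ ∈ K) ∨ ∃ a b ρ c K₁ K₂, IsSteepCrossing Ω M W p (γ t₀) a b ρ c K₁ K₂ := by
  by_cases hM : γ t₀ ∈ ⋃₀ M
  · exact Or.inl hM
  · right
    rcases hF.ext.crossing_or_tangency hF.data.mesh hF.data.domain hF.data.hdiv hF.faces
      (hγ.mem t₀ ht₀) hM hc with ⟨a, b, ρ, K₁, K₂, h⟩ | ⟨a, b, ρ, K₁, K₂, h⟩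
    · obtain ⟨ρ', c, h'⟩ := h.exists_steep hF.ext
      exact ⟨a, b, ρ', c, K₁, K₂, h'⟩
    · exact absurd h (hF.not_isTangency hγ ht₀)

end Tangency

/-! ### Local regularity and local backward uniqueness -/

section Local

variable {x₀ a : Sp d} {b ρ c : ℝ} {K₁ K₂ K : Set (Sp d)} {γ η : ℝ → Sp d} {t t₀ : ℝ}

theorem Frame.exists_small (hL : 0 < L) (hρ : 0 < ρ) {k : ℝ} (hk : 0 ≤ k) :
    ∃ ε > 0, L * (2 * ε) ≤ ρ / 8 ∧ 2 * k * (2 * ε) ≤ 1 := by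
  refine ⟨min (ρ / (16 * L)) (1 / (4 * (k + 1))), by positivity, ?_, ?_⟩
  · have : L * (2 * min (ρ / (16 * L)) (1 / (4 * (k + 1)))) ≤ L * (2 * (ρ / (16 * L))) := by
      gcongr; exact min_le_left _ _
    have e : L * (2 * (ρ / (16 * L))) = ρ / 8 := by field_simp; norm_num
    linarith
  · have : 2 * k * (2 * min (ρ / (16 * L)) (1 / (4 * (k + 1)))) ≤
        2 * k * (2 * (1 / (4 * (k + 1)))) := by
      gcongr; exact min_le_right _ _
    have e : 2 * k * (2 * (1 / (4 * (k + 1)))) = k / (k + 1) := by field_simp; ring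
    have e2 : k / (k + 1) ≤ 1 := by rw [div_le_one (by linarith)]; linarith
    linarith

theorem Frame.mem_ball_of_abs_le (hF : Frame Ω M φ V D φmin φmax Γ T W p H R L)
    (hγ : Traj Ω M φ V T γ) (ht₀ : t₀ ∈ Icc (-T) T) (ht : t ∈ Icc (-T) T) {ε : ℝ} (hρ : 0 < ρ)
    (hε : L * (2 * ε) ≤ ρ / 8) (h : |t - t₀| ≤ ε) : γ t ∈ ball (γ t₀) ρ := by
  have h1 := hF.norm_sub_le hγ ht₀ ht
  have h2 := mul_le_mul_of_nonneg_left h hF.L_pos.le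
  have h3 : 0 ≤ L * ε := (mul_nonneg hF.L_pos.le (abs_nonneg _)).trans h2
  rw [mem_ball_iff_norm]
  linarith

/-- Local regularity of the flow along a trajectory, away from the critical set. -/
theorem Frame.exists_isRegular (hF : Frame Ω M φ V D φmin φmax Γ T W p H R L)
    (hγ : Traj Ω M φ V T γ) (ht₀ : t₀ ∈ Icc (-T) T) (hc : γ t₀ ∉ critical M H W) :
    ∃ ε > 0, (∀ t ∈ Icc (-T) T, |t - t₀| ≤ ε → t ≠ t₀ → γ t ∈ ⋃₀ M) ∧
      ∀ t₁ ∈ Icc (-T) T, ∀ t₂ ∈ Icc (-T) T, |t₁ - t₀| ≤ ε → |t₂ - t₀| ≤ ε → t₁ ≤ t₀ → t₀ ≤ t₂ →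
        γ t₁ ∈ ⋃₀ M → γ t₂ ∈ ⋃₀ M → IsRegular Ω M φ V T γ t₁ t₂ := by
  rcases hF.mem_cell_or_crossing hγ ht₀ hc with ⟨K, hK, hmem⟩ | ⟨a, b, ρ, c, K₁, K₂, h⟩
  · obtain ⟨ρ, hρ, hball⟩ := Metric.isOpen_iff.1 (hF.data.mesh.polytopal K hK).isOpen _ hmem
    obtain ⟨k, -, hkb, -⟩ := exists_fderiv_bound (hF.ext.contDiff_speed hK) R
    obtain ⟨ε, hε, hεL, hεk⟩ := Frame.exists_small hF.L_pos hρ k.2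
    refine ⟨ε, hε, fun t ht h _ => ⟨K, hK, hball (hF.mem_ball_of_abs_le hγ ht₀ ht hρ hεL h)⟩,
      fun t₁ h1 t₂ h2 h1ε h2ε h10 h02 _ _ => ?_⟩
    have hle : t₂ - t₁ ≤ 2 * ε := by linarith [(abs_le.1 h1ε).1, (abs_le.1 h2ε).2]
    have hL' : L * (t₂ - t₁) ≤ ρ / 8 :=
      (mul_le_mul_of_nonneg_left hle hF.L_pos.le).trans hεL
    refine hF.isRegular_of_mem_cell hγ hK h1.1 (h10.trans h02) h2.2 k.2 hkb
      ((mul_le_mul_of_nonneg_left hle (mul_nonneg zero_le_two k.2)).trans hεk)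
      (fun r hr => hball ?_) ?_
    · exact hF.mem_ball_of_near hγ hγ h1.1 h2.2 ⟨h10, h02⟩ hρ hL' (by simpa using by positivity) r hr
    · filter_upwards [eventually_traj, eventually_norm_le (show 0 < ρ / 4 by positivity)]
        with η hη hn r hr
      exact hball (hF.mem_ball_of_near hγ hη h1.1 h2.2 ⟨h10, h02⟩ hρ hL' hn r hr)
  · have hρ := h.pos
    obtain ⟨k₁, -, hk₁, -⟩ := exists_fderiv_bound (hF.ext.contDiff_speed h.mem₁) R
    obtain ⟨k₂, -, hk₂, -⟩ := exists_fderiv_bound (hF.ext.contDiff_speed h.mem₂) R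
    have hk0 : 0 ≤ max (k₁ : ℝ) k₂ := k₁.2.trans (le_max_left _ _)
    obtain ⟨ε, hε, hεL, hεk⟩ := Frame.exists_small hF.L_pos hρ hk0
    have hM₀ : γ t₀ ∉ ⋃₀ M := h.face _ (mem_ball_self hρ) h.mem
    refine ⟨ε, hε, fun t ht hd hne => ?_, fun t₁ h1 t₂ h2 h1ε h2ε h10 h02 m1 m2 => ?_⟩
    · have hb : ∀ r ∈ uIcc t t₀, γ r ∈ ball (γ t₀) ρ := fun r hr =>
        hF.mem_ball_of_abs_le hγ ht₀ (uIcc_subset_Icc ht ht₀ hr) hρ hεL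
          ((abs_sub_left_of_mem_uIcc (by rwa [uIcc_comm] at hr)).trans hd)
      rcases lt_or_gt_of_ne hne with hlt | hlt
      · rw [uIcc_of_le hlt.le] at hb
        exact ⟨K₁, h.mem₁, h.mem₁_of_le hF hγ ht.1 ht₀.2 hb h.mem.le t ⟨le_rfl, hlt⟩⟩
      · rw [uIcc_of_ge hlt.le] at hb
        exact ⟨K₂, h.mem₂, h.mem₂_of_le hF hγ ht₀.1 ht.2 hb h.mem.ge t ⟨hlt, le_rfl⟩⟩
    · have h10' : t₁ < t₀ := lt_of_le_of_ne h10 fun e => hM₀ (e ▸ m1)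
      have h02' : t₀ < t₂ := lt_of_le_of_ne h02 fun e => hM₀ (e ▸ m2)
      have hle : t₂ - t₁ ≤ 2 * ε := by linarith [(abs_le.1 h1ε).1, (abs_le.1 h2ε).2]
      exact h.isRegular hF hγ h1.1 h10' h02' h2.2
        ((mul_le_mul_of_nonneg_left hle hF.L_pos.le).trans hεL) hk0
        (fun x hx => (hk₁ x hx).trans (le_max_left _ _))
        (fun x hx => (hk₂ x hx).trans (le_max_right _ _))
        ((mul_le_mul_of_nonneg_left hle (by positivity)).trans hεk)

/-- Local backward uniqueness, away from the critical set. -/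
theorem Frame.exists_eq_before (hF : Frame Ω M φ V D φmin φmax Γ T W p H R L)
    (hγ : Traj Ω M φ V T γ) (hη : Traj Ω M φ V T η) (ht₀ : t₀ ∈ Icc (-T) T)
    (hc : γ t₀ ∉ critical M H W) (heq : γ t₀ = η t₀) :
    ∃ ε > 0, ∀ t ∈ Icc (-T) T, t₀ - ε ≤ t → t ≤ t₀ → γ t = η t := by
  -- The point reached at t₀ determines the cell occupied just before t₀ by any trajectory through
  -- it (the first cell, for a crossing). Both trajectories thus solve the same smooth equation
  -- there.
  have key : ∀ ε > 0, ∀ K ∈ M,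
      (∀ ζ : ℝ → Sp d, Traj Ω M φ V T ζ → ζ t₀ = γ t₀ → ∀ r ∈ Icc (-T) T, t₀ - ε ≤ r → r < t₀ →
        ζ r ∈ K) → ∃ ε > 0, ∀ t ∈ Icc (-T) T, t₀ - ε ≤ t → t ≤ t₀ → γ t = η t := by
    intro ε hε K hK h
    refine ⟨ε, hε, fun t ht h1 h2 => ?_⟩
    have sol : ∀ ζ : ℝ → Sp d, Traj Ω M φ V T ζ → ζ t₀ = γ t₀ → Solves (speed W p K) ζ t t₀ :=
      fun ζ hζ h0 => hF.solves hζ ht.1 h2 ht₀.2 hK fun r hr =>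
        h ζ hζ h0 r ⟨ht.1.trans hr.1.le, hr.2.le.trans ht₀.2⟩ (h1.trans hr.1.le) hr.2
    exact Solves.eqOn_of_eq_right (hF.ext.contDiff_speed hK) (sol γ hγ rfl) (sol η hη heq.symm)
      (fun r hr => hF.mem_closedBall hγ ⟨ht.1.trans hr.1, hr.2.trans ht₀.2⟩)
      (fun r hr => hF.mem_closedBall hη ⟨ht.1.trans hr.1, hr.2.trans ht₀.2⟩) heq
      (left_mem_Icc.2 h2)
  rcases hF.mem_cell_or_crossing hγ ht₀ hc with ⟨K, hK, hmem⟩ | ⟨a, b, ρ, c, K₁, K₂, h⟩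
  · obtain ⟨ρ, hρ, hball⟩ := Metric.isOpen_iff.1 (hF.data.mesh.polytopal K hK).isOpen _ hmem
    obtain ⟨ε, hε, hεL, -⟩ := Frame.exists_small hF.L_pos hρ le_rfl
    refine key ε hε K hK fun ζ hζ h0 r hr h1 h2 => hball ?_
    rw [← h0]
    exact hF.mem_ball_of_abs_le hζ ht₀ hr hρ hεL (abs_le.2 ⟨by linarith, by linarith⟩)
  · obtain ⟨ε, hε, hεL, -⟩ := Frame.exists_small hF.L_pos h.pos le_rfl
    refine key ε hε K₁ h.mem₁ fun ζ hζ h0 r hr h1 h2 => ?_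
    rw [← h0] at h
    refine h.mem₁_of_le hF hζ hr.1 ht₀.2 (fun u hu => ?_) h.mem.le r ⟨le_rfl, h2⟩
    exact hF.mem_ball_of_abs_le hζ ht₀ ⟨hr.1.trans hu.1, hu.2.trans ht₀.2⟩ h.pos hεL
      (abs_le.2 ⟨by linarith [hu.1], by linarith [hu.2]⟩)

end Local

/-! ### From local to global along a trajectory -/

section Global

variable {γ η : ℝ → Sp d} {s t : ℝ}

theorem Frame.zero_mem (hF : Frame Ω M φ V D φmin φmax Γ T W p H R L) : (0 : ℝ) ∈ Icc (-T) T :=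
  ⟨by linarith [hF.T_pos], hF.T_pos.le⟩

theorem Frame.Icc_subset (hF : Frame Ω M φ V D φmin φmax Γ T W p H R L) (hs : s ≤ T) :
    Icc 0 s ⊆ Icc (-T) T := Icc_subset_Icc hF.zero_mem.1 hs

/-- Regularity of the flow along a trajectory which avoids the critical set. -/
theorem Frame.isRegular (hF : Frame Ω M φ V D φmin φmax Γ T W p H R L)
    (hγ : Traj Ω M φ V T γ) (h0 : γ 0 ∈ ⋃₀ M) (hs : s ≤ T)
    (hc : ∀ r ∈ Icc 0 s, γ r ∉ critical M H W) (ht : t ∈ Icc 0 s) (htM : γ t ∈ ⋃₀ M) :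
    IsRegular Ω M φ V T γ 0 t := by
  by_contra hcon
  -- Let τ be the infimum of the bad times. Local regularity around τ links a good time u < τ, or 0
  -- if τ = 0, to a bad time r ≥ τ, which makes r good.
  set S := {r ∈ Icc 0 s | γ r ∈ ⋃₀ M ∧ ¬ IsRegular Ω M φ V T γ 0 r} with hS
  have hSne : S.Nonempty := ⟨t, ht, htM, hcon⟩
  have hSb : BddBelow S := ⟨0, fun r hr => hr.1.1⟩
  set τ := sInf S with hτ
  have hτ0 : 0 ≤ τ := le_csInf hSne fun r hr => hr.1.1
  have hτs : τ ≤ s := (csInf_le hSb ⟨ht, htM, hcon⟩).trans ht.2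
  have hτT := hF.Icc_subset hs ⟨hτ0, hτs⟩
  obtain ⟨ε, hε, hcell, hreg⟩ := hF.exists_isRegular hγ hτT (hc τ ⟨hτ0, hτs⟩)
  obtain ⟨r, hr, hrε⟩ := exists_lt_of_csInf_lt hSne (show sInf S < τ + ε by linarith)
  have hτr : τ ≤ r := csInf_le hSb hr
  have hrT := hF.Icc_subset hs hr.1
  have habs : |r - τ| ≤ ε := abs_le.2 ⟨by linarith, by linarith⟩
  rcases hτ0.eq_or_lt with he | hlt
  · exact hr.2.2 (hreg 0 hF.zero_mem r hrT (by rw [← he]; simpa using hε.le) habs hτ0 hτr h0 hr.2.1)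
  · set u := max 0 (τ - ε) with hu
    have huτ : u < τ := max_lt hlt (by linarith)
    have hu0 : 0 ≤ u := le_max_left _ _
    have huT : u ∈ Icc (-T) T := hF.Icc_subset hs ⟨hu0, huτ.le.trans hτs⟩
    have huε : |u - τ| ≤ ε :=
      abs_le.2 ⟨by linarith [le_max_right 0 (τ - ε)], by linarith⟩
    have huM := hcell u huT huε huτ.ne
    have hureg : IsRegular Ω M φ V T γ 0 u := by
      by_contra hu'
      exact absurd (csInf_le hSb ⟨⟨hu0, huτ.le.trans hτs⟩, huM, hu'⟩) (not_le.2 huτ)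
    exact hr.2.2 (hF.isRegular_trans hγ hF.zero_mem huT hrT hureg
      (hreg u huT r hrT huε habs huτ.le hτr huM hr.2.1))

/-- Backward uniqueness for trajectories which avoid the critical set. -/
theorem Frame.eq_of_eq (hF : Frame Ω M φ V D φmin φmax Γ T W p H R L)
    (hγ : Traj Ω M φ V T γ) (hη : Traj Ω M φ V T η) (hs0 : 0 ≤ s) (hs : s ≤ T)
    (hc : ∀ r ∈ Icc 0 s, γ r ∉ critical M H W) (heq : γ s = η s) : γ 0 = η 0 := by
  have hmaps : MapsTo (fun r => s - r) (Icc 0 s) (Icc (-T) T) := fun r hr =>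
    hF.Icc_subset hs ⟨by linarith [hr.2], by linarith [hr.1]⟩
  have hsubc : ContinuousOn (fun r => s - r) (Icc 0 s) := by fun_prop
  have h1 : ContinuousOn (fun r => γ (s - r) - η (s - r)) (Icc 0 s) :=
    (hγ.continuousOn.comp hsubc hmaps).sub (hη.continuousOn.comp hsubc hmaps)
  have hcl : IsClosed ({r | γ (s - r) - η (s - r) = 0} ∩ Icc 0 s) := by
    rw [inter_comm]
    exact h1.preimage_isClosed_of_isClosed isClosed_Icc isClosed_singleton
  -- Continuous induction in the reversed time s - r: the coincidence set is closed, and local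
  -- backward uniqueness extends it to the right.
  have key := hcl.Icc_subset_of_forall_mem_nhdsWithin
    (by rw [mem_ofPred_eq, sub_zero, heq, sub_self]) (fun r hr => ?_)
  · have := key (right_mem_Icc.2 hs0)
    rw [mem_ofPred_eq, sub_self] at this
    exact sub_eq_zero.1 this
  · have hr' : r ∈ Icc 0 s := ⟨hr.2.1, hr.2.2.le⟩
    obtain ⟨ε, hε, h⟩ := hF.exists_eq_before hγ hη (hmaps hr')
      (hc _ ⟨by linarith [hr'.2], by linarith [hr'.1]⟩) (sub_eq_zero.1 hr.1)
    have hpos : 0 < min ε (s - r) := lt_min hε (by linarith [hr.2.2])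
    filter_upwards [Ioo_mem_nhdsGT (show r < r + min ε (s - r) by linarith)] with u hu
    have h2 : u ≤ s := by linarith [hu.2, min_le_right ε (s - r)]
    exact sub_eq_zero.2 (h (s - u) (hmaps ⟨hr'.1.trans hu.1.le, h2⟩)
      (by linarith [hu.2, min_le_left ε (s - r)]) (by linarith [hu.1]))

end Global

/-! ### Regularity of the flow map and preimage estimates -/

section Flow

variable {C : Set (Sp d)} {F : ℝ → Sp d → Sp d} {x : Sp d} {s t : ℝ} {B : Set (Sp d)}

theorem IsFlow.traj (hf : IsFlow Ω M φ V T C F) (hx : x ∈ Ω \ C) :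
    Traj Ω M φ V T (fun t => F t x) := by
  have h := hf.trajectory x hx
  have h0 : F 0 x = x := h.init
  rw [Traj, h0]
  exact h

theorem IsFlow.zero (hf : IsFlow Ω M φ V T C F) (hx : x ∈ Ω \ C) : F 0 x = x :=
  (hf.trajectory x hx).init

/-- As C is relatively closed, every point near x starts a trajectory, and F 0 is the identity
there. This converts a tangent map at x into an actual derivative of F t. -/
theorem IsFlow.tendsto_nearTraj (hf : IsFlow Ω M φ V T C F) (hx : x ∈ Ω \ C) :
    Tendsto (fun (y : Sp d) (t : ℝ) => F t y) (𝓝 x) (nearTraj Ω M φ V T (fun t => F t x) 0) := by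
  have hev : ∀ᶠ y in 𝓝 x, y ∈ Ω \ C := hf.isOpen_compl.mem_nhds hx
  refine tendsto_inf.2 ⟨tendsto_comap_iff.2 ?_, tendsto_principal.2 (hev.mono fun y => hf.traj)⟩
  have h1 : Tendsto (fun y => y - x) (𝓝 x) (𝓝 0) := by
    have := (tendsto_id (x := 𝓝 x)).sub_const x
    simpa using this
  refine h1.congr' (hev.mono fun y hy => ?_)
  simp only [Function.comp_apply, hf.zero hy, hf.zero hx]

theorem IsFlow.hasFDerivAt (hf : IsFlow Ω M φ V T C F) (hx : x ∈ Ω \ C)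
    (h : IsRegular Ω M φ V T (fun t => F t x) 0 t) :
    ∃ A, HasFDerivAt (F t) A x ∧
      φ (F t x) * A.det = φ x * Real.exp (∫ r in (0 : ℝ)..t, rate φ V (F r x)) := by
  obtain ⟨A, hA, hA'⟩ := h
  have hev : ∀ᶠ y in 𝓝 x, y ∈ Ω \ C := hf.isOpen_compl.mem_nhds hx
  refine ⟨A, ?_, by simpa only [hf.zero hx] using hA'⟩
  rw [hasFDerivAt_iff_isLittleO]
  refine (hA.comp_tendsto (hf.tendsto_nearTraj hx)).congr' (hev.mono fun y hy => ?_)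
    (hev.mono fun y hy => ?_)
  · simp only [Function.comp_apply, hf.zero hy, hf.zero hx]
  · simp only [Function.comp_apply, hf.zero hy, hf.zero hx]

/-- The points whose trajectory avoids `B` up to time `s`. -/
def avoiding (Ω : Set (Sp d)) (M : Set (Set (Sp d))) (C : Set (Sp d)) (F : ℝ → Sp d → Sp d)
    (B : Set (Sp d)) (s : ℝ) : Set (Sp d) :=
  {x | x ∈ Ω \ C ∧ x ∈ ⋃₀ M ∧ ∀ r ∈ Icc 0 s, F r x ∉ B}

/-- The points whose trajectory avoids `B` up to time `s`, and is in a cell at time `s`. -/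
def arriving (Ω : Set (Sp d)) (M : Set (Set (Sp d))) (C : Set (Sp d)) (F : ℝ → Sp d → Sp d)
    (B : Set (Sp d)) (s : ℝ) : Set (Sp d) :=
  {x | x ∈ avoiding Ω M C F B s ∧ F s x ∈ ⋃₀ M}

theorem avoiding_mono (hst : s ≤ t) : avoiding Ω M C F B t ⊆ avoiding Ω M C F B s :=
  fun _ hx => ⟨hx.1, hx.2.1, fun r hr => hx.2.2 r ⟨hr.1, hr.2.trans hst⟩⟩

theorem Frame.hasFDerivAt (hF : Frame Ω M φ V D φmin φmax Γ T W p H R L)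
    (hf : IsFlow Ω M φ V T C F) (hs : s ≤ T) (hx : x ∈ avoiding Ω M C F (critical M H W) s)
    (ht : t ∈ Icc 0 s) (hM : F t x ∈ ⋃₀ M) :
    ∃ A, HasFDerivAt (F t) A x ∧
      φ (F t x) * A.det = φ x * Real.exp (∫ r in (0 : ℝ)..t, rate φ V (F r x)) :=
  hf.hasFDerivAt hx.1 (hF.isRegular (hf.traj hx.1) (by simpa only [hf.zero hx.1] using hx.2.1) hs
    hx.2.2 ht hM)

theorem Frame.exists_cell_time (hF : Frame Ω M φ V D φmin φmax Γ T W p H R L)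
    {γ : ℝ → Sp d} (hγ : Traj Ω M φ V T γ) (h0 : γ 0 ∈ ⋃₀ M) (ht : t ∈ Icc 0 T) {ε : ℝ}
    (hε : 0 < ε) : ∃ r ∈ Icc 0 t, t - ε ≤ r ∧ γ r ∈ ⋃₀ M := by
  rcases ht.1.eq_or_lt with he | hlt
  · exact ⟨0, ⟨le_rfl, ht.1⟩, by linarith, h0⟩
  · obtain ⟨r, hr, hrM⟩ := hγ.exists_mem_cell (s := max 0 (t - ε)) (t := t)
      (hF.zero_mem.1.trans (le_max_left _ _)) (max_lt hlt (by linarith)) ht.2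
    exact ⟨r, ⟨(le_max_left _ _).trans hr.1.le, hr.2.le⟩, (le_max_right _ _).trans hr.1.le, hrM⟩

/-- Joint continuity of the flow, along the trajectories which avoid the critical set. -/
theorem Frame.eventually_dist_lt (hF : Frame Ω M φ V D φmin φmax Γ T W p H R L)
    (hf : IsFlow Ω M φ V T C F) (hs : s ≤ T) (hx : x ∈ avoiding Ω M C F (critical M H W) s)
    (ht : t ∈ Icc 0 s) {ρ : ℝ} (hρ : 0 < ρ) :
    ∀ᶠ z : Sp d × ℝ in 𝓝 (x, t), z.2 ∈ Icc 0 s → dist (F z.2 z.1) (F t x) < ρ := by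
  have hev : ∀ᶠ y in 𝓝 x, y ∈ Ω \ C := hf.isOpen_compl.mem_nhds hx.1
  have hL := hF.L_pos
  have htr := hf.traj hx.1
  -- At time t the trajectory may be on a face, where differentiability of F t is not available. It
  -- is at a slightly earlier time u spent in a cell, and the speed bound covers the remaining time.
  obtain ⟨u, hu, hut, huM⟩ := hF.exists_cell_time htr
    (by simpa only [hf.zero hx.1] using hx.2.1) ⟨ht.1, ht.2.trans hs⟩
    (show 0 < ρ / (8 * L) by positivity)
  have hus : u ∈ Icc 0 s := ⟨hu.1, hu.2.trans ht.2⟩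
  obtain ⟨A, hA, -⟩ := hF.hasFDerivAt hf hs hx hus huM
  have e1 : ∀ᶠ y in 𝓝 x, dist (F u y) (F u x) < ρ / 4 :=
    hA.continuousAt (Metric.ball_mem_nhds _ (by positivity))
  have e2 : ∀ᶠ r in 𝓝 t, |r - t| < ρ / (8 * L) := by
    have := Metric.ball_mem_nhds t (show 0 < ρ / (8 * L) by positivity)
    filter_upwards [this] with r hr
    rwa [mem_ball, Real.dist_eq] at hr
  filter_upwards [(e1.and hev).prodMk_nhds e2] with ⟨y, r⟩ ⟨⟨h1, h2⟩, h3⟩ hr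
  have huT := hF.Icc_subset hs hus
  have d1 := hF.norm_sub_le (hf.traj h2) huT (hF.Icc_subset hs hr)
  have d2 := hF.norm_sub_le htr (hF.Icc_subset hs ht) huT
  have a1 : |r - u| ≤ 2 * (ρ / (8 * L)) := by
    have := abs_lt.1 h3
    rw [abs_le]; constructor <;> linarith [hu.2]
  have a2 : |u - t| ≤ ρ / (8 * L) := by rw [abs_le]; constructor <;> linarith [hu.2]
  have b1 := mul_le_mul_of_nonneg_left a1 hL.le
  have b2 := mul_le_mul_of_nonneg_left a2 hL.le
  have e : L * (ρ / (8 * L)) = ρ / 8 := by field_simp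
  have e3 : F r y - F t x = (F r y - F u y) + (F u y - F u x) + (F u x - F t x) := by abel
  rw [dist_eq_norm] at h1 ⊢
  rw [e3]
  have := norm_add₃_le (a := F r y - F u y) (b := F u y - F u x) (c := F u x - F t x)
  simp only at d1 d2
  linarith

theorem Frame.continuousOn_flow (hF : Frame Ω M φ V D φmin φmax Γ T W p H R L)
    (hf : IsFlow Ω M φ V T C F) (hs : s ≤ T) :
    ContinuousOn (fun z : Sp d × ℝ => F z.2 z.1)
      (avoiding Ω M C F (critical M H W) s ×ˢ Icc 0 s) := by
  rintro ⟨x, t⟩ ⟨hx, ht⟩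
  rw [ContinuousWithinAt, Metric.tendsto_nhds]
  intro ρ hρ
  filter_upwards [nhdsWithin_le_nhds (hF.eventually_dist_lt hf hs hx ht hρ), self_mem_nhdsWithin]
    with z h1 h2
  exact h1 h2.2

/-- The critical set is closed, the flow is jointly continuous at the points considered and [0, s]
is compact, so avoidance persists for nearby starting points. -/
theorem Frame.isOpen_avoiding (hF : Frame Ω M φ V D φmin φmax Γ T W p H R L)
    (hf : IsFlow Ω M φ V T C F) (hs : s ≤ T) :
    IsOpen (avoiding Ω M C F (critical M H W) s) := by
  rw [isOpen_iff_mem_nhds]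
  intro x hx
  have key : ∀ᶠ y in 𝓝 x, ∀ r ∈ Icc 0 s, r ∈ Icc 0 s → F r y ∉ critical M H W := by
    refine isCompact_Icc.eventually_forall_of_forall_eventually fun t ht => ?_
    have hcl := hF.ext.isClosed_critical hF.data.mesh.finite H
    obtain ⟨ρ, hρ, hball⟩ := Metric.isOpen_iff.1 hcl.isOpen_compl (F t x) (hx.2.2 t ht)
    filter_upwards [hF.eventually_dist_lt hf hs hx ht hρ] with z hz hz'
    exact hball (hz hz')
  filter_upwards [hf.isOpen_compl.mem_nhds hx.1, hF.isOpen_cells.mem_nhds hx.2.1, key]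
    with y h1 h2 h3
  exact ⟨h1, h2, fun r hr => h3 r hr hr⟩

theorem Frame.isOpen_arriving (hF : Frame Ω M φ V D φmin φmax Γ T W p H R L)
    (hf : IsFlow Ω M φ V T C F) (hs : s ∈ Icc 0 T) :
    IsOpen (arriving Ω M C F (critical M H W) s) := by
  rw [isOpen_iff_mem_nhds]
  intro x hx
  obtain ⟨A, hA, -⟩ := hF.hasFDerivAt hf hs.2 hx.1 (right_mem_Icc.2 hs.1) hx.2
  filter_upwards [(hF.isOpen_avoiding hf hs.2).mem_nhds hx.1,
    hA.continuousAt (hF.isOpen_cells.mem_nhds hx.2)] with y h1 h2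
  exact ⟨h1, h2⟩

theorem Frame.continuousOn_arriving (hF : Frame Ω M φ V D φmin φmax Γ T W p H R L)
    (hf : IsFlow Ω M φ V T C F) (hs : s ∈ Icc 0 T) :
    ContinuousOn (F s) (arriving Ω M C F (critical M H W) s) := fun x hx => by
  obtain ⟨A, hA, -⟩ := hF.hasFDerivAt hf hs.2 hx.1 (right_mem_Icc.2 hs.1) hx.2
  exact hA.continuousAt.continuousWithinAt

theorem Frame.injOn_avoiding (hF : Frame Ω M φ V D φmin φmax Γ T W p H R L)
    (hf : IsFlow Ω M φ V T C F) (hs : s ∈ Icc 0 T) :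
    InjOn (F s) (avoiding Ω M C F (critical M H W) s) := fun x hx y hy h => by
  have := hF.eq_of_eq (hf.traj hx.1) (hf.traj hy.1) hs.1 hs.2 hx.2.2 h
  simpa only [hf.zero hx.1, hf.zero hy.1] using this

theorem Frame.measurableSet_preimage (hF : Frame Ω M φ V D φmin φmax Γ T W p H R L)
    (hf : IsFlow Ω M φ V T C F) (hs : s ∈ Icc 0 T) {N : Set (Sp d)} (hN : MeasurableSet N) :
    MeasurableSet {x | x ∈ arriving Ω M C F (critical M H W) s ∧ F s x ∈ N} := by
  have h1 := (hF.continuousOn_arriving hf hs).domRestrict.measurable hN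
  have h2 := (hF.isOpen_arriving hf hs).measurableSet.subtype_image h1
  convert h2 using 1
  ext x
  constructor
  · rintro ⟨hx, hxN⟩
    exact ⟨⟨x, hx⟩, hxN, rfl⟩
  · rintro ⟨y, hy, rfl⟩
    exact ⟨y.2, hy⟩

theorem Frame.abs_integral_rate_le (hF : Frame Ω M φ V D φmin φmax Γ T W p H R L)
    {γ : ℝ → Sp d} (hγ : Traj Ω M φ V T γ) (ht : t ∈ Icc 0 T) :
    |∫ r in (0 : ℝ)..t, rate φ V (γ r)| ≤ Γ / φmin * t := by
  have := intervalIntegral.norm_integral_le_of_norm_le_const_ae (a := 0) (b := t)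
    (C := Γ / φmin) (f := fun r => rate φ V (γ r)) ?_
  · rwa [sub_zero, abs_of_nonneg ht.1, Real.norm_eq_abs] at this
  · filter_upwards [Frame.ae_mem_cells hγ] with r hr hr'
    rw [uIoc_of_le ht.1] at hr'
    exact hF.abs_rate_le (hr (hF.Icc_subset ht.2 (Ioc_subset_Icc_self hr')))

theorem Frame.div_nonneg (hF : Frame Ω M φ V D φmin φmax Γ T W p H R L) (hx : x ∈ ⋃₀ M) :
    0 ≤ Γ / φmin := (abs_nonneg _).trans (hF.abs_rate_le hx)

/-- Bounds on the Jacobian. -/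
theorem Frame.jac_bounds (hF : Frame Ω M φ V D φmin φmax Γ T W p H R L)
    (hf : IsFlow Ω M φ V T C F) (hx : x ∈ Ω \ C) (ht : t ∈ Icc 0 T) (hM : F t x ∈ ⋃₀ M)
    {j : ℝ} (hj : φ (F t x) * j = φ x * Real.exp (∫ r in (0 : ℝ)..t, rate φ V (F r x))) :
    0 < j ∧ j ≤ φmax / φmin * Real.exp (Γ / φmin * t) ∧
      1 ≤ φmax / φmin * Real.exp (Γ / φmin * t) * j := by
  have h0 := hF.φmin_pos
  obtain ⟨b1, b2⟩ := hF.data.bounds x hx.1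
  have b3 := hF.φ_ge hM
  have b4 := (hF.data.bounds _ ((hf.traj hx).mem t (hF.Icc_subset ht.2 ⟨ht.1, le_rfl⟩))).2
  obtain ⟨i1, i2⟩ := abs_le.1 (hF.abs_integral_rate_le (hf.traj hx) ht)
  set I := ∫ r in (0 : ℝ)..t, rate φ V (F r x)
  set e := Real.exp (Γ / φmin * t)
  have he : Real.exp I ≤ e := Real.exp_le_exp.2 i2
  have he' : 1 ≤ e * Real.exp I := by
    rw [← Real.exp_add]; exact Real.one_le_exp (by linarith)
  have hφF : 0 < φ (F t x) := h0.trans_le b3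
  have hjeq : j = φ x * Real.exp I / φ (F t x) := by rw [eq_div_iff hφF.ne', ← hj]; ring
  have hφx : 0 < φ x := h0.trans_le b1
  have hmax : 0 < φmax := hφx.trans_le b2
  refine ⟨by rw [hjeq]; positivity, ?_, ?_⟩
  · rw [hjeq, mul_div_right_comm]
    gcongr
  · rw [hjeq, show φmax / φmin * e * (φ x * Real.exp I / φ (F t x)) =
      (φmax / φ (F t x)) * (φ x / φmin) * (e * Real.exp I) by ring]
    have c1 : 1 ≤ φmax / φ (F t x) := (one_le_div hφF).2 b4
    have c2 : 1 ≤ φ x / φmin := (one_le_div h0).2 b1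
    exact one_le_mul_of_one_le_of_one_le (one_le_mul_of_one_le_of_one_le c1 c2) he'

theorem Frame.exp_mono (hF : Frame Ω M φ V D φmin φmax Γ T W p H R L) (hx : x ∈ ⋃₀ M)
    (hst : s ≤ t) :
    φmax / φmin * Real.exp (Γ / φmin * s) ≤ φmax / φmin * Real.exp (Γ / φmin * t) := by
  have h0 := hF.φmin_pos
  have h1 := hF.φ_ge hx
  obtain ⟨K, hK, hx'⟩ := hx
  have h2 := (hF.data.bounds x (hF.data.mesh.subset K hK hx')).2
  have h3 := hF.div_nonneg ⟨K, hK, hx'⟩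
  have h4 : 0 ≤ φmax := by linarith
  gcongr

/-- The preimages of small sets are small. -/
theorem Frame.volume_preimage_le (hF : Frame Ω M φ V D φmin φmax Γ T W p H R L)
    (hf : IsFlow Ω M φ V T C F) (hs : s ∈ Icc 0 T) (N : Set (Sp d)) :
    volume {x | x ∈ arriving Ω M C F (critical M H W) s ∧ F s x ∈ N} ≤
      ENNReal.ofReal (φmax / φmin * Real.exp (Γ / φmin * T)) * volume N := by
  set N' := toMeasurable volume N
  set S := {x | x ∈ arriving Ω M C F (critical M H W) s ∧ F s x ∈ N'} with hS
  have hSm : MeasurableSet S := hF.measurableSet_preimage hf hs (measurableSet_toMeasurable _ _)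
  have hder : ∀ x ∈ S, HasFDerivWithinAt (F s) (fderiv ℝ (F s) x) S x := fun x hx => by
    obtain ⟨A, hA, -⟩ := hF.hasFDerivAt hf hs.2 hx.1.1 (right_mem_Icc.2 hs.1) hx.1.2
    exact hA.differentiableAt.hasFDerivAt.hasFDerivWithinAt
  -- The flow is injective on S, so the integral of its Jacobian is the volume of an image contained
  -- in the measurable hull of N; the Jacobian is at least 1 / κ.
  have hvol := lintegral_abs_det_fderiv_eq_addHaar_image volume hSm hder
    ((hF.injOn_avoiding hf hs).mono fun x hx => hx.1.1)
  set κ := φmax / φmin * Real.exp (Γ / φmin * T)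
  calc volume {x | x ∈ arriving Ω M C F (critical M H W) s ∧ F s x ∈ N}
      ≤ volume S := measure_mono fun x hx => ⟨hx.1, subset_toMeasurable _ _ hx.2⟩
    _ = ∫⁻ x in S, 1 := by simp
    _ ≤ ∫⁻ x in S, ENNReal.ofReal κ * ENNReal.ofReal |(fderiv ℝ (F s) x).det| := by
        refine setLIntegral_mono' hSm fun x hx => ?_
        obtain ⟨A, hA, hA'⟩ := hF.hasFDerivAt hf hs.2 hx.1.1 (right_mem_Icc.2 hs.1) hx.1.2
        obtain ⟨j1, -, j3⟩ := hF.jac_bounds hf hx.1.1.1 hs hx.1.2 hA'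
        have hmono := hF.exp_mono hx.1.2 hs.2
        have hκ : 1 ≤ κ * A.det := j3.trans (mul_le_mul_of_nonneg_right hmono j1.le)
        rw [hA.fderiv, abs_of_pos j1, ← ENNReal.ofReal_mul' j1.le, ← ENNReal.ofReal_one]
        exact ENNReal.ofReal_le_ofReal hκ
    _ = ENNReal.ofReal κ * volume (F s '' S) := by
        rw [lintegral_const_mul' _ _ ENNReal.ofReal_ne_top, hvol]
    _ ≤ ENNReal.ofReal κ * volume N := by
        rw [← measure_toMeasurable N]
        refine mul_le_mul_right (measure_mono ?_) _
        rintro _ ⟨x, hx, rfl⟩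
        exact hx.2

end Flow

/-! ### Almost every trajectory avoids the critical set -/

section Null

variable {C : Set (Sp d)} {F : ℝ → Sp d → Sp d} {x : Sp d} {s t : ℝ} {B : Set (Sp d)}

/-- At a given time, few trajectories are on a face. -/
theorem Frame.volume_avoiding_diff (hF : Frame Ω M φ V D φmin φmax Γ T W p H R L)
    (hf : IsFlow Ω M φ V T C F) (ht : t ∈ Icc 0 T) :
    volume {x | x ∈ avoiding Ω M C F (critical M H W) t ∧ F t x ∉ ⋃₀ M} = 0 := by
  rcases ht.1.eq_or_lt with rfl | htpos
  · convert measure_empty (μ := volume)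
    ext x
    simp only [mem_ofPred_eq, mem_empty_iff_false, iff_false, not_and, not_not]
    intro hx
    rw [hf.zero hx.1]
    exact hx.2.1
  set Z : Set (Sp d) := closedBall 0 R ∩ ⋃ h ∈ (H : Set (Sp d × ℝ)), {x : Sp d | inner ℝ h.1 x = h.2}
    with hZ
  have hZc : IsCompact Z := by
    refine (isCompact_closedBall _ _).inter_right (H.finite_toSet.isClosed_biUnion fun h _ => ?_)
    exact isClosed_eq (by fun_prop) continuous_const
  have hZ0 : volume Z = 0 := by
    refine measure_mono_null inter_subset_right ((measure_biUnion_null_iff H.countable_toSet).2 ?_)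
    exact fun h hh => volume_hyperplane (hF.faces.ne_zero h hh) h.2
  -- Local regularity puts the trajectory in cells just before t, during a time depending on x; E n
  -- collects the points for which 1 / (n + 1) is enough. For small δ they are, at time t - δ, in
  -- cells and within L δ of the null compact set Z, so the preimage estimate applies, and δ tends
  -- to 0.
  set E : ℕ → Set (Sp d) := fun n => {x | x ∈ avoiding Ω M C F (critical M H W) t ∧ F t x ∉ ⋃₀ M ∧
    ∀ r ∈ Icc 0 T, t - 1 / (n + 1) ≤ r → r < t → F r x ∈ ⋃₀ M} with hE
  have hsub : {x | x ∈ avoiding Ω M C F (critical M H W) t ∧ F t x ∉ ⋃₀ M} ⊆ ⋃ n, E n := by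
    rintro x ⟨hx, hxM⟩
    obtain ⟨ε, hε, h, -⟩ := hF.exists_isRegular (hf.traj hx.1)
      (hF.Icc_subset ht.2 ⟨ht.1, le_rfl⟩) (hx.2.2 t ⟨ht.1, le_rfl⟩)
    obtain ⟨n, hn⟩ := exists_nat_one_div_lt hε
    refine mem_iUnion.2 ⟨n, hx, hxM, fun r hr h1 h2 => h r (hF.Icc_subset le_rfl hr) ?_ h2.ne⟩
    rw [abs_le]
    constructor <;> linarith
  refine measure_mono_null hsub (measure_iUnion_null fun n => ?_)
  have hL := hF.L_pos
  have htend : Tendsto (fun δ : ℝ => ENNReal.ofReal (φmax / φmin * Real.exp (Γ / φmin * T)) *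
      volume (cthickening (L * δ) Z)) (𝓝[>] 0) (𝓝 0) := by
    have h1 : Tendsto (fun δ : ℝ => L * δ) (𝓝[>] 0) (𝓝 0) := by
      have : Tendsto (fun δ : ℝ => L * δ) (𝓝 0) (𝓝 (L * 0)) := tendsto_id.const_mul L
      rw [mul_zero] at this
      exact this.mono_left nhdsWithin_le_nhds
    have h2 := ENNReal.Tendsto.const_mul ((tendsto_measure_cthickening_of_isCompact (μ := volume)
      hZc).comp h1) (Or.inr (ENNReal.ofReal_ne_top (r := φmax / φmin * Real.exp (Γ / φmin * T))))
    rwa [hZ0, mul_zero] at h2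
  have hev : ∀ᶠ δ : ℝ in 𝓝[>] 0, volume (E n) ≤
      ENNReal.ofReal (φmax / φmin * Real.exp (Γ / φmin * T)) *
        volume (cthickening (L * δ) Z) := by
    filter_upwards [Ioo_mem_nhdsGT (lt_min htpos (show (0 : ℝ) < 1 / (n + 1) by positivity))]
      with δ hδ
    have h1 : δ < t := hδ.2.trans_le (min_le_left _ _)
    have h2 : δ < 1 / (n + 1) := hδ.2.trans_le (min_le_right _ _)
    have hr : t - δ ∈ Icc 0 T := ⟨by linarith, by linarith [ht.2, hδ.1]⟩
    refine le_trans (measure_mono fun x hx => ?_)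
      (hF.volume_preimage_le hf hr (cthickening (L * δ) Z))
    have htr := hf.traj hx.1.1
    have htT := hF.Icc_subset ht.2 ⟨ht.1, le_rfl⟩
    refine ⟨⟨avoiding_mono (by linarith [hδ.1]) hx.1,
      hx.2.2 _ hr (by linarith) (by linarith [hδ.1])⟩, ?_⟩
    refine mem_cthickening_of_dist_le _ (F t x) _ _ ⟨hF.mem_closedBall htr htT, ?_⟩ ?_
    · obtain ⟨h, hh, he⟩ := hF.faces.mem_hyperplane hF.data.mesh hF.data.domain.isOpen
        (htr.mem t htT) hx.2.1
      exact mem_iUnion₂.2 ⟨h, hh, he⟩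
    · rw [dist_eq_norm]
      have := hF.norm_sub_le htr htT (hF.Icc_subset le_rfl hr)
      rwa [show |t - δ - t| = δ by rw [show t - δ - t = -δ by ring, abs_neg, abs_of_pos hδ.1]]
        at this
  exact le_antisymm (ge_of_tendsto htend hev) (zero_le)

theorem IsThin.volume_eq_zero (h : IsThin B) (R : ℝ) : volume (B ∩ closedBall 0 R) = 0 := by
  obtain ⟨δ₀, hδ₀, h⟩ := h R 1 1 one_pos one_pos
  have htend : Tendsto (fun δ : ℝ => ENNReal.ofReal (1 * δ)) (𝓝[>] 0) (𝓝 0) := by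
    have : Tendsto (fun δ : ℝ => ENNReal.ofReal (1 * δ)) (𝓝 0) (𝓝 (ENNReal.ofReal (1 * 0))) :=
      (ENNReal.continuous_ofReal.comp (by fun_prop)).tendsto _
    rw [mul_zero, ENNReal.ofReal_zero] at this
    exact this.mono_left nhdsWithin_le_nhds
  refine le_antisymm (ge_of_tendsto htend ?_) zero_le
  filter_upwards [Ioo_mem_nhdsGT hδ₀] with δ hδ
  refine le_trans (measure_mono ?_) (h δ hδ.1 hδ.2.le)
  exact fun x hx => ⟨x, hx.2, hx.1, by simpa using hδ.1.le⟩

/-- Few trajectories meet the critical set. -/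
theorem Frame.volume_hitting (hF : Frame Ω M φ V D φmin φmax Γ T W p H R L)
    (hf : IsFlow Ω M φ V T C F) :
    volume {x | x ∈ Ω \ C ∧ x ∈ ⋃₀ M ∧ ∃ r ∈ Icc 0 T, F r x ∈ critical M H W} = 0 := by
  have hT := hF.T_pos
  have hL := hF.L_pos
  have hcl := hF.ext.isClosed_critical hF.data.mesh.finite H
  have hthin := hF.ext.isThin_critical hF.data.mesh.finite hF.faces
  set B := critical M H W with hB
  set κ := ENNReal.ofReal (φmax / φmin * Real.exp (Γ / φmin * T)) with hκ
  set S := {x | x ∈ Ω \ C ∧ x ∈ ⋃₀ M ∧ ∃ r ∈ Icc 0 T, F r x ∈ B} with hS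
  have key : ∀ ε > 0, volume S ≤ κ * ENNReal.ofReal (ε * T) := by
    intro ε hε
    obtain ⟨δ₀, hδ₀, hth⟩ := hthin R L ε hL hε
    obtain ⟨n, hn⟩ := exists_nat_gt (T / δ₀)
    have hn0 : (0 : ℝ) < n := (by positivity : 0 < T / δ₀).trans hn
    set δ := T / n with hδ
    have hδ0 : 0 < δ := by positivity
    have hδle : δ ≤ δ₀ := by
      rw [hδ, div_le_iff₀ hn0]
      rw [div_lt_iff₀ hδ₀] at hn
      linarith
    set N := {x | ∃ y ∈ closedBall (0 : Sp d) R, y ∈ B ∧ dist x y ≤ L * δ} with hN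
    have hNle := hth δ hδ0 hδle
    have hkmem : ∀ k ∈ Finset.range n, (k : ℝ) * δ ∈ Icc 0 T := by
      intro k hk
      have : (k : ℝ) ≤ n := by exact_mod_cast (Finset.mem_range.1 hk).le
      refine ⟨by positivity, ?_⟩
      calc (k : ℝ) * δ ≤ n * δ := by gcongr
        _ = T := by rw [hδ]; field_simp
    have hsub : S ⊆ (B ∩ closedBall 0 R) ∪ ⋃ k ∈ Finset.range n,
        ({x | x ∈ avoiding Ω M C F B (k * δ) ∧ F (k * δ) x ∉ ⋃₀ M} ∪
          {x | x ∈ arriving Ω M C F B (k * δ) ∧ F (k * δ) x ∈ N}) := by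
      rintro x ⟨hx, hxM, hhit⟩
      have htr := hf.traj hx
      have hcomp : IsCompact {r ∈ Icc 0 T | F r x ∈ B} := by
        have h1 : ContinuousOn (fun r => F r x) (Icc 0 T) :=
          htr.continuousOn.mono (hF.Icc_subset le_rfl)
        exact isCompact_Icc.of_isClosed_subset (h1.preimage_isClosed_of_isClosed isClosed_Icc hcl)
          (sep_subset _ _)
      -- The first hitting time: before it the trajectory avoids B, so the preimage estimate may be
      -- used without circularity.
      obtain ⟨τ, hτ, hmin⟩ := hcomp.exists_isLeast hhit
      rcases hτ.1.1.eq_or_lt with he | hpos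
      · left
        have h1 : F τ x ∈ B := hτ.2
        rw [← he, hf.zero hx] at h1
        exact ⟨h1, hF.subset_ball hx.1⟩
      · right
        -- k is the ceiling minus one, so that kδ < τ ≤ (k + 1)δ. The first inequality must be
        -- strict, as B has to be avoided up to time kδ included.
        have hm : 0 < ⌈τ / δ⌉₊ := Nat.ceil_pos.2 (by positivity)
        obtain ⟨k, hk⟩ := Nat.exists_eq_succ_of_ne_zero hm.ne'
        have hk1 : (k : ℝ) < τ / δ := Nat.lt_ceil.1 (by omega)
        have hk2 : τ / δ ≤ k + 1 := by
          have := Nat.le_ceil (τ / δ)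
          rw [hk] at this
          exact_mod_cast this
        have hkn : k ∈ Finset.range n := by
          have h1 : τ / δ ≤ n := by
            rw [div_le_iff₀ hδ0, hδ, mul_div_cancel₀ _ hn0.ne']
            exact hτ.1.2
          have h2 : (k : ℝ) < n := hk1.trans_le h1
          exact Finset.mem_range.2 (by exact_mod_cast h2)
        rw [lt_div_iff₀ hδ0] at hk1
        rw [div_le_iff₀ hδ0] at hk2
        have hav : x ∈ avoiding Ω M C F B (k * δ) := ⟨hx, hxM, fun r hr hrB =>
          absurd (hmin ⟨⟨hr.1, hr.2.trans (hkmem k hkn).2⟩, hrB⟩)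
            (not_le.2 (hr.2.trans_lt hk1))⟩
        refine mem_iUnion₂.2 ⟨k, hkn, ?_⟩
        by_cases hc : F (k * δ) x ∈ ⋃₀ M
        · refine Or.inr ⟨⟨hav, hc⟩, F τ x, hF.mem_closedBall htr (hF.Icc_subset le_rfl hτ.1), hτ.2,
            ?_⟩
          have h1 := hF.norm_sub_le htr (hF.Icc_subset le_rfl hτ.1)
            (hF.Icc_subset le_rfl (hkmem k hkn))
          rw [dist_eq_norm]
          refine h1.trans (mul_le_mul_of_nonneg_left ?_ hL.le)
          rw [abs_le]
          constructor <;> linarith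
        · exact Or.inl ⟨hav, hc⟩
    calc volume S ≤ volume (B ∩ closedBall 0 R) + ∑ k ∈ Finset.range n,
          volume ({x | x ∈ avoiding Ω M C F B (k * δ) ∧ F (k * δ) x ∉ ⋃₀ M} ∪
            {x | x ∈ arriving Ω M C F B (k * δ) ∧ F (k * δ) x ∈ N}) :=
          (measure_mono hsub).trans ((measure_union_le _ _).trans
            (by gcongr; exact measure_biUnion_finset_le _ _))
      _ ≤ 0 + ∑ k ∈ Finset.range n, κ * ENNReal.ofReal (ε * δ) := by
          rw [hthin.volume_eq_zero R]
          gcongr with k hk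
          refine (measure_union_le _ _).trans ?_
          rw [hF.volume_avoiding_diff hf (hkmem k hk), zero_add]
          exact (hF.volume_preimage_le hf (hkmem k hk) N).trans (by gcongr)
      _ = κ * ENNReal.ofReal (ε * T) := by
          rw [zero_add, Finset.sum_const, Finset.card_range, nsmul_eq_mul, mul_left_comm,
            ← ENNReal.ofReal_natCast, ← ENNReal.ofReal_mul n.cast_nonneg]
          congr 2
          rw [hδ]
          field_simp
  have htend : Tendsto (fun ε : ℝ => κ * ENNReal.ofReal (ε * T)) (𝓝[>] 0) (𝓝 0) := by
    have h1 : Tendsto (fun ε : ℝ => ENNReal.ofReal (ε * T)) (𝓝 0) (𝓝 (ENNReal.ofReal (0 * T))) :=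
      (ENNReal.continuous_ofReal.comp (by fun_prop)).tendsto _
    have h2 := ENNReal.Tendsto.const_mul h1 (Or.inr (show κ ≠ ⊤ from ENNReal.ofReal_ne_top))
    rw [zero_mul, ENNReal.ofReal_zero, mul_zero] at h2
    exact h2.mono_left nhdsWithin_le_nhds
  refine le_antisymm (ge_of_tendsto htend ?_) zero_le
  filter_upwards [self_mem_nhdsWithin] with ε hε
  exact key ε hε

theorem Frame.ae_avoiding (hF : Frame Ω M φ V D φmin φmax Γ T W p H R L)
    (hf : IsFlow Ω M φ V T C F) :
    ∀ᵐ x ∂(volume.restrict Ω), x ∈ avoiding Ω M C F (critical M H W) T := by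
  rw [ae_restrict_iff' hF.data.domain.isOpen.measurableSet, ae_iff]
  refine measure_mono_null (t := C ∪ (Ω \ ⋃₀ M) ∪
    {x | x ∈ Ω \ C ∧ x ∈ ⋃₀ M ∧ ∃ r ∈ Icc 0 T, F r x ∈ critical M H W}) (fun x hx => ?_) ?_
  · rw [mem_ofPred_eq, Classical.not_imp] at hx
    obtain ⟨hx, hx'⟩ := hx
    by_contra hcon
    simp only [mem_union, not_or] at hcon
    have h1 : x ∈ Ω \ C := ⟨hx, hcon.1.1⟩
    have h2 : x ∈ ⋃₀ M := by
      by_contra h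
      exact hcon.1.2 ⟨hx, h⟩
    exact hx' ⟨h1, h2, fun r hr hB => hcon.2 ⟨h1, h2, r, hr, hB⟩⟩
  · exact measure_union_null (measure_union_null hf.null
      (hF.faces.volume_diff hF.data.mesh hF.data.domain.isOpen)) (hF.volume_hitting hf)

theorem Frame.ae_arriving (hF : Frame Ω M φ V D φmin φmax Γ T W p H R L)
    (hf : IsFlow Ω M φ V T C F) (ht : t ∈ Icc 0 T) :
    ∀ᵐ x ∂(volume.restrict Ω), x ∈ arriving Ω M C F (critical M H W) t := by
  have h := ae_restrict_of_ae (s := Ω) (measure_eq_zero_iff_ae_notMem.1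
    (hF.volume_avoiding_diff hf ht))
  filter_upwards [hF.ae_avoiding hf, h] with x h1 h2
  have h3 := avoiding_mono ht.2 h1
  exact ⟨h3, not_not.1 fun hcon => h2 ⟨h3, hcon⟩⟩

/-- The flow does not charge negligible sets. -/
theorem Frame.ae_notMem (hF : Frame Ω M φ V D φmin φmax Γ T W p H R L)
    (hf : IsFlow Ω M φ V T C F) (ht : t ∈ Icc 0 T) {N : Set (Sp d)} (hN : volume N = 0) :
    ∀ᵐ x ∂(volume.restrict Ω), F t x ∉ N := by
  have h := hF.volume_preimage_le hf ht N
  rw [hN, mul_zero] at h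
  have h' := ae_restrict_of_ae (s := Ω) (measure_eq_zero_iff_ae_notMem.1 (le_antisymm h zero_le))
  filter_upwards [hF.ae_arriving hf ht, h'] with x h1 h2 h3
  exact h2 ⟨h1, h3⟩

end Null

/-! ### Estimates at positive times -/

section Forward

variable {C : Set (Sp d)} {F : ℝ → Sp d → Sp d} {x : Sp d} {s t : ℝ} {B : Set (Sp d)}

/-- The weak divergence is determined up to a null set only; this set is then avoided at almost all
times by almost all trajectories. -/
theorem Frame.volume_div_ne (hF : Frame Ω M φ V D φmin φmax Γ T W p H R L) :
    volume {z | z ∈ ⋃₀ M ∧ D z ≠ dv V z} = 0 := by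
  have hsub : {z | z ∈ ⋃₀ M ∧ D z ≠ dv V z} ⊆
      ⋃ K ∈ M, {z | ¬ (z ∈ Ω → z ∈ K → D z = dv (W K) z)} := by
    rintro z ⟨⟨K, hK, hzK⟩, hz⟩
    refine mem_iUnion₂.2 ⟨K, hK, fun h => hz ?_⟩
    rw [h (hF.data.mesh.subset K hK hzK) hzK, hF.ext.dv_eq hF.data.mesh hK hzK]
  refine measure_mono_null hsub ((measure_biUnion_null_iff hF.data.mesh.finite.countable).2
    fun K hK => ?_)
  exact ae_iff.1 ((ae_restrict_iff' hF.data.domain.isOpen.measurableSet).1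
    (hF.ext.weak_div_ae_eq hF.data.mesh hF.data.domain hF.data.hdiv hK))

/-- Almost no trajectory spends a positive time in a negligible set. -/
theorem Frame.ae_ae_notMem (hF : Frame Ω M φ V D φmin φmax Γ T W p H R L)
    (hf : IsFlow Ω M φ V T C F) {N : Set (Sp d)} (hN : volume N = 0) :
    ∀ᵐ x ∂(volume.restrict Ω), ∀ᵐ r : ℝ, r ∈ Icc 0 T → F r x ∉ N := by
  set G := avoiding Ω M C F (critical M H W) T with hG
  have hGm : MeasurableSet (G ×ˢ Icc (0 : ℝ) T) :=
    (hF.isOpen_avoiding hf le_rfl).measurableSet.prod measurableSet_Icc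
  -- Tonelli in (x, t): the slices at fixed t are null by the preimage estimate, hence so are almost
  -- all slices at fixed x. Joint measurability comes from joint continuity of the flow on G × [0,
  -- T].
  set A : Set (Sp d × ℝ) := {z | z ∈ G ×ˢ Icc (0 : ℝ) T ∧ F z.2 z.1 ∈ toMeasurable volume N} with hA
  have hAm : MeasurableSet A := by
    have h2 := hGm.subtype_image ((hF.continuousOn_flow hf le_rfl).domRestrict.measurable
      (measurableSet_toMeasurable volume N))
    convert h2 using 1
    ext z
    constructor
    · rintro ⟨hz, hzN⟩
      exact ⟨⟨z, hz⟩, hzN, rfl⟩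
    · rintro ⟨y, hy, rfl⟩
      exact ⟨y.2, hy⟩
  have hN' : volume (toMeasurable volume N) = 0 := by rw [measure_toMeasurable, hN]
  have hA0 : (volume.prod volume : Measure (Sp d × ℝ)) A = 0 := by
    rw [Measure.prod_apply_symm hAm]
    refine (lintegral_congr fun t => ?_).trans lintegral_zero
    by_cases ht : t ∈ Icc (0 : ℝ) T
    · have h1 := (ae_restrict_iff' hF.data.domain.isOpen.measurableSet).1 (hF.ae_notMem hf ht hN')
      refine measure_mono_null (fun x hx => ?_) (ae_iff.1 h1)
      exact fun h => h hx.1.1.1.1 hx.2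
    · exact measure_mono_null (fun x hx => ht hx.1.2) measure_empty
  have h1 := Measure.measure_ae_null_of_prod_null hA0
  filter_upwards [hF.ae_avoiding hf, ae_restrict_of_ae (s := Ω) h1] with x hx h2
  rw [Pi.zero_apply] at h2
  filter_upwards [measure_eq_zero_iff_ae_notMem.1 h2] with r hr hr' hrN
  exact hr ⟨⟨hx, hr'⟩, subset_toMeasurable _ _ hrN⟩

theorem Frame.continuousAt_rate (hF : Frame Ω M φ V D φmin φmax Γ T W p H R L) (hx : x ∈ ⋃₀ M) :
    ContinuousAt (rate φ V) x := by
  obtain ⟨K, hK, hxK⟩ := hx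
  refine (hF.ext.continuous_cellRate hK).continuousAt.congr ?_
  filter_upwards [(hF.data.mesh.polytopal K hK).isOpen.mem_nhds hxK] with y hy
  exact (hF.rate_eq hK hy).symm

/-- The mass `φ |JF_t|` solves a linear differential equation. -/
theorem Frame.integral_mul_rate (hF : Frame Ω M φ V D φmin φmax Γ T W p H R L)
    {γ : ℝ → Sp d} (hγ : Traj Ω M φ V T γ) (hs : s ∈ Icc 0 T) (a : ℝ) :
    IntervalIntegrable
      (fun t => a * Real.exp (∫ r in (0 : ℝ)..t, rate φ V (γ r)) * rate φ V (γ t)) volume 0 s ∧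
    ∫ t in (0 : ℝ)..s, a * Real.exp (∫ r in (0 : ℝ)..t, rate φ V (γ r)) * rate φ V (γ t) =
      a * Real.exp (∫ r in (0 : ℝ)..s, rate φ V (γ r)) - a := by
  have hT := hF.T_pos
  have hsT := hF.Icc_subset le_rfl hs
  have hTT : IntervalIntegrable (fun r => rate φ V (γ r)) volume (-T) T :=
    hF.intervalIntegrable_rate hγ ⟨le_rfl, by linarith⟩ ⟨by linarith, le_rfl⟩
  have h0s := hF.intervalIntegrable_rate hγ hF.zero_mem hsT
  have hIc : ContinuousOn (fun t => ∫ r in (0 : ℝ)..t, rate φ V (γ r)) (uIcc 0 s) :=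
    intervalIntegral.continuousOn_primitive_interval' h0s left_mem_uIcc
  have hmc : ContinuousOn (fun t => a * Real.exp (∫ r in (0 : ℝ)..t, rate φ V (γ r))) (uIcc 0 s) :=
    continuousOn_const.mul (Real.continuous_exp.comp_continuousOn hIc)
  have hint := h0s.continuousOn_mul hmc
  refine ⟨hint, ?_⟩
  rw [uIcc_of_le hs.1] at hmc
  rw [integral_eq_of_hasDerivAt_off_countable_of_le
    (fun t => a * Real.exp (∫ r in (0 : ℝ)..t, rate φ V (γ r))) _ hs.1 hγ.countable hmc ?_ hint]
  · simp
  · rintro t ⟨ht, htM⟩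
    have htT : t ∈ Ioo (-T) T := ⟨by linarith [ht.1], ht.2.trans_le hs.2⟩
    have htc : γ t ∈ ⋃₀ M := by
      by_contra hcon
      exact htM ⟨Ioo_subset_Icc_self htT, hcon⟩
    have h1 : ContinuousAt (fun r => rate φ V (γ r)) t :=
      (hF.continuousAt_rate htc).comp
        (hγ.continuousOn.continuousAt (Icc_mem_nhds htT.1 htT.2))
    have h2 : StronglyMeasurableAtFilter (fun r => rate φ V (γ r)) (𝓝 t) volume :=
      ⟨Ioc (-T) T, Ioc_mem_nhds htT.1 htT.2, hTT.1.aestronglyMeasurable⟩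
    have h3 := intervalIntegral.integral_hasDerivAt_right
      (hF.intervalIntegrable_rate hγ hF.zero_mem (Ioo_subset_Icc_self htT)) h2 h1
    refine (h3.exp.const_mul a).congr_deriv ?_
    ring

/-- The Jacobian at positive times. -/
theorem IsData.ae_jac (h : IsData Ω M φ V D φmin φmax Γ) (h0 : 0 < φmin) (hT : 0 < T)
    (hf : IsFlow Ω M φ V T C F) :
    ∀ᵐ x ∂(volume.restrict Ω), ∀ s ∈ Icc 0 T, F s x ∈ ⋃₀ M →
      DifferentiableAt ℝ (F s) x ∧
      IntervalIntegrable (fun t => |jac F t x| * D (F t x)) volume 0 s ∧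
      ∫ t in (0 : ℝ)..s, |jac F t x| * D (F t x) = φ (F s x) * |jac F s x| - φ x ∧
      |jac F s x| ≤ C₁ φmin φmax Γ s := by
  obtain ⟨W, p, H, R, L, hF⟩ := h.exists_frame h0 hT
  filter_upwards [hF.ae_avoiding hf, hF.ae_ae_notMem hf hF.volume_div_ne] with x hx hD s hs hM
  have htr := hf.traj hx.1
  have hjac : ∀ t ∈ Icc 0 T, F t x ∈ ⋃₀ M → DifferentiableAt ℝ (F t) x ∧ 0 < jac F t x ∧
      jac F t x ≤ φmax / φmin * Real.exp (Γ / φmin * t) ∧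
      φ (F t x) * jac F t x = φ x * Real.exp (∫ r in (0 : ℝ)..t, rate φ V (F r x)) := by
    intro t ht htM
    obtain ⟨A, hA, hA'⟩ := hF.hasFDerivAt hf le_rfl hx ht htM
    obtain ⟨j1, j2, -⟩ := hF.jac_bounds hf hx.1 ht htM hA'
    rw [jac, hA.fderiv]
    exact ⟨hA.differentiableAt, j1, j2, hA'⟩
  obtain ⟨i1, i2⟩ := hF.integral_mul_rate htr hs (φ x)
  -- At almost every time (φ JF_t)(div V / φ) = JF_t div V, the porosity being evaluated at F_t(x),
  -- where it cancels.
  have hae : ∀ᵐ t, t ∈ uIoc 0 s →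
      φ x * Real.exp (∫ r in (0 : ℝ)..t, rate φ V (F r x)) * rate φ V (F t x) =
        |jac F t x| * D (F t x) := by
    filter_upwards [hD, Frame.ae_mem_cells htr] with t h1 h2 ht
    rw [uIoc_of_le hs.1] at ht
    have ht' : t ∈ Icc 0 T := ⟨ht.1.le, ht.2.trans hs.2⟩
    have htM := h2 (hF.Icc_subset le_rfl ht')
    obtain ⟨-, j1, -, j3⟩ := hjac t ht' htM
    have hDt : D (F t x) = dv V (F t x) := by
      by_contra hne
      exact h1 ht' ⟨htM, hne⟩
    rw [abs_of_pos j1, hDt, ← j3, rate]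
    have := (h0.trans_le (hF.φ_ge htM)).ne'
    field_simp
  obtain ⟨k0, k1, k2, k3⟩ := hjac s hs hM
  refine ⟨k0, i1.congr_ae ((ae_restrict_iff' measurableSet_uIoc).2 hae), ?_, ?_⟩
  · rw [← intervalIntegral.integral_congr_ae hae, i2, abs_of_pos k1, k3]
  · rw [abs_of_pos k1, C₁, abs_of_nonneg hs.1]
    exact k2

theorem IsData.ae_mem_cell (h : IsData Ω M φ V D φmin φmax Γ) (h0 : 0 < φmin) (hT : 0 < T)
    (hf : IsFlow Ω M φ V T C F) (hs : s ∈ Icc 0 T) :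
    ∀ᵐ x ∂(volume.restrict Ω), F s x ∈ ⋃₀ M := by
  obtain ⟨W, p, H, R, L, hF⟩ := h.exists_frame h0 hT
  exact (hF.ae_arriving hf hs).mono fun x hx => hx.2

/-- Change of variables along the flow. -/
theorem Frame.lintegral_le (hF : Frame Ω M φ V D φmin φmax Γ T W p H R L)
    (hf : IsFlow Ω M φ V T C F) (hs : s ∈ Icc 0 T) {a b : Sp d → ℝ≥0∞}
    (hab : ∀ x ∈ arriving Ω M C F (critical M H W) s, ∀ j : ℝ,
      φ (F s x) * j = φ x * Real.exp (∫ r in (0 : ℝ)..s, rate φ V (F r x)) →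
        a x ≤ ENNReal.ofReal |j| * b (F s x)) :
    ∫⁻ x in Ω, a x ≤ ∫⁻ x in Ω, b x := by
  set S := arriving Ω M C F (critical M H W) s with hS
  have hSm : MeasurableSet S := (hF.isOpen_arriving hf hs).measurableSet
  have hder : ∀ x ∈ S, HasFDerivWithinAt (F s) (fderiv ℝ (F s) x) S x := fun x hx => by
    obtain ⟨A, hA, -⟩ := hF.hasFDerivAt hf hs.2 hx.1 (right_mem_Icc.2 hs.1) hx.2
    exact hA.differentiableAt.hasFDerivAt.hasFDerivWithinAt
  have hcv := lintegral_image_eq_lintegral_abs_det_fderiv_mul volume hSm hder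
    ((hF.injOn_avoiding hf hs).mono fun x hx => hx.1) b
  have hSΩ : S ⊆ Ω := fun x hx => hx.1.1.1
  have hae : (Ω : Set (Sp d)) =ᵐ[volume] S := by
    have h1 := (ae_restrict_iff' hF.data.domain.isOpen.measurableSet).1 (hF.ae_arriving hf hs)
    filter_upwards [h1] with x hx
    exact propext ⟨hx, fun h => hSΩ h⟩
  calc ∫⁻ x in Ω, a x = ∫⁻ x in S, a x := by rw [Measure.restrict_congr_set hae]
    _ ≤ ∫⁻ x in S, ENNReal.ofReal |(fderiv ℝ (F s) x).det| * b (F s x) := by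
        refine setLIntegral_mono' hSm fun x hx => ?_
        obtain ⟨A, hA, hA'⟩ := hF.hasFDerivAt hf hs.2 hx.1 (right_mem_Icc.2 hs.1) hx.2
        rw [hA.fderiv]
        exact hab x hx _ hA'
    _ = ∫⁻ x in F s '' S, b x := hcv.symm
    _ ≤ ∫⁻ x in Ω, b x := by
        refine lintegral_mono_set ?_
        rintro _ ⟨x, hx, rfl⟩
        exact (hf.traj hx.1.1).mem s (hF.Icc_subset hs.2 ⟨hs.1, le_rfl⟩)

theorem ofReal_mul_le {a c w : ℝ} (ha : 0 ≤ a) (hac : a ≤ c) :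
    ENNReal.ofReal (a * w) ≤ ENNReal.ofReal (c * w) := by
  rcases le_total 0 w with hw | hw
  · exact ENNReal.ofReal_le_ofReal (mul_le_mul_of_nonneg_right hac hw)
  · rw [ENNReal.ofReal_of_nonpos (mul_nonpos_of_nonneg_of_nonpos ha hw)]
    exact zero_le

/-- This is 1 - z ≤ exp(-z) multiplied by exp z. It gives the stability constant the form 1 + O(s).
-/
theorem exp_le_one_add_mul_exp (z : ℝ) : Real.exp z ≤ 1 + z * Real.exp z := by
  have h1 := Real.add_one_le_exp (-z)
  have h2 := mul_le_mul_of_nonneg_right h1 (Real.exp_pos z).le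
  rw [← Real.exp_add, neg_add_cancel, Real.exp_zero] at h2
  linarith

/-- Stability of the transport by the flow, at positive times. -/
theorem IsData.lintegral_transport_le (h : IsData Ω M φ V D φmin φmax Γ) (h0 : 0 < φmin)
    (hT : 0 < T) (hf : IsFlow Ω M φ V T C F) (hs : s ∈ Icc 0 T) {u v : Sp d → ℝ}
    (huv : ∀ᵐ x ∂(volume.restrict Ω), u x = v (F s x)) :
    ∫⁻ x in Ω, ENNReal.ofReal (φ x * u x) ≤
      ENNReal.ofReal (1 + Γ * C₁ φmin φmax Γ T / φmin * s) *
        ∫⁻ x in Ω, ENNReal.ofReal (φ x * v x) ∧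
    ∫⁻ x in Ω, ENNReal.ofReal (u x) ≤ ENNReal.ofReal (C₁ φmin φmax Γ T / φmin) *
      ∫⁻ x in Ω, ENNReal.ofReal (φ x * v x) := by
  obtain ⟨W, p, H, R, L, hF⟩ := h.exists_frame h0 hT
  have hC₁ : C₁ φmin φmax Γ T = φmax / φmin * Real.exp (Γ / φmin * T) := by
    rw [C₁, abs_of_pos hT]
  constructor
  · rw [← lintegral_const_mul' _ _ ENNReal.ofReal_ne_top,
      lintegral_congr_ae (g := fun x => ENNReal.ofReal (φ x * v (F s x)))
        (huv.mono fun x hx => by simp only [hx])]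
    refine hF.lintegral_le hf hs fun x hx j hj => ?_
    obtain ⟨j1, -, -⟩ := hF.jac_bounds hf hx.1.1 hs hx.2 hj
    have hφx : 0 < φ x := h0.trans_le (hF.φ_ge hx.1.2.1)
    have hφF : 0 < φ (F s x) := h0.trans_le (hF.φ_ge hx.2)
    have hΓ := hF.div_nonneg hx.2
    have i1 := (abs_le.1 (hF.abs_integral_rate_le (hf.traj hx.1.1) hs)).1
    have hmax : 1 ≤ φmax / φmin := by
      obtain ⟨b1, b2⟩ := h.bounds x hx.1.1.1
      exact (one_le_div h0).2 (b1.trans b2)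
    have hexp : Real.exp (Γ / φmin * s) ≤ 1 + Γ * C₁ φmin φmax Γ T / φmin * s := by
      refine (exp_le_one_add_mul_exp _).trans ?_
      have e1 : Real.exp (Γ / φmin * s) ≤ C₁ φmin φmax Γ T := by
        rw [hC₁]
        calc Real.exp (Γ / φmin * s) ≤ Real.exp (Γ / φmin * T) :=
              Real.exp_le_exp.2 (mul_le_mul_of_nonneg_left hs.2 hΓ)
          _ ≤ φmax / φmin * Real.exp (Γ / φmin * T) :=
              le_mul_of_one_le_left (Real.exp_pos _).le hmax
      have e2 := mul_le_mul_of_nonneg_left e1 (mul_nonneg hΓ hs.1)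
      have e3 : Γ * C₁ φmin φmax Γ T / φmin * s = Γ / φmin * s * C₁ φmin φmax Γ T := by ring
      linarith
    set c := 1 + Γ * C₁ φmin φmax Γ T / φmin * s
    have hc : 0 < c := (Real.exp_pos _).trans_le hexp
    rw [abs_of_pos j1, ← ENNReal.ofReal_mul hc.le, ← ENNReal.ofReal_mul j1.le, ← mul_assoc,
      ← mul_assoc]
    refine ofReal_mul_le hφx.le ?_
    have e4 : 1 ≤ c * Real.exp (∫ r in (0 : ℝ)..s, rate φ V (F r x)) := by
      calc (1 : ℝ) ≤ Real.exp (Γ / φmin * s) * Real.exp (∫ r in (0 : ℝ)..s, rate φ V (F r x)) := by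
            rw [← Real.exp_add]; exact Real.one_le_exp (by linarith)
        _ ≤ _ := mul_le_mul_of_nonneg_right hexp (Real.exp_pos _).le
    calc φ x ≤ φ x * (c * Real.exp (∫ r in (0 : ℝ)..s, rate φ V (F r x))) :=
          le_mul_of_one_le_right hφx.le e4
      _ = c * (φ (F s x) * j) := by rw [hj]; ring
      _ = j * c * φ (F s x) := by ring
  -- The factor 1 puts the integrand in the form a * w that `ofReal_mul_le` expects.
  · rw [← lintegral_const_mul' _ _ ENNReal.ofReal_ne_top,
      lintegral_congr_ae (g := fun x => ENNReal.ofReal (1 * v (F s x)))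
        (huv.mono fun x hx => by simp only [hx, one_mul])]
    refine hF.lintegral_le hf hs fun x hx j hj => ?_
    obtain ⟨j1, -, j3⟩ := hF.jac_bounds hf hx.1.1 hs hx.2 hj
    have hφF := hF.φ_ge hx.2
    have hmono := hF.exp_mono hx.2 hs.2
    rw [← hC₁] at hmono
    have hc1 : 1 ≤ C₁ φmin φmax Γ T * j := j3.trans (mul_le_mul_of_nonneg_right hmono j1.le)
    have hc : 0 < C₁ φmin φmax Γ T := pos_of_mul_pos_left (zero_lt_one.trans_le hc1) j1.le
    rw [abs_of_pos j1, ← ENNReal.ofReal_mul (by positivity), ← ENNReal.ofReal_mul j1.le,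
      ← mul_assoc, ← mul_assoc]
    refine ofReal_mul_le zero_le_one ?_
    have e5 : 1 ≤ φ (F s x) / φmin := (one_le_div h0).2 hφF
    calc (1 : ℝ) ≤ (C₁ φmin φmax Γ T * j) * (φ (F s x) / φmin) :=
          one_le_mul_of_one_le_of_one_le hc1 e5
      _ = j * (C₁ φmin φmax Γ T / φmin) * φ (F s x) := by ring

end Forward

/-! ### Time reversal -/

section Reversal

variable {C : Set (Sp d)} {F : ℝ → Sp d → Sp d}

/-- The assumptions are invariant under V ↦ -V with D ↦ -D, and t ↦ F (-t) is a flow of the reversed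
field, so estimates at positive times suffice. -/
theorem IsData.neg (h : IsData Ω M φ V D φmin φmax Γ) : IsData Ω M φ (-V) (-D) φmin φmax Γ where
  domain := h.domain
  mesh := h.mesh
  smooth := h.smooth
  bounds := h.bounds
  hdiv :=
    { memLp_field := h.hdiv.memLp_field.neg
      memLp_div := h.hdiv.memLp_div.neg
      weak_div := fun ψ h1 h2 h3 => by
        have := h.hdiv.weak_div ψ h1 h2 h3
        simp only [Pi.neg_apply, map_neg, mul_neg, integral_neg, this] }
  polynomial := fun K hK i => by
    obtain ⟨P, hP⟩ := h.polynomial K hK i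
    exact ⟨-P, fun x hx => by rw [map_neg, ← hP x hx]; rfl⟩
  div_bound := h.div_bound.mono fun x hx => by rwa [Pi.neg_apply, abs_neg]
  no_flux := fun ψ h1 h2 => by
    have := h.no_flux ψ h1 h2
    simp only [Pi.neg_apply, map_neg, mul_neg]
    rw [← neg_zero, ← this, ← integral_neg]
    refine integral_congr_ae (Eventually.of_forall fun x => ?_)
    simp only
    ring

theorem neg_mem_Icc_neg {t : ℝ} (ht : t ∈ Icc (-T) T) : -t ∈ Icc (-T) T :=
  ⟨neg_le_neg ht.2, by linarith [ht.1]⟩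

theorem IsTrajectory.neg {x : Sp d} {γ : ℝ → Sp d} (h : IsTrajectory Ω M φ V T x γ) :
    IsTrajectory Ω M φ (-V) T x (fun t => γ (-t)) where
  init := by simpa using h.init
  mem := fun t ht => h.mem _ (neg_mem_Icc_neg ht)
  lipschitz := by
    obtain ⟨L, hL⟩ := h.lipschitz
    refine ⟨L, LipschitzOnWith.of_dist_le_mul fun s hs t ht => ?_⟩
    have := hL.dist_le_mul _ (neg_mem_Icc_neg hs) _ (neg_mem_Icc_neg ht)
    rwa [dist_neg_neg] at this
  ode := by
    obtain ⟨N, hN, h⟩ := h.ode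
    refine ⟨(fun t => -t) '' N, hN.image _, fun t ht => ?_⟩
    have ht' : -t ∈ Icc (-T) T \ N := ⟨neg_mem_Icc_neg ht.1, fun hm => ht.2 ⟨-t, hm, neg_neg t⟩⟩
    obtain ⟨h1, h2⟩ := h (-t) ht'
    refine ⟨h1, ?_⟩
    have h3 := h2.scomp t ((hasDerivAt_neg t).hasDerivWithinAt (s := Icc (-T) T))
      fun r hr => neg_mem_Icc_neg hr
    refine h3.congr_deriv ?_
    rw [neg_one_smul, Pi.neg_apply, smul_neg]

theorem IsFlow.neg (h : IsFlow Ω M φ V T C F) : IsFlow Ω M φ (-V) T C (fun t => F (-t)) where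
  subset := h.subset
  isOpen_compl := h.isOpen_compl
  null := h.null
  trajectory := fun x hx => (h.trajectory x hx).neg

end Reversal

end EllamFlow

/-! ### Conclusion for times of both signs -/

theorem lemma5p2 {d : ℕ} (T φmin φmax Γ : ℝ) (hT : 0 < T) (hφmin : 0 < φmin)
    (Ω : Set (EllamFlow.Sp d)) (M : Set (Set (EllamFlow.Sp d)))
    (φ : EllamFlow.Sp d → ℝ) (V : EllamFlow.Sp d → EllamFlow.Sp d) (D : EllamFlow.Sp d → ℝ)
    (hdata : EllamFlow.IsData Ω M φ V D φmin φmax Γ)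
    (C : Set (EllamFlow.Sp d)) (F : ℝ → EllamFlow.Sp d → EllamFlow.Sp d)
    (hF : EllamFlow.IsFlow Ω M φ V T C F) :
    -- for a.e. `x` and all times `s`, except the countably many when `F_s(x)` is on a face
    (∀ᵐ x ∂(MeasureTheory.volume.restrict Ω),
      {s ∈ Set.Icc (-T) T | F s x ∉ ⋃₀ M}.Countable ∧
      ∀ s ∈ Set.Icc (-T) T, F s x ∈ ⋃₀ M →
        DifferentiableAt ℝ (F s) x ∧
        IntervalIntegrable (fun t => |EllamFlow.jac F t x| * D (F t x))
          MeasureTheory.volume 0 s ∧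
        ∫ t in (0 : ℝ)..s, |EllamFlow.jac F t x| * D (F t x)
          = φ (F s x) * |EllamFlow.jac F s x| - φ x ∧
        |EllamFlow.jac F s x| ≤ EllamFlow.C₁ φmin φmax Γ s) ∧
    -- for each time `s`, the restriction `F_s(x) ∈ ⋃₀ M` above only excludes a null set of `x`
    (∀ s ∈ Set.Icc (-T) T, ∀ᵐ x ∂(MeasureTheory.volume.restrict Ω), F s x ∈ ⋃₀ M) ∧
    -- stability of nonnegative solutions of the advection equation
    (∀ w : EllamFlow.Sp d → ℝ → ℝ, EllamFlow.IsAdvectionSolution Ω T F w →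
      (∀ t ∈ Set.Icc (-T) T, ∀ᵐ x ∂(MeasureTheory.volume.restrict Ω), 0 ≤ w x t) →
      ∀ s ∈ Set.Icc (-T) T, ∀ t ∈ Set.Icc (-T) T, s - t ∈ Set.Icc (-T) T →
        ∫⁻ x in Ω, ENNReal.ofReal (φ x * w x (t - s))
          ≤ ENNReal.ofReal (1 + Γ * EllamFlow.C₁ φmin φmax Γ T / φmin * |s|)
            * ∫⁻ x in Ω, ENNReal.ofReal (φ x * w x t) ∧
        ∫⁻ x in Ω, ENNReal.ofReal (w x (t - s))
          ≤ ENNReal.ofReal (EllamFlow.C₁ φmin φmax Γ T / φmin)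
            * ∫⁻ x in Ω, ENNReal.ofReal (φ x * w x t)) := by
  have hneg := hdata.neg
  have hFneg := hF.neg
  have htraj : ∀ᵐ x ∂(MeasureTheory.volume.restrict Ω), x ∈ Ω \ C := by
    have hΩ := hdata.domain.isOpen.measurableSet
    filter_upwards [MeasureTheory.ae_restrict_of_ae (s := Ω)
      (MeasureTheory.measure_eq_zero_iff_ae_notMem.1 hF.null), MeasureTheory.ae_restrict_mem hΩ]
      with x h1 h2
    exact ⟨h2, h1⟩
  refine ⟨?_, fun s hs => ?_, fun w hw _ s hs t ht hst => ?_⟩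
  · filter_upwards [htraj, hdata.ae_jac hφmin hT hF, hneg.ae_jac hφmin hT hFneg] with x h0 h1 h2
    refine ⟨(hF.traj h0).countable, fun s hs hM => ?_⟩
    rcases le_total 0 s with h | h
    · exact h1 s ⟨h, hs.2⟩ hM
    · obtain ⟨k0, k1, k2, k3⟩ := h2 (-s) ⟨by linarith, by linarith [hs.1]⟩ (by rwa [neg_neg])
      have e : ∀ t, EllamFlow.jac (fun t => F (-t)) t x = EllamFlow.jac F (-t) x := fun t => rfl
      have e' : ∀ t, |EllamFlow.jac (fun t => F (-t)) t x| * (-D) (F (-t) x) =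
          -(|EllamFlow.jac F (-t) x| * D (F (-t) x)) := fun t => by
        rw [e, Pi.neg_apply, mul_neg]
      simp only [e'] at k1 k2
      rw [e, neg_neg] at k2 k3
      rw [neg_neg] at k0
      rw [EllamFlow.C₁, abs_neg] at k3
      refine ⟨k0, ?_, ?_, k3⟩
      · rw [IntervalIntegrable.iff_comp_neg]
        have := k1.neg
        simpa only [Pi.neg_def, neg_neg, neg_zero] using this
      · rw [← k2, intervalIntegral.integral_neg, intervalIntegral.integral_comp_neg
          (fun t => |EllamFlow.jac F t x| * D (F t x)), neg_neg, neg_zero,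
          intervalIntegral.integral_symm]
  · rcases le_total 0 s with h | h
    · exact hdata.ae_mem_cell hφmin hT hF ⟨h, hs.2⟩
    · have := hneg.ae_mem_cell hφmin hT hFneg (s := -s) ⟨by linarith, by linarith [hs.1]⟩
      simpa only [neg_neg] using this
  -- Transport between the times t - s and t reads w(x, t - s) = w(F_s(x), t), since t - (t - s) =
  -- s.
  · have htr := hw.transport t ht (t - s) ⟨by linarith [hst.2], by linarith [hst.1]⟩
      (by rwa [sub_sub_cancel])
    rw [sub_sub_cancel] at htr
    rcases le_total 0 s with h | h
    · rw [abs_of_nonneg h]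
      exact hdata.lintegral_transport_le hφmin hT hF ⟨h, hs.2⟩ htr
    · rw [abs_of_nonpos h]
      exact hneg.lintegral_transport_le hφmin hT hFneg (s := -s)
        ⟨by linarith, by linarith [hs.1]⟩ (by simpa only [neg_neg] using htr)
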